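/- **Localized virial identity.** Let $n\ge 1$, let $1\le p<2^*-1$, where $2^*=\frac{2n}{n-2}$ if $n\ge 3$ and $2^*=\infty$ if $n=1,2$, and let $\lambda\in\mathbb R$. Let $M$ be a real skew-symmetric $n\times n$ matrix, $A(x)=Mx$, and let $V\in C^1(\mathbb R^n;\mathbb R)$. For $1<r<\infty$ let $\mathscr H^{1,r}=\{f\in L^r(\mathbb R^n;\mathbb C):\nabla f,\ xf\in L^r\}$ (weak gradient) with the norm $\|\nabla f\|_r+\|xf\|_r+\|f\|_r$, and $\mathscr H^1=\mathscr H^{1,2}$. Let $0<T\le\infty$ and let $u$ be a solution on $[0,T)$ of $$iu_t=-\Delta u+Vu-\lambda|u|^{p-1}u+iA\cdot\nabla u .$$ As usual for this equation, this means that $u$ lies in the class of the local well-posedness theory, $u\in C([0,T),\mathscr H^1)\cap L^q_{\rm loc}([0,T),\mathscr H^{1,p+1})$ with $q=\frac{4(p+1)}{n(p-1)}$ ($q=\infty$ if $p=1$), and that the equation holds in the sense of distributions on $\mathbb R^n$ at every time $t\in[0,T)$ (with a one-sided time derivative at $t=0$). Let $\varphi\in C_0^\infty(\mathbb R^n)$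 be real-valued and radial, write $r=|x|$, and let $\varphi',\varphi''$ be the first two derivatives of $\varphi$ as a function of $r$. Set $J(t)=\int\varphi|u(t)|^2\,dx$. Then $J$ is twice differentiable on $[0,T)$ (one-sidedly at $t=0$), and for every $t\in[0,T)$ $$J'(t)=2\,\mathrm{Im}\int\overline u\,\nabla\varphi\cdot\nabla u\,dx,$$ $$\begin{aligned}J''(t)=&-\int\Delta^2\varphi\,|u|^2\,dx-\frac{2\lambda(p-1)}{p+1}\int\Delta\varphi\,|u|^{p+1}\,dx+4\int\Big(\frac{\varphi''}{r^2}-\frac{\varphi'}{r^3}\Big)|x\cdot\nabla u|^2\,dx\\&+4\int\frac{\varphi'}{r}|\nabla u|^2\,dx-2\int\nabla\varphi\cdot\nabla V\,|u|^2\,dx,\end{aligned}$$ where all the integrals, including the one defining $J(t)$, converge absolutely. (No term with $A$ occurs.) -/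

import Mathlib

open MeasureTheory Filter Topology InnerProductSpace
open scoped ENNReal ContDiff Gradient Laplacian Matrix

noncomputable section

namespace RNLS

variable {n : ℕ}

/-- Real test functions on `ℝⁿ`: smooth with compact support. -/
def IsTest (ψ : EuclideanSpace ℝ (Fin n) → ℝ) : Prop :=
  ContDiff ℝ ∞ ψ ∧ HasCompactSupport ψ

/-- `g = (g₁, …, gₙ)` is the gradient of `f` in the sense of distributions on `ℝⁿ`. -/
def IsWeakGrad (f : EuclideanSpace ℝ (Fin n) → ℂ)
    (g : EuclideanSpace ℝ (Fin n) → EuclideanSpace ℂ (Fin n)) : Prop :=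
  LocallyIntegrable f ∧ LocallyIntegrable g ∧
    ∀ ψ : EuclideanSpace ℝ (Fin n) → ℝ, IsTest ψ → ∀ j : Fin n,
      ∫ x, (((∇ ψ x) j : ℝ) : ℂ) * f x = - ∫ x, (ψ x : ℂ) * g x j

open Classical in
/-- The weak gradient `∇f` (unique up to null sets; `0` if there is none). -/
def weakGrad (f : EuclideanSpace ℝ (Fin n) → ℂ) :
    EuclideanSpace ℝ (Fin n) → EuclideanSpace ℂ (Fin n) :=
  if h : ∃ g, IsWeakGrad f g then h.choose else 0

/-- The weighted Sobolev space `ℋ^{1,r} = {f ∈ L^r : ∇f, x f ∈ L^r}`. -/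
def MemH (r : ℝ≥0∞) (f : EuclideanSpace ℝ (Fin n) → ℂ) : Prop :=
  MemLp f r volume ∧ (∃ g, IsWeakGrad f g) ∧ MemLp (weakGrad f) r volume ∧
    MemLp (fun x => ‖x‖ • f x) r volume

/-- The norm `‖∇f‖_r + ‖x f‖_r + ‖f‖_r` of `ℋ^{1,r}`, set to `∞` for functions outside
that space. -/
def normH (r : ℝ≥0∞) (f : EuclideanSpace ℝ (Fin n) → ℂ) : ℝ≥0∞ :=
  open Classical in
  if MemH r f then
    eLpNorm (weakGrad f) r volume + eLpNorm (fun x => ‖x‖ • f x) r volume + eLpNorm f r volume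
  else ⊤

/-- The time interval `[0, T)`, where `T = ∞` is allowed. -/
def timeInterval (T : EReal) : Set ℝ := {t | 0 ≤ t ∧ (t : EReal) < T}

/-- `u ∈ C([0,T), ℋ^1)`, where `ℋ^1 = ℋ^{1,2}`. -/
def ContinuousInH1 (T : EReal) (u : ℝ → EuclideanSpace ℝ (Fin n) → ℂ) : Prop :=
  (∀ t ∈ timeInterval T, MemH 2 (u t)) ∧
    ∀ t ∈ timeInterval T,
      Tendsto (fun s => normH 2 (fun x => u s x - u t x)) (𝓝[timeInterval T] t) (𝓝 0)

/-- `u ∈ L^q_loc([0,T), ℋ^{1,r})`. Strong measurability in time is automatic for the functions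
of class `C([0,T), ℋ^1)` for which this is used. -/
def MemLqLocH (T : EReal) (q r : ℝ≥0∞) (u : ℝ → EuclideanSpace ℝ (Fin n) → ℂ) : Prop :=
  ∀ τ ∈ timeInterval T,
    eLpNorm (fun t => normH r (u t)) q (volume.restrict (Set.Icc 0 τ)) < ⊤

/-- The bilinear (not sesquilinear) product `a · z = ∑ⱼ aⱼ zⱼ` of a real and a complex vector. -/
def dotC (a : EuclideanSpace ℝ (Fin n)) (z : EuclideanSpace ℂ (Fin n)) : ℂ :=
  ∑ j, (a j : ℂ) * z j

/-- The vector field `A(x) = M x`. -/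
def rotField (M : Matrix (Fin n) (Fin n) ℝ) (x : EuclideanSpace ℝ (Fin n)) :
    EuclideanSpace ℝ (Fin n) :=
  WithLp.toLp 2 (M *ᵥ x.ofLp)

/-- `i u_t = -Δu + V u - λ|u|^{p-1}u + i A·∇u`, `A = M x`, on `[0,T)`: at every time in `[0,T)`
both sides agree as distributions on `ℝⁿ` (the derivative at `t = 0` is one-sided). -/
def SolvesNLS (M : Matrix (Fin n) (Fin n) ℝ) (V : EuclideanSpace ℝ (Fin n) → ℝ) (lam p : ℝ)
    (T : EReal) (u : ℝ → EuclideanSpace ℝ (Fin n) → ℂ) : Prop :=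
  ∀ ψ : EuclideanSpace ℝ (Fin n) → ℝ, IsTest ψ → ∀ t ∈ timeInterval T,
    HasDerivWithinAt (fun s => Complex.I * ∫ x, (ψ x : ℂ) * u s x)
      ((∫ x, dotC (∇ ψ x) (weakGrad (u t) x))
        + (∫ x, (ψ x : ℂ) * ((V x : ℂ) * u t x))
        - (lam : ℂ) * (∫ x, (ψ x : ℂ) * (((‖u t x‖ ^ (p - 1) : ℝ) : ℂ) * u t x))
        + ∫ x, (ψ x : ℂ) * (Complex.I * dotC (rotField M x) (weakGrad (u t) x)))
      (timeInterval T) t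

/-- Solutions of the rotational NLS on `[0,T)` in the class of the local well-posedness theory:
`u ∈ C([0,T), ℋ^1) ∩ L^q_loc([0,T), ℋ^{1,r})` with `r = p + 1`, `q = 4(p+1)/(n(p-1))`
(`q = ∞` if `p = 1`), satisfying the equation in the sense of distributions. -/
structure IsSolution (M : Matrix (Fin n) (Fin n) ℝ) (V : EuclideanSpace ℝ (Fin n) → ℝ)
    (lam p : ℝ) (T : EReal) (u : ℝ → EuclideanSpace ℝ (Fin n) → ℂ) : Prop where
  continuous : ContinuousInH1 T u
  memLqLoc : MemLqLocH T (ENNReal.ofReal (4 * (p + 1)) / ENNReal.ofReal (n * (p - 1)))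
    (ENNReal.ofReal (p + 1)) u
  equation : SolvesNLS M V lam p T u

end RNLS

end

/-! Write X = ∇φ·∇, Y = 2X + Δφ and B = A·∇. Formally, pairing the equation with iφu gives J' = K
with K = 2 Im ∫ ū Xu, and pairing it with Yu gives K'. Integration by parts turns -Δ into 4∫ D²φ(∇u,
∇ū) - ∫ Δ²φ |u|², the potential into -2∫ ∇φ·∇V |u|², and the power into a multiple of ∫ Δφ
|u|^{p+1}. The rotation drops out: since φ is radial and M is skew, Bφ = 0 and div A = 0, so B
commutes with X and is antisymmetric (`gradDot_rotD`, `integral_rotD_morY`). For radial φ the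
Hessian form splits into the two gradient terms of the statement (`hessC_radial`).

The formal computation is not licit for u(t) in the energy space: Yu is only in L², while Δu is only
a distribution. Testing the equation against mollifying kernels makes v = η_k * u smooth in x and
differentiable in t at each point x (`SolvesNLS.hasDerivWithinAt_mol`). For v the identities are
exact (`integral_inner_rhsSmooth`, `integral_inner_rhsSmooth_morC`), up to the commutators of
mollification with V, with A·∇ and with the power (`integral_inner_rhsC`). On balls the linear
commutators tend to zero in L² and the one with the power in L^{(p+1)/p}, the latter by the local
Sobolev embedding into L^{p+1} (`exists_sobolev`).

It remains to bound what the commutators are tested against. For J' this is iφv, bounded in L² and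
L^{p+1} uniformly in time. For K' it is Yv, whose L^{p+1} norm involves ∇v. That norm is controlled
only through the class L^q in time, and q ≥ 1 yields an integrable majorant
(`exists_integrable_bound_grad`). The integrated identities then pass to the limit by dominated
convergence. As the limiting right-hand sides are continuous in time, the fundamental theorem of
calculus gives a derivative at every time, not merely almost every one
(`hasDerivWithinAt_of_tendsto_of_dominated`). -/

noncomputable section

namespace RNLS

/-! ### Convergence, boundedness and bilinear pairings in L^s -/

section LpCalculus

variable {α ι F F' G : Type*} [MeasurableSpace α] {μ : Measure α}
  [NormedAddCommGroup F] [NormedAddCommGroup F'] [NormedAddCommGroup G]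

/-- Convergence in `L^s(μ)` of a family of functions along a filter. -/
structure LpTendsto (l : Filter ι) (s : ℝ≥0∞) (μ : Measure α) (f : ι → α → F) (g : α → F) :
    Prop where
  ev : ∀ᶠ i in l, MemLp (f i) s μ
  lim : MemLp g s μ
  tendsto : Tendsto (fun i => eLpNorm (fun x => f i x - g x) s μ) l (𝓝 0)

/-- Boundedness in `L^s(μ)` of a family of functions. -/
structure LpBdd (s : ℝ≥0∞) (μ : Measure α) (f : ι → α → F) : Prop where
  memLp : ∀ i, MemLp (f i) s μ
  bdd : ∃ C : ℝ, ∀ i, (eLpNorm (f i) s μ).toReal ≤ C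

variable {l : Filter ι} {s r : ℝ≥0∞} {f f' : ι → α → F} {g g' : α → F}

/-- Only the differences are dominated, so membership of `f₂ i` in L^s is recovered by adding `g₂`
back. -/
theorem LpTendsto.of_le {f₁ : ι → α → F} {g₁ : α → F} {f₂ : ι → α → G} {g₂ : α → G} {C : ℝ}
    (h : LpTendsto l s μ f₁ g₁) (hm : ∀ᶠ i in l, AEStronglyMeasurable (f₂ i) μ)
    (hg : MemLp g₂ s μ)
    (hle : ∀ᶠ i in l, ∀ᵐ x ∂μ, ‖f₂ i x - g₂ x‖ ≤ C * ‖f₁ i x - g₁ x‖) :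
    LpTendsto l s μ f₂ g₂ := by
  refine ⟨?_, hg, ?_⟩
  · filter_upwards [h.ev, hm, hle] with i h1 h2 h3
    have h4 : MemLp (fun x => f₂ i x - g₂ x) s μ :=
      (h1.sub h.lim).of_le_mul (h2.sub hg.1) h3
    have h5 := h4.add hg
    have h6 : (fun x => f₂ i x - g₂ x) + g₂ = f₂ i := by ext x; simp
    rwa [h6] at h5
  · have h1 : Tendsto (fun i => ENNReal.ofReal C * eLpNorm (fun x => f₁ i x - g₁ x) s μ) l
        (𝓝 0) := by
      simpa using ENNReal.Tendsto.const_mul h.tendsto (Or.inr ENNReal.ofReal_ne_top)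
    refine tendsto_of_tendsto_of_tendsto_of_le_of_le' tendsto_const_nhds h1
      (Eventually.of_forall fun i => zero_le) ?_
    filter_upwards [hle] with i hi
    exact eLpNorm_le_mul_eLpNorm_of_ae_le_mul hi s

theorem LpTendsto.const (hg : MemLp g s μ) : LpTendsto l s μ (fun _ => g) g :=
  ⟨Eventually.of_forall fun _ => hg, hg, by simpa using tendsto_const_nhds⟩

theorem LpTendsto.add (hs : 1 ≤ s) (h : LpTendsto l s μ f g) (h' : LpTendsto l s μ f' g') :
    LpTendsto l s μ (fun i x => f i x + f' i x) (fun x => g x + g' x) := by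
  refine ⟨?_, h.lim.add h'.lim, ?_⟩
  · filter_upwards [h.ev, h'.ev] with i h1 h2 using h1.add h2
  · have h1 := h.tendsto.add h'.tendsto
    rw [add_zero] at h1
    refine tendsto_of_tendsto_of_tendsto_of_le_of_le' tendsto_const_nhds h1
      (Eventually.of_forall fun i => zero_le) ?_
    filter_upwards [h.ev, h'.ev] with i h2 h3
    refine le_trans (le_of_eq ?_) (eLpNorm_add_le (h2.sub h.lim).1 (h3.sub h'.lim).1 hs)
    congr 1
    ext x
    simp only [Pi.add_apply]
    abel

theorem LpTendsto.neg (h : LpTendsto l s μ f g) :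
    LpTendsto l s μ (fun i x => - f i x) (fun x => - g x) := by
  refine h.of_le (C := 1) ?_ h.lim.neg ?_
  · filter_upwards [h.ev] with i hi using hi.1.neg
  · refine Eventually.of_forall fun i => Eventually.of_forall fun x => ?_
    rw [one_mul, ← norm_neg]
    apply le_of_eq
    congr 1
    abel

theorem LpTendsto.sub (hs : 1 ≤ s) (h : LpTendsto l s μ f g) (h' : LpTendsto l s μ f' g') :
    LpTendsto l s μ (fun i x => f i x - f' i x) (fun x => g x - g' x) := by
  simpa only [sub_eq_add_neg] using h.add hs h'.neg

theorem LpTendsto.congr_ae {f₂ : ι → α → F} {g₂ : α → F} (h : LpTendsto l s μ f g)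
    (hf : ∀ᶠ i in l, f i =ᵐ[μ] f₂ i) (hg : g =ᵐ[μ] g₂) : LpTendsto l s μ f₂ g₂ := by
  refine h.of_le (C := 1) ?_ ((memLp_congr_ae hg).1 h.lim) ?_
  · filter_upwards [h.ev, hf] with i h1 h2 using h1.1.congr h2
  · filter_upwards [hf] with i h2
    filter_upwards [h2, hg] with x h3 h4
    rw [h3, h4, one_mul]

theorem LpTendsto.mono_measure {ν : Measure α} (h : LpTendsto l s μ f g) (hν : ν ≤ μ) :
    LpTendsto l s ν f g := by
  refine ⟨h.ev.mono fun i hi => hi.mono_measure hν, h.lim.mono_measure hν, ?_⟩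
  exact tendsto_of_tendsto_of_tendsto_of_le_of_le tendsto_const_nhds h.tendsto
    (fun i => zero_le) fun i => eLpNorm_mono_measure _ hν

theorem LpTendsto.comp {κ : Type*} {m : Filter κ} {k : κ → ι} (h : LpTendsto l s μ f g)
    (hk : Tendsto k m l) : LpTendsto m s μ (fun i => f (k i)) g :=
  ⟨hk.eventually h.ev, h.lim, h.tendsto.comp hk⟩

theorem LpTendsto.mono_exponent [IsFiniteMeasure μ] {s' : ℝ≥0∞} (h : LpTendsto l s μ f g)
    (hs : s' ≤ s) : LpTendsto l s' μ f g := by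
  refine ⟨h.ev.mono fun i hi => hi.mono_exponent hs, h.lim.mono_exponent hs, ?_⟩
  by_cases h0 : s' = 0
  · subst h0; simpa using tendsto_const_nhds
  have hc : μ Set.univ ^ (1 / s'.toReal - 1 / s.toReal) ≠ ⊤ := by
    refine ENNReal.rpow_ne_top_of_nonneg ?_ (measure_ne_top _ _)
    by_cases hst : s = ⊤
    · simp [hst]
    have : s'.toReal ≤ s.toReal := ENNReal.toReal_mono hst hs
    have h2 : 0 < s'.toReal := ENNReal.toReal_pos h0 (ne_top_of_le_ne_top hst hs)
    rw [sub_nonneg]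
    exact one_div_le_one_div_of_le h2 this
  have h1 := ENNReal.Tendsto.mul_const h.tendsto (Or.inr hc)
  rw [zero_mul] at h1
  refine tendsto_of_tendsto_of_tendsto_of_le_of_le' tendsto_const_nhds h1
    (Eventually.of_forall fun i => zero_le) ?_
  filter_upwards [h.ev] with i hi
  exact eLpNorm_le_eLpNorm_mul_rpow_measure_univ hs (hi.sub h.lim).1

theorem LpTendsto.eLpNorm_tendsto (hs : 1 ≤ s) (h : LpTendsto l s μ f g) :
    Tendsto (fun i => (eLpNorm (f i) s μ).toReal) l (𝓝 (eLpNorm g s μ).toReal) := by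
  have h0 : Tendsto (fun i => (eLpNorm (fun x => f i x - g x) s μ).toReal) l (𝓝 0) := by
    simpa [Function.comp_def] using (ENNReal.tendsto_toReal ENNReal.zero_ne_top).comp h.tendsto
  rw [tendsto_iff_dist_tendsto_zero]
  refine tendsto_of_tendsto_of_tendsto_of_le_of_le' tendsto_const_nhds h0
    (Eventually.of_forall fun i => dist_nonneg) ?_
  filter_upwards [h.ev] with i hi
  have hd : MemLp (fun x => f i x - g x) s μ := hi.sub h.lim
  have e1 : f i = (fun x => f i x - g x) + g := by ext x; simp
  have e2 : g = f i - (fun x => f i x - g x) := by ext x; simp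
  have h1 : (eLpNorm (f i) s μ).toReal ≤
      (eLpNorm (fun x => f i x - g x) s μ).toReal + (eLpNorm g s μ).toReal := by
    rw [← ENNReal.toReal_add hd.2.ne h.lim.2.ne]
    refine ENNReal.toReal_mono (ENNReal.add_ne_top.2 ⟨hd.2.ne, h.lim.2.ne⟩) ?_
    conv_lhs => rw [e1]
    exact eLpNorm_add_le hd.1 h.lim.1 hs
  have h2 : (eLpNorm g s μ).toReal ≤
      (eLpNorm (f i) s μ).toReal + (eLpNorm (fun x => f i x - g x) s μ).toReal := by
    rw [← ENNReal.toReal_add hi.2.ne hd.2.ne]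
    refine ENNReal.toReal_mono (ENNReal.add_ne_top.2 ⟨hi.2.ne, hd.2.ne⟩) ?_
    conv_lhs => rw [e2]
    exact eLpNorm_sub_le hi.1 hd.1 hs
  rw [Real.dist_eq, abs_le]
  constructor <;> linarith

/-- Dominated convergence with a constant majorant, which is integrable because the measure is
finite. It serves limits in time as well as in the mollification parameter, hence the general
filter. -/
theorem LpTendsto.of_bdd_pointwise [IsFiniteMeasure μ] [l.IsCountablyGenerated] (hs : s ≠ ⊤)
    {C : ℝ} (hm : ∀ᶠ i in l, AEStronglyMeasurable (f i) μ) (hg : MemLp g s μ)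
    (hb : ∀ᶠ i in l, ∀ᵐ x ∂μ, ‖f i x - g x‖ ≤ C)
    (hlim : ∀ᵐ x ∂μ, Tendsto (fun i => f i x) l (𝓝 (g x))) : LpTendsto l s μ f g := by
  have hC : ∀ᶠ i in l, MemLp (fun x => f i x - g x) s μ := by
    filter_upwards [hm, hb] with i h1 h2
    exact MemLp.of_bound (h1.sub hg.1) C h2
  refine ⟨?_, hg, ?_⟩
  · filter_upwards [hC] with i hi
    have h6 : (fun x => f i x - g x) + g = f i := by ext x; simp
    simpa only [h6] using hi.add hg
  · by_cases h0 : s = 0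
    · subst h0; simpa using tendsto_const_nhds
    have hpos : 0 < s.toReal := ENNReal.toReal_pos h0 hs
    have h1 : Tendsto (fun i => ∫⁻ x, ‖f i x - g x‖ₑ ^ s.toReal ∂μ) l
        (𝓝 (∫⁻ x, (0 : ℝ≥0∞) ∂μ)) := by
      refine tendsto_lintegral_filter_of_dominated_convergence'
        (fun _ => ENNReal.ofReal C ^ s.toReal) ?_ ?_ ?_ ?_
      · filter_upwards [hC] with i hi using hi.1.enorm.pow_const _
      · filter_upwards [hb] with i hi
        filter_upwards [hi] with x hx
        refine ENNReal.rpow_le_rpow ?_ hpos.le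
        rw [← ofReal_norm]
        exact ENNReal.ofReal_le_ofReal hx
      · rw [lintegral_const]
        exact ENNReal.mul_ne_top (ENNReal.rpow_ne_top_of_nonneg hpos.le ENNReal.ofReal_ne_top)
          (measure_ne_top _ _)
      · filter_upwards [hlim] with x hx
        have h2 : Tendsto (fun i => ‖f i x - g x‖ₑ) l (𝓝 0) := by
          have := (hx.sub_const (g x)).enorm
          simpa using this
        have h3 := (ENNReal.continuous_rpow_const (y := s.toReal)).tendsto 0 |>.comp h2
        simpa [ENNReal.zero_rpow_of_pos hpos, Function.comp_def] using h3
    have h2 := (ENNReal.continuous_rpow_const (y := 1 / s.toReal)).tendsto _ |>.comp h1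
    simp only [lintegral_zero, ENNReal.zero_rpow_of_pos (one_div_pos.2 hpos)] at h2
    refine h2.congr fun i => ?_
    rw [eLpNorm_eq_lintegral_rpow_enorm_toReal h0 hs]
    rfl

/-! ### Bounded families -/

theorem LpBdd.of_le {f₁ : ι → α → F} {f₂ : ι → α → G} {C : ℝ} (h : LpBdd s μ f₁)
    (hm : ∀ i, AEStronglyMeasurable (f₂ i) μ) (hle : ∀ i, ∀ᵐ x ∂μ, ‖f₂ i x‖ ≤ C * ‖f₁ i x‖) :
    LpBdd s μ f₂ := by
  obtain ⟨D, hD⟩ := h.bdd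
  refine ⟨fun i => (h.memLp i).of_le_mul (hm i) (hle i), (max C 0) * D, fun i => ?_⟩
  have h1 := eLpNorm_le_mul_eLpNorm_of_ae_le_mul (hle i) s
  have h2 := ENNReal.toReal_mono (ENNReal.mul_ne_top ENNReal.ofReal_ne_top (h.memLp i).2.ne) h1
  rw [ENNReal.toReal_mul, ENNReal.toReal_ofReal'] at h2
  exact h2.trans (mul_le_mul_of_nonneg_left (hD i) (le_max_right _ _))

/-- The reindexing `k` allows a family of mollifications, indexed by time and scale, to be compared
with the original family, indexed by time alone. -/
theorem LpBdd.of_eLpNorm_le {κ : Type*} {β : Type*} [MeasurableSpace β] {ν : Measure β}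
    {f₁ : κ → β → F} {f₂ : ι → α → G} (k : ι → κ) (h : LpBdd s ν f₁)
    (hm : ∀ i, AEStronglyMeasurable (f₂ i) μ)
    (hle : ∀ i, eLpNorm (f₂ i) r μ ≤ eLpNorm (f₁ (k i)) s ν) : LpBdd r μ f₂ := by
  obtain ⟨D, hD⟩ := h.bdd
  refine ⟨fun i => ⟨hm i, (hle i).trans_lt (h.memLp _).2⟩, D, fun i => ?_⟩
  exact (ENNReal.toReal_mono (h.memLp _).2.ne (hle i)).trans (hD _)

theorem LpBdd.add (hs : 1 ≤ s) (h : LpBdd s μ f) (h' : LpBdd s μ f') :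
    LpBdd s μ (fun i x => f i x + f' i x) := by
  obtain ⟨C, hC⟩ := h.bdd
  obtain ⟨D, hD⟩ := h'.bdd
  refine ⟨fun i => (h.memLp i).add (h'.memLp i), C + D, fun i => ?_⟩
  have h1 := eLpNorm_add_le (h.memLp i).1 (h'.memLp i).1 hs
  have h2 := ENNReal.toReal_mono
    (ENNReal.add_ne_top.2 ⟨(h.memLp i).2.ne, (h'.memLp i).2.ne⟩) h1
  rw [ENNReal.toReal_add (h.memLp i).2.ne (h'.memLp i).2.ne] at h2
  exact h2.trans (add_le_add (hC i) (hD i))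

theorem LpBdd.neg (h : LpBdd s μ f) : LpBdd s μ (fun i x => - f i x) :=
  h.of_le (C := 1) (fun i => (h.memLp i).1.neg) fun _ => Eventually.of_forall fun x => by simp

theorem LpBdd.sub (hs : 1 ≤ s) (h : LpBdd s μ f) (h' : LpBdd s μ f') :
    LpBdd s μ (fun i x => f i x - f' i x) := by
  simpa only [sub_eq_add_neg] using h.add hs h'.neg

theorem LpBdd.mono_measure {ν : Measure α} (h : LpBdd s μ f) (hν : ν ≤ μ) : LpBdd s ν f :=
  h.of_eLpNorm_le id (fun _ => ((h.memLp _).mono_measure hν).1)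
    fun _ => eLpNorm_mono_measure _ hν

theorem LpBdd.mono_exponent [IsFiniteMeasure μ] {s' : ℝ≥0∞} (h : LpBdd s μ f) (hs : s' ≤ s) :
    LpBdd s' μ f := by
  obtain ⟨D, hD⟩ := h.bdd
  refine ⟨fun i => (h.memLp i).mono_exponent hs, ?_⟩
  by_cases h0 : s' = 0
  · subst h0; exact ⟨0, by simp⟩
  have hc : μ Set.univ ^ (1 / s'.toReal - 1 / s.toReal) ≠ ⊤ := by
    refine ENNReal.rpow_ne_top_of_nonneg ?_ (measure_ne_top _ _)
    by_cases hst : s = ⊤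
    · simp [hst]
    have : s'.toReal ≤ s.toReal := ENNReal.toReal_mono hst hs
    have h2 : 0 < s'.toReal := ENNReal.toReal_pos h0 (ne_top_of_le_ne_top hst hs)
    rw [sub_nonneg]
    exact one_div_le_one_div_of_le h2 this
  refine ⟨D * (μ Set.univ ^ (1 / s'.toReal - 1 / s.toReal)).toReal, fun i => ?_⟩
  have h1 := eLpNorm_le_eLpNorm_mul_rpow_measure_univ hs (h.memLp i).1
  have h2 := ENNReal.toReal_mono (ENNReal.mul_ne_top (h.memLp i).2.ne hc) h1
  rw [ENNReal.toReal_mul] at h2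
  exact h2.trans (mul_le_mul_of_nonneg_right (hD i) ENNReal.toReal_nonneg)

/-- A curve that is continuous in `L^s` on a compact set is bounded there. -/
theorem LpBdd.of_compact [TopologicalSpace ι] {K : Set ι} (hK : IsCompact K) (hs : 1 ≤ s)
    (hm : ∀ t ∈ K, MemLp (f t) s μ)
    (h : ∀ t ∈ K, LpTendsto (𝓝[K] t) s μ f (f t)) : LpBdd s μ (fun t : K => f t) := by
  have hc : ContinuousOn (fun t => (eLpNorm (f t) s μ).toReal) K :=
    fun t ht => (h t ht).eLpNorm_tendsto hs
  obtain ⟨C, hC⟩ := hK.exists_bound_of_continuousOn hc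
  exact ⟨fun i => hm _ i.2, C, fun i => (le_abs_self _).trans (hC _ i.2)⟩

/-! ### Bilinear pairings -/

section Bilin

variable [NormedSpace ℝ F] [NormedSpace ℝ F'] [NormedSpace ℝ G] (L : F →L[ℝ] F' →L[ℝ] G)
  [hsr : ENNReal.HolderTriple s r 1]

theorem integrable_bilin {a : α → F} {b : α → F'} (ha : MemLp a s μ) (hb : MemLp b r μ) :
    Integrable (fun x => L (a x) (b x)) μ := by
  rw [← memLp_one_iff_integrable]
  refine MemLp.of_bilin (p := s) (q := r) (fun y z => L y z) ‖L‖₊ ha hb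
    (L.aestronglyMeasurable_comp₂ ha.1 hb.1) (Eventually.of_forall fun x => ?_)
  exact_mod_cast L.le_opNorm₂ (a x) (b x)

theorem norm_integral_bilin_le {a : α → F} {b : α → F'} (ha : MemLp a s μ) (hb : MemLp b r μ) :
    ‖∫ x, L (a x) (b x) ∂μ‖ ≤ ‖L‖ * (eLpNorm a s μ).toReal * (eLpNorm b r μ).toReal := by
  have h1 := eLpNorm_le_eLpNorm_mul_eLpNorm_of_nnnorm (p := s) (q := r) (r := 1) ha.1 hb.1 (fun y z => L y z) ‖L‖₊
    (Eventually.of_forall fun x => by exact_mod_cast L.le_opNorm₂ (a x) (b x))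
  have h2 : ‖∫ x, L (a x) (b x) ∂μ‖ₑ ≤ ‖L‖₊ * eLpNorm a s μ * eLpNorm b r μ := by
    refine (enorm_integral_le_lintegral_enorm _).trans ?_
    rwa [eLpNorm_one_eq_lintegral_enorm] at h1
  have h3 := ENNReal.toReal_mono (ENNReal.mul_ne_top
    (ENNReal.mul_ne_top ENNReal.coe_ne_top ha.2.ne) hb.2.ne) h2
  simpa [ENNReal.toReal_mul] using h3

/-- Hölder applied to L(a_i - a', b_i) + L(a', b_i - b'). The integrals in J, in its derivatives and
in the commutator errors are combinations of such pairings. -/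
theorem LpTendsto.integral_bilin (hr : 1 ≤ r) {a : ι → α → F} {a' : α → F}
    {b : ι → α → F'} {b' : α → F'} (ha : LpTendsto l s μ a a') (hb : LpTendsto l r μ b b') :
    Tendsto (fun i => ∫ x, L (a i x) (b i x) ∂μ) l (𝓝 (∫ x, L (a' x) (b' x) ∂μ)) := by
  have ha0 : Tendsto (fun i => (eLpNorm (fun x => a i x - a' x) s μ).toReal) l (𝓝 0) := by
    simpa [Function.comp_def] using (ENNReal.tendsto_toReal ENNReal.zero_ne_top).comp ha.tendsto
  have hb0 : Tendsto (fun i => (eLpNorm (fun x => b i x - b' x) r μ).toReal) l (𝓝 0) := by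
    simpa [Function.comp_def] using (ENNReal.tendsto_toReal ENNReal.zero_ne_top).comp hb.tendsto
  have hb1 := hb.eLpNorm_tendsto hr
  have hlim := ((ha0.const_mul ‖L‖).mul hb1).add
    (hb0.const_mul (‖L‖ * (eLpNorm a' s μ).toReal))
  rw [mul_zero, zero_mul, mul_zero, add_zero] at hlim
  rw [tendsto_iff_norm_sub_tendsto_zero]
  refine tendsto_of_tendsto_of_tendsto_of_le_of_le' tendsto_const_nhds hlim
    (Eventually.of_forall fun i => norm_nonneg _) ?_
  filter_upwards [ha.ev, hb.ev] with i hai hbi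
  have hda : MemLp (fun x => a i x - a' x) s μ := hai.sub ha.lim
  have hdb : MemLp (fun x => b i x - b' x) r μ := hbi.sub hb.lim
  have e : ∫ x, L (a i x) (b i x) ∂μ - ∫ x, L (a' x) (b' x) ∂μ =
      ∫ x, L (a i x - a' x) (b i x) ∂μ + ∫ x, L (a' x) (b i x - b' x) ∂μ := by
    rw [← integral_sub (integrable_bilin L hai hbi) (integrable_bilin L ha.lim hb.lim),
      ← integral_add (integrable_bilin L hda hbi)
        (integrable_bilin L ha.lim hdb)]
    congr 1
    ext x
    simp
  rw [e]
  exact (norm_add_le _ _).trans (add_le_add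
    (norm_integral_bilin_le L hda hbi)
    (norm_integral_bilin_le L ha.lim hdb))

theorem LpBdd.integral_bilin {a : ι → α → F} {b : ι → α → F'}
    (ha : LpBdd s μ a) (hb : LpBdd r μ b) : ∃ C, ∀ i, ‖∫ x, L (a i x) (b i x) ∂μ‖ ≤ C := by
  obtain ⟨C, hC⟩ := ha.bdd
  obtain ⟨D, hD⟩ := hb.bdd
  refine ⟨‖L‖ * C * D, fun i => (norm_integral_bilin_le L (ha.memLp i) (hb.memLp i)).trans ?_⟩
  have h0 : 0 ≤ C := ENNReal.toReal_nonneg.trans (hC i)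
  have := hC i
  have := hD i
  gcongr

end Bilin

end LpCalculus

/-! ### The power nonlinearity as a map from L^{p+1} to L^{(p+1)/p} -/

section PowerNonlinearity

/-- The power nonlinearity `z ↦ |z|^{p-1} z`. -/
def powNL (p : ℝ) (z : ℂ) : ℂ := ((‖z‖ ^ (p - 1) : ℝ) : ℂ) * z

theorem continuous_powNL {p : ℝ} (hp : 1 ≤ p) : Continuous (powNL p) :=
  (Complex.continuous_ofReal.comp
    (continuous_norm.rpow_const fun _ => Or.inr (by linarith))).mul continuous_id

theorem norm_powNL {p : ℝ} (hp : 1 ≤ p) (z : ℂ) : ‖powNL p z‖ = ‖z‖ ^ p := by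
  rw [powNL, norm_mul, Complex.norm_real, Real.norm_of_nonneg (by positivity)]
  rcases eq_or_ne z 0 with rfl | hz
  · simp [Real.zero_rpow (by linarith : p ≠ 0)]
  · conv_lhs => rw [← Real.rpow_one ‖z‖, ← Real.rpow_mul (norm_nonneg z), one_mul,
      ← Real.rpow_add (norm_pos_iff.2 hz)]
    congr 1
    ring

/-- Split the difference as |a|^{p-1}(a - b) + (|a|^{p-1} - |b|^{p-1}) b. With σ = |b|/|a| ≤ 1 the
second term reduces to σ - σ^p ≤ p(1 - σ), which is Bernoulli's inequality for σ^p. This avoids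
differentiating the power at the origin. -/
theorem norm_powNL_sub_le_of_le {p : ℝ} (hp : 1 ≤ p) {a b : ℂ} (hab : ‖b‖ ≤ ‖a‖) :
    ‖powNL p a - powNL p b‖ ≤ (1 + p) * ‖a‖ ^ (p - 1) * ‖a - b‖ := by
  rcases eq_or_ne a 0 with rfl | ha
  · have : b = 0 := by simpa using hab
    simp [this]
  have ha0 : 0 < ‖a‖ := norm_pos_iff.2 ha
  have e : powNL p a - powNL p b = ((‖a‖ ^ (p - 1) : ℝ) : ℂ) * (a - b) +
      ((‖a‖ ^ (p - 1) - ‖b‖ ^ (p - 1) : ℝ) : ℂ) * b := by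
    simp only [powNL]
    push_cast
    ring
  have h1 : ‖b‖ ^ (p - 1) ≤ ‖a‖ ^ (p - 1) :=
    Real.rpow_le_rpow (norm_nonneg _) hab (by linarith)
  have h2 : (‖a‖ ^ (p - 1) - ‖b‖ ^ (p - 1)) * ‖b‖ ≤ p * ‖a‖ ^ (p - 1) * (‖a‖ - ‖b‖) := by
    set σ := ‖b‖ / ‖a‖ with hσ
    have hσ0 : 0 ≤ σ := by positivity
    have hb : ‖b‖ = σ * ‖a‖ := by rw [hσ]; field_simp
    have hσ1 : σ ≤ 1 := (div_le_one ha0).2 hab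
    have hB : 1 + p * (σ - 1) ≤ σ ^ p := by
      have := one_add_mul_self_le_rpow_one_add (by linarith : -1 ≤ σ - 1) hp
      simpa using this
    have hσp : σ ^ (p - 1) * σ = σ ^ p := by
      rcases hσ0.eq_or_lt with h | h
      · rw [← h, Real.zero_rpow (by linarith : p ≠ 0), mul_zero]
      · conv_lhs => rw [← Real.rpow_one σ, ← Real.rpow_mul hσ0, one_mul, ← Real.rpow_add h]
        congr 1; ring
    have hfin : σ - σ ^ (p - 1) * σ ≤ p * (1 - σ) := by rw [hσp]; linarith
    rw [hb, Real.mul_rpow hσ0 ha0.le]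
    have hA : 0 ≤ ‖a‖ ^ (p - 1) * ‖a‖ := by positivity
    nlinarith [mul_le_mul_of_nonneg_left hfin hA]
  rw [e]
  refine (norm_add_le _ _).trans ?_
  rw [norm_mul, norm_mul, Complex.norm_real, Complex.norm_real,
    Real.norm_of_nonneg (by positivity), Real.norm_of_nonneg (sub_nonneg.2 h1)]
  have h3 : ‖a‖ - ‖b‖ ≤ ‖a - b‖ := norm_sub_norm_le a b
  have h4 : p * ‖a‖ ^ (p - 1) * (‖a‖ - ‖b‖) ≤ p * ‖a‖ ^ (p - 1) * ‖a - b‖ :=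
    mul_le_mul_of_nonneg_left h3 (by positivity)
  linarith

theorem norm_powNL_sub_le {p : ℝ} (hp : 1 ≤ p) (a b : ℂ) :
    ‖powNL p a - powNL p b‖ ≤ (1 + p) * (‖a‖ + ‖b‖) ^ (p - 1) * ‖a - b‖ := by
  have key : ∀ a b : ℂ, ‖b‖ ≤ ‖a‖ →
      ‖powNL p a - powNL p b‖ ≤ (1 + p) * (‖a‖ + ‖b‖) ^ (p - 1) * ‖a - b‖ := by
    intro a b hab
    refine (norm_powNL_sub_le_of_le hp hab).trans ?_
    have := Real.rpow_le_rpow (norm_nonneg a) (le_add_of_nonneg_right (norm_nonneg b))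
      (by linarith : 0 ≤ p - 1)
    gcongr
  rcases le_total ‖b‖ ‖a‖ with h | h
  · exact key a b h
  · rw [norm_sub_rev, norm_sub_rev a, add_comm ‖a‖]
    exact key b a h

theorem holderTriple_powNL {p : ℝ} (hp : 1 ≤ p) :
    ENNReal.HolderTriple (ENNReal.ofReal ((p + 1) / p)) (ENNReal.ofReal (p + 1)) 1 := by
  refine ⟨?_⟩
  have h1 : 0 < (p + 1) / p := by positivity
  rw [← ENNReal.ofReal_inv_of_pos h1, ← ENNReal.ofReal_inv_of_pos (by linarith),
    ← ENNReal.ofReal_add (by positivity) (by positivity), inv_one, ← ENNReal.ofReal_one]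
  congr 1
  field_simp

variable {α ι : Type*} [MeasurableSpace α] {μ : Measure α} {l : Filter ι}

theorem memLp_powNL {p : ℝ} (hp : 1 ≤ p) {f : α → ℂ} (hf : MemLp f (ENNReal.ofReal (p + 1)) μ) :
    MemLp (fun x => powNL p (f x)) (ENNReal.ofReal ((p + 1) / p)) μ ∧
    eLpNorm (fun x => powNL p (f x)) (ENNReal.ofReal ((p + 1) / p)) μ =
      eLpNorm f (ENNReal.ofReal (p + 1)) μ ^ p := by
  have h1 : eLpNorm (fun x => powNL p (f x)) (ENNReal.ofReal ((p + 1) / p)) μ =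
      eLpNorm f (ENNReal.ofReal (p + 1)) μ ^ p := by
    have h2 : eLpNorm (fun x => powNL p (f x)) (ENNReal.ofReal ((p + 1) / p)) μ =
        eLpNorm (fun x => ‖f x‖ ^ p) (ENNReal.ofReal ((p + 1) / p)) μ := by
      refine eLpNorm_congr_norm_ae (Eventually.of_forall fun x => ?_)
      rw [norm_powNL hp, Real.norm_of_nonneg (by positivity)]
    rw [h2, eLpNorm_norm_rpow f (by linarith), ← ENNReal.ofReal_mul (by positivity)]
    congr 3
    field_simp
  refine ⟨⟨(continuous_powNL hp).comp_aestronglyMeasurable hf.1, ?_⟩, h1⟩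
  rw [h1]
  exact ENNReal.rpow_lt_top_of_nonneg (by linarith) hf.2.ne

theorem LpBdd.powNL {p : ℝ} (hp : 1 ≤ p) {f : ι → α → ℂ}
    (hf : LpBdd (ENNReal.ofReal (p + 1)) μ f) :
    LpBdd (ENNReal.ofReal ((p + 1) / p)) μ (fun i x => powNL p (f i x)) := by
  obtain ⟨C, hC⟩ := hf.bdd
  refine ⟨fun i => (memLp_powNL hp (hf.memLp i)).1, C ^ p, fun i => ?_⟩
  rw [(memLp_powNL hp (hf.memLp i)).2, ← ENNReal.toReal_rpow]
  exact Real.rpow_le_rpow ENNReal.toReal_nonneg (hC i) (by linarith)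

/-- Hölder with exponents (p+1)/(p-1) and p+1 applied to the pointwise Lipschitz bound. The first
exponent forces p > 1. -/
theorem eLpNorm_powNL_sub_le {p : ℝ} (hp : 1 < p) {f g : α → ℂ}
    (hf : MemLp f (ENNReal.ofReal (p + 1)) μ) (hg : MemLp g (ENNReal.ofReal (p + 1)) μ) :
    eLpNorm (fun x => powNL p (f x) - powNL p (g x)) (ENNReal.ofReal ((p + 1) / p)) μ ≤
      ENNReal.ofReal (1 + p) * (eLpNorm f (ENNReal.ofReal (p + 1)) μ +
        eLpNorm g (ENNReal.ofReal (p + 1)) μ) ^ (p - 1) *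
        eLpNorm (fun x => f x - g x) (ENNReal.ofReal (p + 1)) μ := by
  have hp1 : 0 < p - 1 := by linarith
  have hp0 : 0 < p := by linarith
  have hT : ENNReal.HolderTriple (ENNReal.ofReal ((p + 1) / (p - 1))) (ENNReal.ofReal (p + 1))
      (ENNReal.ofReal ((p + 1) / p)) := by
    refine ⟨?_⟩
    rw [← ENNReal.ofReal_inv_of_pos (by positivity), ← ENNReal.ofReal_inv_of_pos (by positivity),
      ← ENNReal.ofReal_inv_of_pos (by positivity),
      ← ENNReal.ofReal_add (by positivity) (by positivity)]
    congr 1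
    field_simp
    ring
  have hN : MemLp (fun x => ‖f x‖ + ‖g x‖) (ENNReal.ofReal (p + 1)) μ := hf.norm.add hg.norm
  have hm : AEStronglyMeasurable (fun x => (‖f x‖ + ‖g x‖) ^ (p - 1)) μ :=
    (Real.continuous_rpow_const hp1.le).comp_aestronglyMeasurable hN.1
  have h1 : eLpNorm (fun x => (‖f x‖ + ‖g x‖) ^ (p - 1)) (ENNReal.ofReal ((p + 1) / (p - 1))) μ ≤
      (eLpNorm f (ENNReal.ofReal (p + 1)) μ + eLpNorm g (ENNReal.ofReal (p + 1)) μ) ^ (p - 1) := by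
    have h2 : eLpNorm (fun x => (‖f x‖ + ‖g x‖) ^ (p - 1))
        (ENNReal.ofReal ((p + 1) / (p - 1))) μ =
        eLpNorm (fun x => ‖f x‖ + ‖g x‖) (ENNReal.ofReal (p + 1)) μ ^ (p - 1) := by
      have h3 := eLpNorm_norm_rpow (μ := μ) (p := ENNReal.ofReal ((p + 1) / (p - 1)))
        (fun x => ‖f x‖ + ‖g x‖) hp1
      rw [← ENNReal.ofReal_mul (by positivity), div_mul_cancel₀ _ hp1.ne'] at h3
      rw [← h3]
      congr 1
      ext x
      rw [Real.norm_of_nonneg (by positivity)]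
    rw [h2]
    refine ENNReal.rpow_le_rpow ?_ hp1.le
    have := eLpNorm_add_le hf.norm.1 hg.norm.1 (p := ENNReal.ofReal (p + 1))
      (by rw [← ENNReal.ofReal_one]; exact ENNReal.ofReal_le_ofReal (by linarith))
    rwa [eLpNorm_norm, eLpNorm_norm] at this
  have h4 : eLpNorm (fun x => powNL p (f x) - powNL p (g x)) (ENNReal.ofReal ((p + 1) / p)) μ ≤
      ENNReal.ofReal (1 + p) * eLpNorm (fun x => (‖f x‖ + ‖g x‖) ^ (p - 1) • (f x - g x))
        (ENNReal.ofReal ((p + 1) / p)) μ := by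
    refine eLpNorm_le_mul_eLpNorm_of_ae_le_mul (Eventually.of_forall fun x => ?_) _
    rw [norm_smul, Real.norm_of_nonneg (by positivity), ← mul_assoc]
    exact norm_powNL_sub_le hp.le _ _
  refine h4.trans ?_
  rw [mul_assoc]
  gcongr
  refine (eLpNorm_smul_le_mul_eLpNorm (p := ENNReal.ofReal ((p + 1) / (p - 1)))
    (q := ENNReal.ofReal (p + 1))
    (hf.sub hg).1 hm).trans ?_
  exact mul_le_mul_left h1 _

theorem LpTendsto.powNL {p : ℝ} (hp : 1 ≤ p) {f : ι → α → ℂ} {g : α → ℂ}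
    (h : LpTendsto l (ENNReal.ofReal (p + 1)) μ f g) :
    LpTendsto l (ENNReal.ofReal ((p + 1) / p)) μ (fun i x => RNLS.powNL p (f i x))
      (fun x => RNLS.powNL p (g x)) := by
  -- For p = 1 the Hölder exponent (p+1)/(p-1) degenerates, but the nonlinearity is then the
  -- identity.
  rcases hp.eq_or_lt with rfl | hp1
  · simpa [RNLS.powNL] using h
  have hr : 1 ≤ ENNReal.ofReal (p + 1) := by
    rw [← ENNReal.ofReal_one]; exact ENNReal.ofReal_le_ofReal (by linarith)
  refine ⟨h.ev.mono fun i hi => (memLp_powNL hp hi).1, (memLp_powNL hp h.lim).1, ?_⟩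
  set r := ENNReal.ofReal (p + 1) with hrdef
  -- The Lipschitz constant depends on the norms, so these are first bounded along the filter.
  have h1 : ∀ᶠ i in l, eLpNorm (f i) r μ ≤ eLpNorm g r μ + 1 := by
    filter_upwards [h.ev, h.tendsto.eventually_lt_const zero_lt_one] with i hi h2
    have e1 : f i = g + (fun x => f i x - g x) := by ext x; simp
    conv_lhs => rw [e1]
    exact (eLpNorm_add_le h.lim.1 (hi.sub h.lim).1 hr).trans (add_le_add le_rfl h2.le)
  have h2 : Tendsto (fun i => ENNReal.ofReal (1 + p) *
      (eLpNorm g r μ + 1 + eLpNorm g r μ) ^ (p - 1) * eLpNorm (fun x => f i x - g x) r μ) l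
      (𝓝 0) := by
    have := ENNReal.Tendsto.const_mul (a := ENNReal.ofReal (1 + p) *
      (eLpNorm g r μ + 1 + eLpNorm g r μ) ^ (p - 1)) h.tendsto (Or.inr ?_)
    · simpa using this
    · have := h.lim.2.ne
      refine ENNReal.mul_ne_top ENNReal.ofReal_ne_top
        (ENNReal.rpow_ne_top_of_nonneg (by linarith) ?_)
      finiteness
  refine tendsto_of_tendsto_of_tendsto_of_le_of_le' tendsto_const_nhds h2
    (Eventually.of_forall fun i => zero_le) ?_
  filter_upwards [h.ev, h1] with i hi h3
  refine (eLpNorm_powNL_sub_le hp1 hi h.lim).trans ?_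
  have : 0 ≤ p - 1 := by linarith
  gcongr

end PowerNonlinearity

/-! ### Localization to balls -/

section Ball

variable {n : ℕ} {ι F F' G : Type*} [NormedAddCommGroup F] [NormedAddCommGroup F']
  [NormedAddCommGroup G] [NormedSpace ℝ F] [NormedSpace ℝ F'] [NormedSpace ℝ G]

/-- Lebesgue measure on the ball of radius `R` about the origin of `ℝⁿ`. -/
def ballMeas (n : ℕ) (R : ℝ) : Measure (EuclideanSpace ℝ (Fin n)) :=
  volume.restrict (Metric.ball 0 R)

instance (R : ℝ) : IsFiniteMeasure (ballMeas n R) :=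
  ⟨by rw [ballMeas, Measure.restrict_apply_univ]; exact measure_ball_lt_top⟩

theorem ballMeas_le (R : ℝ) : ballMeas n R ≤ volume := Measure.restrict_le_self

theorem exists_bound_ball {F : Type*} [NormedAddCommGroup F] {B : EuclideanSpace ℝ (Fin n) → F} (hB : Continuous B) (R : ℝ) :
    ∃ C, 0 ≤ C ∧ ∀ x ∈ Metric.ball (0 : EuclideanSpace ℝ (Fin n)) R, ‖B x‖ ≤ C := by
  obtain ⟨C, hC⟩ := (isCompact_closedBall (0 : EuclideanSpace ℝ (Fin n)) R).exists_bound_of_continuousOn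
    hB.continuousOn
  exact ⟨max C 0, le_max_right _ _, fun x hx =>
    (hC x (Metric.ball_subset_closedBall hx)).trans (le_max_left _ _)⟩

theorem ae_ballMeas_mem (R : ℝ) :
    ∀ᵐ x ∂ballMeas n R, x ∈ Metric.ball (0 : EuclideanSpace ℝ (Fin n)) R :=
  ae_restrict_mem measurableSet_ball

variable {R : ℝ} {s : ℝ≥0∞} {l : Filter ι}
  {B : EuclideanSpace ℝ (Fin n) → F →L[ℝ] G}

theorem memLp_clm (hB : Continuous B) {g : EuclideanSpace ℝ (Fin n) → F}
    (h : MemLp g s (ballMeas n R)) : MemLp (fun x => B x (g x)) s (ballMeas n R) := by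
  obtain ⟨C, -, hC⟩ := exists_bound_ball hB R
  refine h.of_le_mul (c := C) ((ContinuousLinearMap.id ℝ (F →L[ℝ] G)).aestronglyMeasurable_comp₂ hB.aestronglyMeasurable h.1) ?_
  filter_upwards [ae_ballMeas_mem R] with x hx
  exact ((B x).le_opNorm _).trans (mul_le_mul_of_nonneg_right (hC x hx) (norm_nonneg _))

/-- The coefficients V and A are continuous but possibly unbounded on the whole space. This is why
all limits involving them are taken on balls, where a continuous coefficient acts boundedly on L^s.
-/
theorem LpTendsto.clm (hB : Continuous B) {f : ι → EuclideanSpace ℝ (Fin n) → F}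
    {g : EuclideanSpace ℝ (Fin n) → F} (h : LpTendsto l s (ballMeas n R) f g) :
    LpTendsto l s (ballMeas n R) (fun i x => B x (f i x)) (fun x => B x (g x)) := by
  obtain ⟨C, -, hC⟩ := exists_bound_ball hB R
  refine h.of_le (C := C) ?_ (memLp_clm hB h.lim) (Eventually.of_forall fun i => ?_)
  · filter_upwards [h.ev] with i hi using (ContinuousLinearMap.id ℝ (F →L[ℝ] G)).aestronglyMeasurable_comp₂ hB.aestronglyMeasurable hi.1
  · filter_upwards [ae_ballMeas_mem R] with x hx
    rw [← map_sub]
    exact ((B x).le_opNorm _).trans (mul_le_mul_of_nonneg_right (hC x hx) (norm_nonneg _))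

theorem LpBdd.clm (hB : Continuous B) {f : ι → EuclideanSpace ℝ (Fin n) → F}
    (h : LpBdd s (ballMeas n R) f) :
    LpBdd s (ballMeas n R) (fun i x => B x (f i x)) := by
  obtain ⟨C, -, hC⟩ := exists_bound_ball hB R
  refine h.of_le (C := C) (fun i => (ContinuousLinearMap.id ℝ (F →L[ℝ] G)).aestronglyMeasurable_comp₂ hB.aestronglyMeasurable (h.memLp i).1) fun i => ?_
  filter_upwards [ae_ballMeas_mem R] with x hx
  exact ((B x).le_opNorm _).trans (mul_le_mul_of_nonneg_right (hC x hx) (norm_nonneg _))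

theorem integral_ballMeas {h : EuclideanSpace ℝ (Fin n) → F}
    (hh : ∀ x, x ∉ Metric.ball (0 : EuclideanSpace ℝ (Fin n)) R → h x = 0) :
    ∫ x, h x ∂ballMeas n R = ∫ x, h x :=
  setIntegral_eq_integral_of_forall_compl_eq_zero fun x hx => hh x hx

theorem integrable_of_ballMeas {F : Type*} [NormedAddCommGroup F]
    {h : EuclideanSpace ℝ (Fin n) → F}
    (hi : Integrable h (ballMeas n R))
    (hh : ∀ x, x ∉ Metric.ball (0 : EuclideanSpace ℝ (Fin n)) R → h x = 0) : Integrable h :=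
  (integrableOn_iff_integrable_of_support_subset fun x hx => by
    by_contra h'; exact hx (hh x h')).1 hi

end Ball

/-! ### Mollification -/

section Mollifier

/-- Euclidean space `ℝⁿ`. -/
abbrev Eu (n : ℕ) : Type := EuclideanSpace ℝ (Fin n)

variable {n : ℕ} {F G : Type*} [NormedAddCommGroup F] [NormedSpace ℝ F]
  [NormedAddCommGroup G] [NormedSpace ℝ G]

/-- Convolution of a scalar kernel with a vector-valued function. -/
def cv (η : Eu n → ℝ) (h : Eu n → F) (x : Eu n) : F := ∫ y, η (x - y) • h y

theorem cv_eq_convolution (η : Eu n → ℝ) (h : Eu n → F) :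
    cv η h = convolution η h (ContinuousLinearMap.lsmul ℝ ℝ) volume := by
  ext x
  exact convolution_lsmul_swap.symm

theorem cv_eq (η : Eu n → ℝ) (h : Eu n → F) (x : Eu n) : cv η h x = ∫ t, η t • h (x - t) := by
  rw [cv_eq_convolution]; rfl

theorem cv_congr_ae {η : Eu n → ℝ} {h h' : Eu n → F} (hh : h =ᵐ[volume] h') :
    cv η h = cv η h' := by
  ext x
  refine integral_congr_ae ?_
  filter_upwards [hh] with y hy
  rw [hy]

theorem contDiff_cv {η : Eu n → ℝ} (hη : ContDiff ℝ ∞ η) (hc : HasCompactSupport η)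
    {h : Eu n → F} (hh : LocallyIntegrable h) : ContDiff ℝ ∞ (cv η h) := by
  rw [cv_eq_convolution]
  exact hc.contDiff_convolution_left (n := ⊤) _ hη hh

theorem integrable_cv {η : Eu n → ℝ} (hη : Continuous η) (hc : HasCompactSupport η)
    {h : Eu n → F} (hh : LocallyIntegrable h) (x : Eu n) :
    Integrable (fun y => η (x - y) • h y) := by
  have h1 := hc.convolutionExists_left (ContinuousLinearMap.lsmul ℝ ℝ) hη hh x
  have h2 := convolutionExistsAt_flip.2 h1
  exact h2

theorem cv_sub {η : Eu n → ℝ} (hη : Continuous η) (hc : HasCompactSupport η)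
    {h h' : Eu n → F} (hh : LocallyIntegrable h) (hh' : LocallyIntegrable h') (x : Eu n) :
    cv η (fun y => h y - h' y) x = cv η h x - cv η h' x := by
  simp only [cv, smul_sub]
  exact integral_sub (integrable_cv hη hc hh x) (integrable_cv hη hc hh' x)

theorem clm_cv [CompleteSpace F] [CompleteSpace G] (L : F →L[ℝ] G) {η : Eu n → ℝ}
    (hη : Continuous η) (hc : HasCompactSupport η)
    {h : Eu n → F} (hh : LocallyIntegrable h) (x : Eu n) :
    L (cv η h x) = cv η (fun y => L (h y)) x := by
  simp only [cv]
  rw [← L.integral_comp_comm (integrable_cv hη hc hh x)]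
  simp

theorem fderiv_cv {η : Eu n → ℝ} (hη : ContDiff ℝ ∞ η) (hc : HasCompactSupport η)
    {h : Eu n → F} (hh : LocallyIntegrable h) (x e : Eu n) :
    fderiv ℝ (cv η h) x e = cv (fun y => fderiv ℝ η y e) h x := by
  have h1 := hc.hasFDerivAt_convolution_left (ContinuousLinearMap.lsmul ℝ ℝ) (hη.of_le (by simp))
    hh x (μ := (volume : Measure (Eu n)))
  rw [cv_eq_convolution, cv_eq_convolution, h1.fderiv]
  have h2 := (hc.fderiv ℝ).convolutionExists_left
    ((ContinuousLinearMap.lsmul ℝ ℝ : ℝ →L[ℝ] F →L[ℝ] F).precompL (Eu n))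
    (hη.continuous_fderiv (by simp)) hh x (μ := (volume : Measure (Eu n)))
  simp_rw [convolution_def, ContinuousLinearMap.integral_apply h2]
  rfl

/-- Locality of convolution with a kernel supported in the unit ball. -/
theorem cv_indicator {η : Eu n → ℝ} (hs : ∀ x, 1 ≤ ‖x‖ → η x = 0) (h : Eu n → F) {R : ℝ}
    {x : Eu n} (hx : x ∈ Metric.ball (0 : Eu n) R) :
    cv η ((Metric.ball 0 (R + 1)).indicator h) x = cv η h x := by
  refine integral_congr_ae (Eventually.of_forall fun y => ?_)
  by_cases hy : y ∈ Metric.ball (0 : Eu n) (R + 1)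
  · simp [hy]
  · have : η (x - y) = 0 := by
      apply hs
      rw [Metric.mem_ball, dist_zero_right] at hx hy
      have := norm_sub_norm_le y x
      rw [norm_sub_rev] at this
      linarith
    simp [this]

theorem cv_eq_ball {η : Eu n → ℝ} (hs : ∀ x, 1 ≤ ‖x‖ → η x = 0) (h : Eu n → F) {R : ℝ}
    {x : Eu n} (hx : x ∈ Metric.ball (0 : Eu n) R) :
    cv η h x = ∫ y, η (x - y) • h y ∂ballMeas n (R + 1) := by
  rw [integral_ballMeas, cv]
  intro y hy
  have : η (x - y) = 0 := by
    apply hs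
    rw [Metric.mem_ball, dist_zero_right] at hx hy
    have := norm_sub_norm_le y x
    rw [norm_sub_rev] at this
    linarith
  simp [this]

/-- For a fixed kernel, convolution improves L¹ to L^∞. The ball grows by 1 because the kernel
vanishes outside the unit ball. -/
theorem exists_norm_cv_le {η : Eu n → ℝ} (hη : Continuous η) (hs : ∀ x, 1 ≤ ‖x‖ → η x = 0)
    (R : ℝ) : ∃ C, 0 ≤ C ∧ ∀ h : Eu n → F, MemLp h 1 (ballMeas n (R + 1)) →
      ∀ x ∈ Metric.ball (0 : Eu n) R, ‖cv η h x‖ ≤ C * (eLpNorm h 1 (ballMeas n (R + 1))).toReal := by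
  obtain ⟨C, hC0, hC⟩ := exists_bound_ball hη 1
  have hC' : ∀ x, ‖η x‖ ≤ C := by
    intro x
    by_cases hx : x ∈ Metric.ball (0 : Eu n) 1
    · exact hC x hx
    · rw [hs x (by simpa using hx)]; simpa using hC0
  refine ⟨C, hC0, fun h hh x hx => ?_⟩
  rw [cv_eq_ball hs h hx]
  have hi : Integrable (fun y => C * ‖h y‖) (ballMeas n (R + 1)) :=
    ((memLp_one_iff_integrable.1 hh).norm).const_mul C
  refine (norm_integral_le_of_norm_le hi (Eventually.of_forall fun y => ?_)).trans (le_of_eq ?_)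
  · rw [norm_smul]
    exact mul_le_mul_of_nonneg_right (hC' _) (norm_nonneg _)
  · rw [integral_const_mul, eLpNorm_one_eq_lintegral_enorm,
      integral_norm_eq_lintegral_enorm hh.1]

/-! ### The mollifier -/

/-- A sequence of bump functions concentrating at the origin. -/
def bumpSeq (n k : ℕ) : ContDiffBump (0 : Eu n) :=
  -- The shift by 2 keeps the outer radius below 1 for every k, so kernels vanish outside the unit
  -- ball. The fixed ratio 2 of the radii is what almost everywhere convergence at Lebesgue points
  -- requires.
  ⟨1 / (2 * (k + 2)), 1 / (k + 2), by positivity, by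
    apply one_div_lt_one_div_of_lt <;> have : (0 : ℝ) ≤ k := k.cast_nonneg <;> linarith⟩

/-- The mollifying kernels. -/
def kern (n k : ℕ) : Eu n → ℝ := (bumpSeq n k).normed volume

theorem contDiff_kern (k : ℕ) : ContDiff ℝ ∞ (kern n k) := (bumpSeq n k).contDiff_normed (n := ⊤)

theorem hasCompactSupport_kern (k : ℕ) : HasCompactSupport (kern n k) :=
  (bumpSeq n k).hasCompactSupport_normed

theorem bumpSeq_rOut_lt (k : ℕ) : (bumpSeq n k).rOut < 1 := by
  change 1 / ((k : ℝ) + 2) < 1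
  have : (0 : ℝ) ≤ k := k.cast_nonneg
  rw [div_lt_one (by linarith)]
  linarith

theorem tendsto_bumpSeq_rOut : Tendsto (fun k => (bumpSeq n k).rOut) atTop (𝓝 0) := by
  change Tendsto (fun k : ℕ => 1 / ((k : ℝ) + 2)) atTop (𝓝 0)
  have h1 : Tendsto (fun k : ℕ => (k : ℝ) + 2) atTop atTop :=
    tendsto_atTop_add_const_right _ _ tendsto_natCast_atTop_atTop
  simpa [Pi.inv_def] using h1.inv_tendsto_atTop

theorem kern_eq_zero (k : ℕ) (x : Eu n) (hx : 1 ≤ ‖x‖) : kern n k x = 0 := by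
  by_contra h
  have : x ∈ Function.support ((bumpSeq n k).normed volume) := h
  rw [ContDiffBump.support_normed_eq, Metric.mem_ball, dist_zero_right] at this
  linarith [bumpSeq_rOut_lt (n := n) k]

theorem fderiv_kern_eq_zero (k : ℕ) (e x : Eu n) (hx : 1 ≤ ‖x‖) : fderiv ℝ (kern n k) x e = 0 := by
  have h1 : x ∉ tsupport (kern n k) := by
    rw [kern, ContDiffBump.tsupport_normed_eq, Metric.mem_closedBall, dist_zero_right]
    linarith [bumpSeq_rOut_lt (n := n) k]
  have h2 : x ∉ tsupport (fderiv ℝ (kern n k)) := fun h => h1 (tsupport_fderiv_subset ℝ h)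
  rw [image_eq_zero_of_notMem_tsupport h2]
  rfl

theorem kern_nonneg (k : ℕ) (x : Eu n) : 0 ≤ kern n k x := ContDiffBump.nonneg_normed _ _

theorem integral_kern (k : ℕ) : ∫ x, kern n k x = 1 := ContDiffBump.integral_normed _

/-- Mollification. -/
def mol (k : ℕ) (h : Eu n → F) : Eu n → F := cv (kern n k) h

theorem contDiff_mol (k : ℕ) {h : Eu n → F} (hh : LocallyIntegrable h) :
    ContDiff ℝ ∞ (mol k h) := contDiff_cv (contDiff_kern k) (hasCompactSupport_kern k) hh

theorem mol_sub (k : ℕ) {h h' : Eu n → F} (hh : LocallyIntegrable h)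
    (hh' : LocallyIntegrable h') :
    mol k (fun y => h y - h' y) = fun x => mol k h x - mol k h' x := by
  ext x
  exact cv_sub (contDiff_kern k).continuous (hasCompactSupport_kern k) hh hh' x

theorem clm_mol [CompleteSpace F] [CompleteSpace G] (L : F →L[ℝ] G) (k : ℕ)
    {h : Eu n → F} (hh : LocallyIntegrable h) (x : Eu n) :
    L (mol k h x) = mol k (fun y => L (h y)) x :=
  clm_cv L (contDiff_kern k).continuous (hasCompactSupport_kern k) hh x

theorem mol_indicator (k : ℕ) (h : Eu n → F) {R : ℝ}
    {x : Eu n} (hx : x ∈ Metric.ball (0 : Eu n) R) :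
    mol k ((Metric.ball 0 (R + 1)).indicator h) x = mol k h x :=
  cv_indicator (kern_eq_zero k) h hx

theorem ae_tendsto_mol [CompleteSpace F] {h : Eu n → F} (hh : LocallyIntegrable h) :
    ∀ᵐ x, Tendsto (fun k => mol k h x) atTop (𝓝 (h x)) := by
  have h1 := ContDiffBump.ae_convolution_tendsto_right_of_locallyIntegrable (K := 2)
    (φ := bumpSeq n) (l := atTop) tendsto_bumpSeq_rOut (Eventually.of_forall fun k => le_of_eq ?_) hh
  · filter_upwards [h1] with x hx
    refine hx.congr fun k => ?_
    rw [mol, cv_eq_convolution]; rfl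
  · change 1 / ((k : ℝ) + 2) = 2 * (1 / (2 * ((k : ℝ) + 2)))
    have : (0 : ℝ) ≤ k := k.cast_nonneg
    field_simp

theorem tendsto_mol_of_continuous [CompleteSpace F] {h : Eu n → F} (hh : Continuous h) (x : Eu n) :
    Tendsto (fun k => mol k h x) atTop (𝓝 (h x)) := by
  have h1 := ContDiffBump.convolution_tendsto_right_of_continuous (μ := (volume : Measure (Eu n)))
    (φ := bumpSeq n) (l := atTop) tendsto_bumpSeq_rOut hh x
  refine h1.congr fun k => ?_
  rw [mol, cv_eq_convolution]; rfl

/-- Mollification is a contraction of `L^s`. -/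
theorem eLpNorm_mol_le (k : ℕ) {h : Eu n → F} (hh : AEStronglyMeasurable h volume) {s : ℝ≥0∞}
    (hs : 1 ≤ s) (hs' : s ≠ ⊤) : eLpNorm (mol k h) s volume ≤ eLpNorm h s volume := by
  -- A strongly measurable representative makes (x, t) ↦ g(x - t) jointly measurable, as Tonelli
  -- needs below.
  obtain ⟨g, hg, hgh⟩ := hh
  rw [mol, cv_congr_ae hgh, eLpNorm_congr_ae hgh]
  have hs0 : s ≠ 0 := (zero_lt_one.trans_le hs).ne'
  -- The kernel is the density of a probability measure, so the L¹ norm is at most the L^s norm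
  -- (Jensen). Tonelli and translation invariance then finish.
  set ν : Measure (Eu n) := volume.withDensity (fun t => ENNReal.ofReal (kern n k t)) with hν
  have hkm : Measurable fun t => ENNReal.ofReal (kern n k t) :=
    ((contDiff_kern k).continuous.measurable).ennreal_ofReal
  have hν1 : ν Set.univ = 1 := by
    rw [hν, withDensity_apply _ MeasurableSet.univ, Measure.restrict_univ,
      ← ofReal_integral_eq_lintegral_ofReal, integral_kern, ENNReal.ofReal_one]
    · exact (bumpSeq n k).integrable_normed
    · exact Eventually.of_forall fun t => kern_nonneg k t
  have : IsProbabilityMeasure ν := ⟨hν1⟩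
  have hpt : ∀ x, ‖cv (kern n k) g x‖ₑ ^ s.toReal ≤ ∫⁻ t, ‖g (x - t)‖ₑ ^ s.toReal ∂ν := by
    intro x
    have hm : StronglyMeasurable fun t => g (x - t) :=
      hg.comp_measurable (measurable_const.sub measurable_id)
    have h1 : ‖cv (kern n k) g x‖ₑ ≤ eLpNorm (fun t => g (x - t)) 1 ν := by
      rw [cv_eq, eLpNorm_one_eq_lintegral_enorm, hν,
        lintegral_withDensity_eq_lintegral_mul _ hkm hm.enorm]
      refine (enorm_integral_le_lintegral_enorm _).trans (le_of_eq ?_)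
      congr 1
      ext t
      rw [enorm_smul, Pi.mul_apply, Real.enorm_of_nonneg (kern_nonneg k t)]
    have h2 : ‖cv (kern n k) g x‖ₑ ≤ eLpNorm (fun t => g (x - t)) s ν :=
      h1.trans (eLpNorm_le_eLpNorm_of_exponent_le hs hm.aestronglyMeasurable)
    have h3 := ENNReal.rpow_le_rpow h2 (ENNReal.toReal_nonneg (a := s))
    refine h3.trans (le_of_eq ?_)
    rw [eLpNorm_eq_lintegral_rpow_enorm_toReal hs0 hs', ← ENNReal.rpow_mul,
      one_div_mul_cancel (ENNReal.toReal_pos hs0 hs').ne', ENNReal.rpow_one]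
  rw [eLpNorm_eq_lintegral_rpow_enorm_toReal hs0 hs', eLpNorm_eq_lintegral_rpow_enorm_toReal hs0 hs']
  refine ENNReal.rpow_le_rpow ?_ (by positivity)
  calc ∫⁻ x, ‖cv (kern n k) g x‖ₑ ^ s.toReal
      ≤ ∫⁻ x, ∫⁻ t, ‖g (x - t)‖ₑ ^ s.toReal ∂ν := lintegral_mono hpt
    _ = ∫⁻ t, (∫⁻ x, ‖g (x - t)‖ₑ ^ s.toReal) ∂ν := by
        refine lintegral_lintegral_swap (μ := volume) (ν := ν)
          (f := fun x t => ‖g (x - t)‖ₑ ^ s.toReal) (Measurable.aemeasurable ?_)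
        exact ((hg.comp_measurable (measurable_fst.sub measurable_snd)).enorm).pow_const _
    _ = ∫⁻ t, (∫⁻ x, ‖g x‖ₑ ^ s.toReal) ∂ν := by
        refine lintegral_congr fun t => ?_
        exact lintegral_sub_right_eq_self (fun x => ‖g x‖ₑ ^ s.toReal) t
    _ = ∫⁻ x, ‖g x‖ₑ ^ s.toReal := by rw [lintegral_const, hν1, mul_one]

theorem memLp_mol (k : ℕ) {h : Eu n → F} {s : ℝ≥0∞} (hs : 1 ≤ s) (hs' : s ≠ ⊤)
    (hh : MemLp h s volume) : MemLp (mol k h) s volume :=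
  ⟨(contDiff_mol k (hh.locallyIntegrable hs)).continuous.aestronglyMeasurable,
    (eLpNorm_mol_le k hh.1 hs hs').trans_lt hh.2⟩

theorem mol_eq_zero_of_tsupport (k : ℕ) {h : Eu n → F} {R : ℝ}
    (hR : ∀ x, R ≤ ‖x‖ → h x = 0) (x : Eu n) (hx : R + 1 ≤ ‖x‖) : mol k h x = 0 := by
  rw [mol, cv]
  refine integral_eq_zero_of_ae (Eventually.of_forall fun y => ?_)
  by_cases hy : R ≤ ‖y‖
  · simp [hR y hy]
  · have : kern n k (x - y) = 0 := kern_eq_zero k _ (by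
      have := norm_sub_norm_le x y
      push Not at hy
      linarith)
    simp [this]

theorem norm_mol_le (k : ℕ) {h : Eu n → F} {C : ℝ} (hC : ∀ x, ‖h x‖ ≤ C) (x : Eu n) :
    ‖mol k h x‖ ≤ C := by
  have hi : Integrable (fun y => kern n k y * C) := ((bumpSeq n k).integrable_normed).mul_const C
  rw [mol, cv_eq]
  refine (norm_integral_le_of_norm_le hi (Eventually.of_forall fun y => ?_)).trans (le_of_eq ?_)
  · rw [norm_smul, Real.norm_of_nonneg (kern_nonneg k y)]
    exact mul_le_mul_of_nonneg_left (hC _) (kern_nonneg k y)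
  · rw [integral_mul_const, integral_kern, one_mul]

/-- Mollifications converge in `L^s`. -/
theorem lpTendsto_mol [CompleteSpace F] {h : Eu n → F} {s : ℝ≥0∞} (hs : 1 ≤ s) (hs' : s ≠ ⊤)
    (hh : MemLp h s volume) : LpTendsto atTop s volume (fun k => mol k h) h := by
  refine ⟨Eventually.of_forall fun k => memLp_mol k hs hs' hh, hh, ?_⟩
  rw [ENNReal.tendsto_nhds_zero]
  intro ε hε
  -- An ε/3 argument: h is replaced by a continuous g of compact support, and mollification does not
  -- increase the error.
  obtain ⟨g, hgc, hgε, hg, hgm⟩ := hh.exists_hasCompactSupport_eLpNorm_sub_le hs'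
    (ENNReal.div_pos hε.ne' (by norm_num : (3 : ℝ≥0∞) ≠ ⊤)).ne'
  obtain ⟨R, hR⟩ := hgc.isCompact.isBounded.subset_ball (0 : Eu n)
  have hR' : ∀ x, R ≤ ‖x‖ → g x = 0 := fun x hx => by
    by_contra h'
    have := hR (subset_tsupport _ h')
    rw [Metric.mem_ball, dist_zero_right] at this
    linarith
  obtain ⟨C, hC⟩ := hg.bounded_above_of_compact_support hgc
  -- All mollifications of g vanish outside the ball of radius R + 1, so bounded pointwise
  -- convergence on this finite measure space is enough.
  have hgl : LpTendsto atTop s (ballMeas n (R + 1)) (fun k => mol k g) g := by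
    refine LpTendsto.of_bdd_pointwise hs' (C := C + C) (Eventually.of_forall fun k =>
      ((memLp_mol k hs hs' hgm).mono_measure (ballMeas_le _)).1) (hgm.mono_measure (ballMeas_le _))
      (Eventually.of_forall fun k => Eventually.of_forall fun x => ?_)
      (Eventually.of_forall fun x => tendsto_mol_of_continuous hg x)
    exact (norm_sub_le _ _).trans (add_le_add (norm_mol_le k hC x) (hC x))
  have h3 := (ENNReal.tendsto_nhds_zero.1 hgl.tendsto) (ε / 3)
    (ENNReal.div_pos hε.ne' (by norm_num))
  filter_upwards [h3] with k hk
  have hsupp : eLpNorm (fun x => mol k g x - g x) s (ballMeas n (R + 1)) =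
      eLpNorm (fun x => mol k g x - g x) s volume := by
    refine eLpNorm_restrict_eq_of_support_subset fun x hx => ?_
    by_contra h'
    rw [Metric.mem_ball, dist_zero_right, not_lt] at h'
    apply hx
    simp only
    rw [mol_eq_zero_of_tsupport k hR' x h', hR' x (by linarith), sub_zero]
  rw [hsupp] at hk
  have e : (fun x => mol k h x - h x) =
      (mol k (fun y => h y - g y) + fun x => mol k g x - g x) - (h - g) := by
    rw [mol_sub k (hh.locallyIntegrable hs) (hgm.locallyIntegrable hs)]
    ext x
    simp only [Pi.add_apply, Pi.sub_apply]
    abel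
  have hm1 : MemLp (fun y => h y - g y) s volume := hh.sub hgm
  have hm2 := memLp_mol k hs hs' hm1
  have hm3 : MemLp (fun x => mol k g x - g x) s volume := (memLp_mol k hs hs' hgm).sub hgm
  rw [e]
  refine (eLpNorm_sub_le (hm2.add hm3).1 (hh.sub hgm).1 hs).trans ?_
  refine (add_le_add (eLpNorm_add_le hm2.1 hm3.1 hs) le_rfl).trans ?_
  refine (add_le_add (add_le_add ((eLpNorm_mol_le k hm1.1 hs hs').trans hgε) hk) hgε).trans ?_
  exact (ENNReal.add_thirds ε).le

end Mollifier

/-! ### Local Sobolev embedding and weak gradients -/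

section Sobolev

variable {n : ℕ}

/-- Gagliardo–Nirenberg–Sobolev on the line, for functions supported in a ball. -/
theorem exists_sobolev_one (R q : ℝ) :
    ∃ C : ℝ≥0∞, C ≠ ⊤ ∧ ∀ w : Eu 1 → ℂ, ContDiff ℝ 1 w →
      Function.support w ⊆ Metric.ball 0 R →
      eLpNorm w (ENNReal.ofReal q) volume ≤ C * eLpNorm (fderiv ℝ w) 2 volume := by
  set m : ℝ≥0∞ := volume (Metric.ball (0 : Eu 1) R) with hm
  have hm' : m ≠ ⊤ := measure_ball_lt_top.ne
  refine ⟨m ^ (1 / (ENNReal.ofReal q).toReal) * m ^ (1 / (1 : ℝ≥0∞).toReal - 1 / (2 : ℝ≥0∞).toReal),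
    ENNReal.mul_ne_top (ENNReal.rpow_ne_top_of_nonneg (by positivity) hm')
      (ENNReal.rpow_ne_top_of_nonneg (by norm_num) hm'), fun w hw hs => ?_⟩
  have hwc : HasCompactSupport w := by
    refine HasCompactSupport.of_support_subset_isCompact (isCompact_closedBall (0 : Eu 1) R)
      (hs.trans Metric.ball_subset_closedBall)
  let γ : ℝ ≃ₗᵢ[ℝ] Eu 1 := (OrthonormalBasis.singleton (Fin 1) ℝ).repr
  have hγ : ContDiff ℝ 1 γ := γ.contDiff
  have hf : ContDiff ℝ 1 (w ∘ γ) := hw.comp hγ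
  have hfc : HasCompactSupport (w ∘ γ) := hwc.comp_homeomorph γ.toHomeomorph
  -- Through the isometry γ the problem lives on ℝ, where |w| is bounded by the integral of |w'|.
  -- Hölder on the ball, once for w and once for w', gives the two powers of its volume.
  have hd : ∀ s, ‖deriv (w ∘ γ) s‖ₑ ≤ ‖fderiv ℝ w (γ s)‖ₑ := by
    intro s
    have h1 : HasDerivAt (w ∘ γ) (fderiv ℝ w (γ s) (γ 1)) s := by
      have h2 := (hw.differentiable one_ne_zero (γ s)).hasFDerivAt
      have h3 : HasDerivAt γ (γ 1) s := by
        simpa using (γ.toContinuousLinearEquiv : ℝ →L[ℝ] Eu 1).hasDerivAt (x := s)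
      exact h2.comp_hasDerivAt s h3
    rw [h1.deriv, ← ofReal_norm, ← ofReal_norm]
    refine ENNReal.ofReal_le_ofReal (((fderiv ℝ w (γ s)).le_opNorm _).trans ?_)
    rw [γ.norm_map]
    simp
  have hsup : ∀ x, ‖w x‖ₑ ≤ eLpNorm (fderiv ℝ w) 1 volume := by
    intro x
    have h1 := HasCompactSupport.enorm_le_lintegral_Ici_deriv hf hfc (γ.symm x)
    simp only [Function.comp_apply, γ.apply_symm_apply] at h1
    refine h1.trans ((setLIntegral_le_lintegral _ _).trans ((lintegral_mono hd).trans ?_))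
    rw [eLpNorm_one_eq_lintegral_enorm]
    exact le_of_eq (γ.measurePreserving.lintegral_comp (f := fun b => ‖fderiv ℝ w b‖ₑ)
      ((hw.continuous_fderiv one_ne_zero).measurable).enorm)
  have h2 : eLpNorm (fderiv ℝ w) 1 volume ≤
      eLpNorm (fderiv ℝ w) 2 volume * m ^ (1 / (1 : ℝ≥0∞).toReal - 1 / (2 : ℝ≥0∞).toReal) := by
    have hsd : Function.support (fderiv ℝ w) ⊆ Metric.closedBall (0 : Eu 1) R := by
      refine (support_fderiv_subset ℝ).trans ?_
      exact closure_minimal (hs.trans Metric.ball_subset_closedBall) Metric.isClosed_closedBall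
    rw [← eLpNorm_restrict_eq_of_support_subset (f := fderiv ℝ w) (p := 1) hsd]
    refine (eLpNorm_le_eLpNorm_mul_rpow_measure_univ (p := 1) (q := 2) (by norm_num)
      (hw.continuous_fderiv one_ne_zero).aestronglyMeasurable).trans ?_
    rw [Measure.restrict_apply_univ, Measure.addHaar_closedBall_eq_addHaar_ball]
    gcongr
    exact Measure.restrict_le_self
  rw [← eLpNorm_restrict_eq_of_support_subset hs]
  refine (eLpNorm_le_of_ae_enorm_bound (Eventually.of_forall hsup)).trans ?_
  rw [Measure.restrict_apply_univ, ← hm, smul_eq_mul, ← one_div]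
  calc _ ≤ m ^ (1 / (ENNReal.ofReal q).toReal) * (eLpNorm (fderiv ℝ w) 2 volume *
        m ^ (1 / (1 : ℝ≥0∞).toReal - 1 / (2 : ℝ≥0∞).toReal)) := by
          rw [mul_comm]; exact mul_le_mul_right h2 _
    _ = _ := by ring

/-- The Sobolev exponent condition `q < 2n/(n-2)` if `n ≥ 3`. -/
def SubcriticalExp (n : ℕ) (q : ℝ) : Prop := 2 ≤ q ∧ (3 ≤ n → q < 2 * (n : ℝ) / ((n : ℝ) - 2))

/-- The Gagliardo–Nirenberg–Sobolev inequality is used with a gradient exponent s in [1, 2] with s <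
n; boundedness of the ball then raises s to 2. No such s exists for n = 1, which is treated on its
own. -/
theorem exists_sobolev_of_support (hn : 1 ≤ n) (R : ℝ) {q : ℝ} (hq : SubcriticalExp n q) :
    ∃ C : ℝ≥0∞, C ≠ ⊤ ∧ ∀ w : Eu n → ℂ, ContDiff ℝ 1 w →
      Function.support w ⊆ Metric.ball 0 R →
      eLpNorm w (ENNReal.ofReal q) volume ≤ C * eLpNorm (fderiv ℝ w) 2 volume := by
  rcases hn.eq_or_lt with rfl | hn2
  · exact exists_sobolev_one R q
  have hq2 := hq.1
  have hn2' : (2 : ℝ) ≤ n := by exact_mod_cast hn2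
  obtain ⟨s, hs1, hs2, hsn, hsq⟩ : ∃ s : ℝ, 1 ≤ s ∧ s ≤ 2 ∧ s < n ∧
      s⁻¹ - (n : ℝ)⁻¹ ≤ q⁻¹ := by
    rcases Nat.lt_or_ge n 3 with h | h
    · have : n = 2 := by omega
      subst this
      -- In dimension two s = 2 is excluded; this s < 2 is the one whose Sobolev conjugate is
      -- exactly q.
      refine ⟨2 * q / (q + 2), ?_, ?_, ?_, ?_⟩
      · rw [le_div_iff₀ (by linarith)]; linarith
      · rw [div_le_iff₀ (by linarith)]; linarith
      · rw [div_lt_iff₀ (by linarith)]; push_cast; linarith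
      · apply le_of_eq
        push_cast
        field_simp
        ring
    · have h3 : (3 : ℝ) ≤ n := by exact_mod_cast h
      refine ⟨2, by norm_num, le_rfl, by linarith, ?_⟩
      have h4 := hq.2 h
      have h5 : (n : ℝ) - 2 > 0 := by linarith
      have h6 : (2 : ℝ)⁻¹ - (n : ℝ)⁻¹ = (2 * (n : ℝ) / ((n : ℝ) - 2))⁻¹ := by
        field_simp
      rw [h6]
      exact inv_anti₀ (by linarith) h4.le
  set m : ℝ≥0∞ := volume (Metric.ball (0 : Eu n) R) with hm
  have hm' : m ≠ ⊤ := measure_ball_lt_top.ne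
  set s' : NNReal := s.toNNReal with hs'
  have hs's : (s' : ℝ) = s := Real.coe_toNNReal _ (by linarith)
  set q' : NNReal := q.toNNReal with hq'
  have hq's : (q' : ℝ) = q := Real.coe_toNNReal _ (by linarith)
  set K := eLpNormLESNormFDerivOfLeConst ℂ (volume : Measure (Eu n)) (Metric.ball (0 : Eu n) R) s' q'
  refine ⟨K * m ^ (1 / (s' : ℝ≥0∞).toReal - 1 / (2 : ℝ≥0∞).toReal),
    ENNReal.mul_ne_top ENNReal.coe_ne_top (ENNReal.rpow_ne_top_of_nonneg ?_ hm'),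
    fun w hw hs => ?_⟩
  · rw [ENNReal.coe_toReal, hs's, sub_nonneg, ENNReal.toReal_ofNat]
    exact one_div_le_one_div_of_le (by linarith) hs2
  · have h1 := eLpNorm_le_eLpNorm_fderiv_of_le (μ := (volume : Measure (Eu n))) (p := s') (q := q')
      hw hs (by rw [← NNReal.coe_le_coe, hs's]; exact_mod_cast hs1)
      (by rw [finrank_euclideanSpace_fin, ← NNReal.coe_lt_coe, hs's]; exact_mod_cast hsn)
      (by rw [finrank_euclideanSpace_fin, NNReal.coe_inv, hs's, hq's]; exact hsq)
      Metric.isBounded_ball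
    refine h1.trans ?_
    rw [mul_assoc]
    refine mul_le_mul_right ?_ _
    have hsd : Function.support (fderiv ℝ w) ⊆ Metric.closedBall (0 : Eu n) R := by
      refine (support_fderiv_subset ℝ).trans ?_
      exact closure_minimal (hs.trans Metric.ball_subset_closedBall) Metric.isClosed_closedBall
    rw [← eLpNorm_restrict_eq_of_support_subset (f := fderiv ℝ w) (p := (s' : ℝ≥0∞)) hsd]
    have hs2' : (s' : ℝ≥0∞) ≤ 2 := by
      have : s' ≤ 2 := by rw [← NNReal.coe_le_coe, hs's]; exact_mod_cast hs2
      exact_mod_cast this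
    have : NeZero n := ⟨by omega⟩
    refine (eLpNorm_le_eLpNorm_mul_rpow_measure_univ hs2'
      (hw.continuous_fderiv one_ne_zero).aestronglyMeasurable).trans ?_
    rw [Measure.restrict_apply_univ, Measure.addHaar_closedBall_eq_addHaar_ball, mul_comm]
    gcongr
    exact Measure.restrict_le_self

/-! ### Weak gradients and mollification -/

/-- The bilinear product `a · z`, as a continuous bilinear map. -/
def dotB (n : ℕ) : Eu n →L[ℝ] EuclideanSpace ℂ (Fin n) →L[ℝ] ℂ :=
  ∑ j, (ContinuousLinearMap.lsmul ℝ ℝ : ℝ →L[ℝ] ℂ →L[ℝ] ℂ).bilinearComp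
    (EuclideanSpace.proj j : Eu n →L[ℝ] ℝ)
    ((EuclideanSpace.proj j : EuclideanSpace ℂ (Fin n) →L[ℂ] ℂ).restrictScalars ℝ)

theorem dotB_apply (a : Eu n) (z : EuclideanSpace ℂ (Fin n)) : dotB n a z = dotC a z := by
  simp [dotB, dotC]

theorem dotC_single (j : Fin n) (z : EuclideanSpace ℂ (Fin n)) :
    dotC (EuclideanSpace.single j (1 : ℝ)) z = z j := by
  simp only [dotC, PiLp.single_apply]
  rw [Finset.sum_eq_single j]
  · simp
  · intro i _ hi; simp [hi]
  · simp

theorem norm_dotC_le (a : Eu n) (z : EuclideanSpace ℂ (Fin n)) : ‖dotC a z‖ ≤ ‖a‖ * ‖z‖ := by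
  have h1 : ‖dotC a z‖ ≤ ∑ j, ‖a j‖ * ‖z j‖ := by
    refine (norm_sum_le _ _).trans (le_of_eq ?_)
    simp
  refine h1.trans ?_
  rw [EuclideanSpace.norm_eq, EuclideanSpace.norm_eq]
  exact Real.sum_mul_le_sqrt_mul_sqrt _ _ _

theorem sum_single_smul (a : Eu n) : a = ∑ j, a j • EuclideanSpace.single j (1 : ℝ) := by
  ext i
  simp [Pi.single_apply]

theorem gradient_apply (f : Eu n → ℝ) (x : Eu n) (j : Fin n) :
    (∇ f x) j = fderiv ℝ f x (EuclideanSpace.single j 1) := by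
  rw [← toDual_gradient, toDual_apply_apply, EuclideanSpace.inner_single_right]
  simp

theorem isTest_kern_sub (k : ℕ) (x : Eu n) : IsTest fun y => kern n k (x - y) :=
  ⟨(contDiff_kern k).comp (contDiff_const.sub contDiff_id),
    (hasCompactSupport_kern k).comp_homeomorph (Homeomorph.subLeft x)⟩

theorem gradient_kern_sub (k : ℕ) (x y : Eu n) (j : Fin n) :
    (∇ (fun y => kern n k (x - y)) y) j =
      - fderiv ℝ (kern n k) (x - y) (EuclideanSpace.single j 1) := by
  rw [gradient_apply]
  have h1 : HasFDerivAt (fun y : Eu n => x - y) (-ContinuousLinearMap.id ℝ (Eu n)) y :=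
    (hasFDerivAt_id y).const_sub x
  have h2 := (((contDiff_kern k).differentiable (by simp) (x - y)).hasFDerivAt.comp y h1).fderiv
  change fderiv ℝ (kern n k ∘ fun y => x - y) y _ = _
  rw [h2]
  simp

theorem mol_apply (k : ℕ) {g : Eu n → EuclideanSpace ℂ (Fin n)} (hg : LocallyIntegrable g)
    (x : Eu n) (j : Fin n) : mol k g x j = mol k (fun y => g y j) x :=
  clm_mol ((EuclideanSpace.proj j : EuclideanSpace ℂ (Fin n) →L[ℂ] ℂ).restrictScalars ℝ) k hg x

/-- The weak gradient is tested against y ↦ η_k(x - y). The sign from the reflection cancels the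
sign in the definition, so mollification commutes with the gradient. -/
theorem fderiv_mol {f : Eu n → ℂ} {g : Eu n → EuclideanSpace ℂ (Fin n)} (h : IsWeakGrad f g)
    (k : ℕ) (x a : Eu n) : fderiv ℝ (mol k f) x a = dotC a (mol k g x) := by
  have key : ∀ j, fderiv ℝ (mol k f) x (EuclideanSpace.single j 1) = mol k g x j := by
    intro j
    rw [mol_apply k h.2.1, mol, fderiv_cv (contDiff_kern k) (hasCompactSupport_kern k) h.1]
    have h1 := h.2.2 _ (isTest_kern_sub k x) j
    simp only [gradient_kern_sub] at h1
    simp only [mol, cv, Complex.real_smul]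
    rw [← neg_inj, ← h1, ← integral_neg]
    congr 1
    ext y
    push_cast
    ring
  conv_lhs => rw [sum_single_smul a, map_sum]
  simp only [map_smul, key, dotC, Complex.real_smul]

theorem norm_fderiv_mol_le {f : Eu n → ℂ} {g : Eu n → EuclideanSpace ℂ (Fin n)}
    (h : IsWeakGrad f g) (k : ℕ) (x : Eu n) : ‖fderiv ℝ (mol k f) x‖ ≤ ‖mol k g x‖ := by
  refine ContinuousLinearMap.opNorm_le_bound _ (norm_nonneg _) fun a => ?_
  rw [fderiv_mol h, mul_comm]
  exact norm_dotC_le _ _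

/-- The local Sobolev embedding `H¹ ⊂ L^q(ball)`. -/
theorem exists_sobolev (hn : 1 ≤ n) {R : ℝ} (hR : 0 < R) {q : ℝ} (hq : SubcriticalExp n q) :
    ∃ C : ℝ≥0∞, C ≠ ⊤ ∧ ∀ (f : Eu n → ℂ) (g : Eu n → EuclideanSpace ℂ (Fin n)),
      IsWeakGrad f g → MemLp f 2 → MemLp g 2 →
      eLpNorm f (ENNReal.ofReal q) (ballMeas n R) ≤
        C * (eLpNorm f 2 volume + eLpNorm g 2 volume) := by
  obtain ⟨C, hC, hS⟩ := exists_sobolev_of_support hn (R + 1) hq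
  -- The inequality for supported C¹ functions is applied to χ times a mollification of f, with χ =
  -- 1 on the ball of radius R. The resulting bound does not depend on k.
  let χ : ContDiffBump (0 : Eu n) := ⟨R, R + 1, hR, by linarith⟩
  have hχ : ContDiff ℝ ∞ χ := χ.contDiff
  obtain ⟨D, hD⟩ := (hχ.continuous_fderiv (by simp)).bounded_above_of_compact_support
    (χ.hasCompactSupport.fderiv ℝ)
  have hD0 : 0 ≤ D := (norm_nonneg _).trans (hD 0)
  refine ⟨C * ENNReal.ofReal (1 + D), ENNReal.mul_ne_top hC ENNReal.ofReal_ne_top,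
    fun f g hfg hf hg => ?_⟩
  have hk : ∀ k, eLpNorm (mol k f) (ENNReal.ofReal q) (ballMeas n R) ≤
      C * ENNReal.ofReal (1 + D) * (eLpNorm f 2 volume + eLpNorm g 2 volume) := by
    intro k
    have hmf : ContDiff ℝ ∞ (mol k f) := contDiff_mol k hfg.1
    have hmg : ContDiff ℝ ∞ (mol k g) := contDiff_mol k hfg.2.1
    set w : Eu n → ℂ := fun x => χ x • mol k f x with hw
    have hw1 : ContDiff ℝ 1 w := (hχ.smul hmf).of_le (by simp)
    have hws : Function.support w ⊆ Metric.ball 0 (R + 1) := by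
      intro x hx
      rw [← χ.support_eq]
      intro h0
      exact hx (by simp only [hw, h0, zero_smul])
    have h1 : eLpNorm (mol k f) (ENNReal.ofReal q) (ballMeas n R) ≤
        eLpNorm w (ENNReal.ofReal q) volume := by
      refine le_trans (le_of_eq ?_) (eLpNorm_mono_measure _ (ballMeas_le R))
      refine eLpNorm_congr_ae ?_
      filter_upwards [ae_ballMeas_mem R] with x hx
      simp only [hw]
      rw [χ.one_of_mem_closedBall (Metric.ball_subset_closedBall hx), one_smul]
    refine h1.trans ((hS w hw1 hws).trans ?_)
    rw [mul_assoc]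
    refine mul_le_mul_right ?_ _
    have h2 : ∀ x, ‖fderiv ℝ w x‖ ≤ (1 + D) * (‖mol k f x‖ + ‖mol k g x‖) := by
      intro x
      have h3 := ((hχ.differentiable (by simp) x).hasFDerivAt.smul
        (hmf.differentiable (by simp) x).hasFDerivAt)
      have h4 : fderiv ℝ w x = _ := h3.fderiv
      rw [h4]
      refine (norm_add_le _ _).trans ?_
      have h5 : ‖χ x • fderiv ℝ (mol k f) x‖ ≤ ‖mol k g x‖ := by
        rw [norm_smul, Real.norm_of_nonneg χ.nonneg]
        calc χ x * ‖fderiv ℝ (mol k f) x‖ ≤ 1 * ‖mol k g x‖ := by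
              have := χ.le_one (x := x)
              have := norm_fderiv_mol_le hfg k x
              gcongr
          _ = _ := one_mul _
      have h6 : ‖(fderiv ℝ χ x).smulRight (mol k f x)‖ ≤ D * ‖mol k f x‖ := by
        rw [ContinuousLinearMap.norm_smulRight_apply]
        exact mul_le_mul_of_nonneg_right (hD x) (norm_nonneg _)
      have h7 := norm_nonneg (mol k f x)
      have h8 := norm_nonneg (mol k g x)
      nlinarith [mul_nonneg hD0 h8]
    have h9 : eLpNorm (fderiv ℝ w) 2 volume ≤ ENNReal.ofReal (1 + D) *
        eLpNorm (fun x => ‖mol k f x‖ + ‖mol k g x‖) 2 volume := by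
      refine eLpNorm_le_mul_eLpNorm_of_ae_le_mul (Eventually.of_forall fun x => ?_) 2
      rw [Real.norm_of_nonneg (by positivity : 0 ≤ ‖mol k f x‖ + ‖mol k g x‖)]
      exact h2 x
    refine h9.trans ?_
    refine mul_le_mul_right ?_ _
    refine (eLpNorm_add_le hmf.continuous.norm.aestronglyMeasurable
      hmg.continuous.norm.aestronglyMeasurable (by norm_num)).trans ?_
    rw [eLpNorm_norm, eLpNorm_norm]
    exact add_le_add (eLpNorm_mol_le k hf.1 (by norm_num) (by norm_num))
      (eLpNorm_mol_le k hg.1 (by norm_num) (by norm_num))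
  have hlim : ∀ᵐ x ∂ballMeas n R, Tendsto (fun k => mol k f x) atTop (𝓝 (f x)) :=
    ae_restrict_of_ae (ae_tendsto_mol hfg.1)
  -- Fatou's lemma: f need not be known to lie in L^q beforehand.
  refine (Lp.eLpNorm_lim_le_liminf_eLpNorm (fun k =>
    (contDiff_mol k hfg.1).continuous.aestronglyMeasurable) f hlim).trans ?_
  refine liminf_le_of_frequently_le' (Frequently.of_forall hk)

theorem ae_eq_of_isWeakGrad {f : Eu n → ℂ} {g g' : Eu n → EuclideanSpace ℂ (Fin n)}
    (h : IsWeakGrad f g) (h' : IsWeakGrad f g') : g =ᵐ[volume] g' := by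
  have key : ∀ j, ∀ᵐ x, g x j = g' x j := by
    intro j
    let P : EuclideanSpace ℂ (Fin n) →L[ℝ] ℂ :=
      (EuclideanSpace.proj j : EuclideanSpace ℂ (Fin n) →L[ℂ] ℂ).restrictScalars ℝ
    have hP : ∀ {g : Eu n → EuclideanSpace ℂ (Fin n)}, LocallyIntegrable g →
        LocallyIntegrable (fun x => g x j) := fun {g} hg x => by
      obtain ⟨s, hs, hi⟩ := hg x
      exact ⟨s, hs, P.integrable_comp hi⟩
    refine ae_eq_of_integral_contDiff_smul_eq (hP h.2.1) (hP h'.2.1) fun ψ hψ hψc => ?_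
    have h1 := h.2.2 ψ ⟨hψ, hψc⟩ j
    have h2 := h'.2.2 ψ ⟨hψ, hψc⟩ j
    simp only [Complex.real_smul]
    rw [← neg_inj, ← h1, ← h2]
  filter_upwards [ae_all_iff.2 key] with x hx
  ext j
  exact hx j

theorem isWeakGrad_weakGrad {f : Eu n → ℂ} (h : ∃ g, IsWeakGrad f g) :
    IsWeakGrad f (weakGrad f) := by
  rw [weakGrad, dif_pos h]
  exact h.choose_spec

end Sobolev

/-! ### Continuous curves in the energy space -/

section Curves

variable {n : ℕ}

theorem IsWeakGrad.sub {f f' : Eu n → ℂ} {g g' : Eu n → EuclideanSpace ℂ (Fin n)}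
    (h : IsWeakGrad f g) (h' : IsWeakGrad f' g') :
    IsWeakGrad (fun x => f x - f' x) (fun x => g x - g' x) := by
  refine ⟨h.1.sub h'.1, h.2.1.sub h'.2.1, fun ψ hψ j => ?_⟩
  have hint : ∀ {η : Eu n → ℝ} {w : Eu n → ℂ}, Continuous η → HasCompactSupport η →
      LocallyIntegrable w → Integrable (fun x => (η x : ℂ) * w x) := by
    intro η w hη hc hw
    have := hw.integrable_smul_left_of_hasCompactSupport hη hc
    simpa only [Complex.real_smul] using this
  have hcoord : ∀ {w : Eu n → EuclideanSpace ℂ (Fin n)}, LocallyIntegrable w →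
      LocallyIntegrable (fun x => w x j) := fun {w} hw x => by
    obtain ⟨s, hs, hi⟩ := hw x
    exact ⟨s, hs, ((EuclideanSpace.proj j :
      EuclideanSpace ℂ (Fin n) →L[ℂ] ℂ).restrictScalars ℝ).integrable_comp hi⟩
  have hc1 : Continuous fun x => (∇ ψ x) j := by
    simp only [gradient_apply]
    exact (hψ.1.continuous_fderiv (by simp)).clm_apply continuous_const
  have hc2 : HasCompactSupport fun x => (∇ ψ x) j := by
    simp only [gradient_apply]
    exact (hψ.2.fderiv ℝ).comp_left (g := fun L : Eu n →L[ℝ] ℝ => L (EuclideanSpace.single j 1))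
      rfl
  have e1 := h.2.2 ψ hψ j
  have e2 := h'.2.2 ψ hψ j
  simp only [mul_sub, PiLp.sub_apply]
  rw [integral_sub (hint hc1 hc2 h.1) (hint hc1 hc2 h'.1),
    integral_sub (hint hψ.1.continuous hψ.2 (hcoord h.2.1))
      (hint hψ.1.continuous hψ.2 (hcoord h'.2.1)), e1, e2]
  ring

/-- `weakGrad` is chosen separately for each function, so it is additive only up to a null set, by
uniqueness of weak gradients. -/
theorem weakGrad_sub_ae {f f' : Eu n → ℂ} (h : ∃ g, IsWeakGrad f g) (h' : ∃ g, IsWeakGrad f' g) :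
    weakGrad (fun x => f x - f' x) =ᵐ[volume] fun x => weakGrad f x - weakGrad f' x := by
  have h1 := (isWeakGrad_weakGrad h).sub (isWeakGrad_weakGrad h')
  exact ae_eq_of_isWeakGrad (isWeakGrad_weakGrad ⟨_, h1⟩) h1

variable {T : EReal} {u : ℝ → Eu n → ℂ} {t : ℝ}

/-- Since `normH` is ∞ outside the space, convergence to 0 forces the differences eventually into
it. Each summand of the norm can then be read off. -/
theorem ContinuousInH1.lpTendsto (hu : ContinuousInH1 T u) (ht : t ∈ timeInterval T) :
    LpTendsto (𝓝[timeInterval T] t) 2 volume u (u t) ∧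
    LpTendsto (𝓝[timeInterval T] t) 2 volume (fun s => weakGrad (u s)) (weakGrad (u t)) := by
  have h1 := hu.2 t ht
  have hmem : ∀ᶠ s in 𝓝[timeInterval T] t, s ∈ timeInterval T := self_mem_nhdsWithin
  have hfin : ∀ᶠ s in 𝓝[timeInterval T] t, MemH 2 (fun x => u s x - u t x) := by
    filter_upwards [h1.eventually_lt_const ENNReal.zero_lt_top] with s hs
    by_contra h
    rw [normH, if_neg h] at hs
    exact lt_irrefl _ hs
  have htu := hu.1 t ht
  refine ⟨⟨?_, htu.1, ?_⟩, ⟨?_, htu.2.2.1, ?_⟩⟩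
  · filter_upwards [hmem] with s hs using (hu.1 s hs).1
  · refine tendsto_of_tendsto_of_tendsto_of_le_of_le' tendsto_const_nhds h1
      (Eventually.of_forall fun i => zero_le) ?_
    filter_upwards [hfin] with s hs
    rw [normH, if_pos hs]
    exact le_add_self
  · filter_upwards [hmem] with s hs using (hu.1 s hs).2.2.1
  · refine tendsto_of_tendsto_of_tendsto_of_le_of_le' tendsto_const_nhds h1
      (Eventually.of_forall fun i => zero_le) ?_
    filter_upwards [hfin, hmem] with s hs hsm
    rw [normH, if_pos hs, ← eLpNorm_congr_ae (weakGrad_sub_ae (hu.1 s hsm).2.1 htu.2.1), add_assoc]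
    exact le_self_add

theorem memLp_ball_of_memH (hn : 1 ≤ n) {q R : ℝ} (hq : SubcriticalExp n q)
    (hR : 0 < R) {f : Eu n → ℂ} (hf : MemH 2 f) : MemLp f (ENNReal.ofReal q) (ballMeas n R) := by
  obtain ⟨C, hC, hS⟩ := exists_sobolev hn hR hq
  refine ⟨hf.1.1.mono_measure (ballMeas_le R), (hS f _ (isWeakGrad_weakGrad hf.2.1) hf.1
    hf.2.2.1).trans_lt ?_⟩
  have := hf.1.2
  have := hf.2.2.1.2
  finiteness

theorem ContinuousInH1.lpTendsto_ball (hn : 1 ≤ n) {q R : ℝ} (hq : SubcriticalExp n q)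
    (hR : 0 < R) (hu : ContinuousInH1 T u) (ht : t ∈ timeInterval T) :
    LpTendsto (𝓝[timeInterval T] t) (ENNReal.ofReal q) (ballMeas n R) u (u t) := by
  obtain ⟨C, hC, hS⟩ := exists_sobolev hn hR hq
  have hmem : ∀ᶠ s in 𝓝[timeInterval T] t, s ∈ timeInterval T := self_mem_nhdsWithin
  obtain ⟨h1, h2⟩ := hu.lpTendsto ht
  refine ⟨?_, memLp_ball_of_memH hn hq hR (hu.1 t ht), ?_⟩
  · filter_upwards [hmem] with s hs using memLp_ball_of_memH hn hq hR (hu.1 s hs)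
  · have h3 := ENNReal.Tendsto.const_mul (h1.tendsto.add h2.tendsto) (Or.inr hC)
    rw [add_zero, mul_zero] at h3
    refine tendsto_of_tendsto_of_tendsto_of_le_of_le' tendsto_const_nhds h3
      (Eventually.of_forall fun i => zero_le) ?_
    filter_upwards [hmem] with s hs
    exact hS _ _ ((isWeakGrad_weakGrad (hu.1 s hs).2.1).sub (isWeakGrad_weakGrad (hu.1 t ht).2.1))
      ((hu.1 s hs).1.sub (hu.1 t ht).1) ((hu.1 s hs).2.2.1.sub (hu.1 t ht).2.2.1)

end Curves

/-! ### Coordinate calculus and integration by parts -/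

section PartialDerivatives

variable {n : ℕ}

/-- The partial derivative of a real-valued function. -/
def pd (j : Fin n) (f : Eu n → ℝ) (x : Eu n) : ℝ := fderiv ℝ f x (EuclideanSpace.single j 1)

/-- `∇φ · ∇f`. -/
def gradDot (φ f : Eu n → ℝ) (x : Eu n) : ℝ := ∑ k, pd k φ x * pd k f x

/-- The Laplacian in coordinates. -/
def lap (f : Eu n → ℝ) (x : Eu n) : ℝ := ∑ k, pd k (pd k f) x

/-- The antisymmetric operator `2 ∇φ · ∇ + Δφ`. -/
def morY (φ f : Eu n → ℝ) (x : Eu n) : ℝ := 2 * gradDot φ f x + lap φ x * f x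

/-- The derivative `A · ∇f` along the rotation field. -/
def rotD (M : Matrix (Fin n) (Fin n) ℝ) (f : Eu n → ℝ) (x : Eu n) : ℝ :=
  ∑ l, (rotField M x) l * pd l f x

theorem contDiff_pd {m k : ℕ∞ω} {f : Eu n → ℝ} (hf : ContDiff ℝ m f) (h : k + 1 ≤ m) (j : Fin n) :
    ContDiff ℝ k (pd j f) :=
  (hf.fderiv_right h).clm_apply contDiff_const

theorem contDiff_pd_top {f : Eu n → ℝ} (hf : ContDiff ℝ ∞ f) (j : Fin n) :
    ContDiff ℝ ∞ (pd j f) := contDiff_pd hf (by simp) j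

theorem contDiff_gradDot {φ f : Eu n → ℝ} (hφ : ContDiff ℝ ∞ φ) (hf : ContDiff ℝ ∞ f) :
    ContDiff ℝ ∞ (gradDot φ f) :=
  ContDiff.sum fun k _ => (contDiff_pd_top hφ k).mul (contDiff_pd_top hf k)

theorem continuous_gradDot {φ f : Eu n → ℝ} (hφ : ContDiff ℝ 1 φ) (hf : ContDiff ℝ 1 f) :
    Continuous (gradDot φ f) :=
  continuous_finsetSum _ fun k _ =>
    (contDiff_pd hφ (k := 0) (by simp) k).continuous.mul
      (contDiff_pd hf (k := 0) (by simp) k).continuous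

theorem contDiff_lap {f : Eu n → ℝ} (hf : ContDiff ℝ ∞ f) : ContDiff ℝ ∞ (lap f) :=
  ContDiff.sum fun k _ => contDiff_pd_top (contDiff_pd_top hf k) k

theorem contDiff_morY {φ f : Eu n → ℝ} (hφ : ContDiff ℝ ∞ φ) (hf : ContDiff ℝ ∞ f) :
    ContDiff ℝ ∞ (morY φ f) :=
  (contDiff_const.mul (contDiff_gradDot hφ hf)).add ((contDiff_lap hφ).mul hf)

theorem rotField_apply (M : Matrix (Fin n) (Fin n) ℝ) (x : Eu n) (l : Fin n) :
    (rotField M x) l = ∑ m, M l m * x m := by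
  simp [rotField, Matrix.mulVec, dotProduct]

theorem contDiff_rotField_apply (M : Matrix (Fin n) (Fin n) ℝ) (l : Fin n) :
    ContDiff ℝ ∞ fun x : Eu n => (rotField M x) l := by
  simp only [rotField_apply]
  refine ContDiff.sum fun m _ => contDiff_const.mul ?_
  exact (EuclideanSpace.proj m : Eu n →L[ℝ] ℝ).contDiff

theorem contDiff_rotD (M : Matrix (Fin n) (Fin n) ℝ) {f : Eu n → ℝ} (hf : ContDiff ℝ ∞ f) :
    ContDiff ℝ ∞ (rotD M f) :=
  ContDiff.sum fun l _ => (contDiff_rotField_apply M l).mul (contDiff_pd_top hf l)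

theorem pd_mul {f g : Eu n → ℝ} (hf : ContDiff ℝ 1 f) (hg : ContDiff ℝ 1 g) (j : Fin n)
    (x : Eu n) : pd j (fun y => f y * g y) x = f x * pd j g x + g x * pd j f x := by
  simp only [pd]
  rw [fderiv_fun_mul (hf.differentiable one_ne_zero x) (hg.differentiable one_ne_zero x)]
  simp

theorem pd_add {f g : Eu n → ℝ} (hf : ContDiff ℝ 1 f) (hg : ContDiff ℝ 1 g) (j : Fin n)
    (x : Eu n) : pd j (fun y => f y + g y) x = pd j f x + pd j g x := by
  simp only [pd]
  rw [fderiv_fun_add (hf.differentiable one_ne_zero x) (hg.differentiable one_ne_zero x)]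
  simp

theorem pd_const_mul (c : ℝ) {f : Eu n → ℝ} (hf : ContDiff ℝ 1 f) (j : Fin n) (x : Eu n) :
    pd j (fun y => c * f y) x = c * pd j f x := by
  simp only [pd]
  rw [fderiv_const_mul (hf.differentiable one_ne_zero x)]
  simp

theorem pd_sum {ι : Type*} (s : Finset ι) {f : ι → Eu n → ℝ} (hf : ∀ i, ContDiff ℝ 1 (f i))
    (j : Fin n) (x : Eu n) : pd j (fun y => ∑ i ∈ s, f i y) x = ∑ i ∈ s, pd j (f i) x := by
  simp only [pd]
  rw [fderiv_fun_sum fun i _ => (hf i).differentiable one_ne_zero x]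
  simp

theorem pd_comm {f : Eu n → ℝ} (hf : ContDiff ℝ ∞ f) (i j : Fin n) (x : Eu n) :
    pd i (pd j f) x = pd j (pd i f) x := by
  have h1 : ∀ i j, pd i (pd j f) x =
      fderiv ℝ (fderiv ℝ f) x (EuclideanSpace.single i 1) (EuclideanSpace.single j 1) := by
    intro i j
    have hd : DifferentiableAt ℝ (fderiv ℝ f) x :=
      ((contDiff_infty.1 hf 2).fderiv_right (m := 1) (by norm_num)).differentiable one_ne_zero x
    change fderiv ℝ (fun y => fderiv ℝ f y (EuclideanSpace.single j 1)) x _ = _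
    rw [fderiv_clm_apply hd (differentiableAt_const _)]
    simp
  rw [h1, h1]
  exact ((contDiff_infty.1 hf 2).contDiffAt.isSymmSndFDerivAt (by simp)).eq _ _

theorem laplacian_eq_lap {f : Eu n → ℝ} (hf : ContDiff ℝ ∞ f) : Δ f = lap f := by
  rw [laplacian_eq_iteratedFDeriv_orthonormalBasis f (EuclideanSpace.basisFun (Fin n) ℝ)]
  ext x
  refine Finset.sum_congr rfl fun j _ => ?_
  rw [iteratedFDeriv_two_apply]
  have hd : DifferentiableAt ℝ (fderiv ℝ f) x :=
    ((contDiff_infty.1 hf 2).fderiv_right (m := 1) (by norm_num)).differentiable one_ne_zero x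
  change _ = fderiv ℝ (fun y => fderiv ℝ f y (EuclideanSpace.single j 1)) x _
  rw [fderiv_clm_apply hd (differentiableAt_const _)]
  simp

/-! ### Supports -/

theorem tsupport_subset_of_eq_zero {φ f : Eu n → ℝ} (h : ∀ x, x ∉ tsupport φ → f x = 0) :
    tsupport f ⊆ tsupport φ :=
  closure_minimal (fun x hx => by by_contra h'; exact hx (h x h')) (isClosed_tsupport _)

theorem pd_eq_zero {φ : Eu n → ℝ} {x : Eu n} (hx : x ∉ tsupport φ) (j : Fin n) : pd j φ x = 0 := by
  have : x ∉ tsupport (fderiv ℝ φ) := fun h => hx (tsupport_fderiv_subset ℝ h)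
  rw [pd, image_eq_zero_of_notMem_tsupport this]
  rfl

theorem pd_pd_eq_zero {φ : Eu n → ℝ} {x : Eu n} (hx : x ∉ tsupport φ) (i j : Fin n) :
    pd i (pd j φ) x = 0 :=
  pd_eq_zero (fun h => hx (tsupport_subset_of_eq_zero (fun _ hy => pd_eq_zero hy j) h)) i

theorem lap_eq_zero {φ : Eu n → ℝ} {x : Eu n} (hx : x ∉ tsupport φ) : lap φ x = 0 :=
  Finset.sum_eq_zero fun k _ => pd_pd_eq_zero hx k k

theorem lap_lap_eq_zero {φ : Eu n → ℝ} {x : Eu n} (hx : x ∉ tsupport φ) : lap (lap φ) x = 0 :=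
  lap_eq_zero fun h => hx (tsupport_subset_of_eq_zero (fun _ hy => lap_eq_zero hy) h)

theorem gradDot_eq_zero {φ : Eu n → ℝ} {x : Eu n} (hx : x ∉ tsupport φ) (f : Eu n → ℝ) :
    gradDot φ f x = 0 :=
  Finset.sum_eq_zero fun k _ => by rw [pd_eq_zero hx, zero_mul]

theorem morY_eq_zero {φ : Eu n → ℝ} {x : Eu n} (hx : x ∉ tsupport φ) (f : Eu n → ℝ) :
    morY φ f x = 0 := by
  rw [morY, gradDot_eq_zero hx, lap_eq_zero hx]; ring

theorem integrable_of_vanish {φ f : Eu n → ℝ} (hφ : HasCompactSupport φ) (hf : Continuous f)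
    (h : ∀ x, x ∉ tsupport φ → f x = 0) : Integrable f :=
  hf.integrable_of_hasCompactSupport (HasCompactSupport.intro hφ.isCompact h)

theorem integral_eq_of_sub_eq {φ f g h : Eu n → ℝ} (hφ : HasCompactSupport φ) (hf : Continuous f)
    (hg : Continuous g) (hf0 : ∀ x, x ∉ tsupport φ → f x = 0)
    (hg0 : ∀ x, x ∉ tsupport φ → g x = 0) (hh : ∀ x, f x - g x = h x) (h0 : ∫ x, h x = 0) :
    ∫ x, f x = ∫ x, g x := by
  rw [← sub_eq_zero, ← integral_sub (integrable_of_vanish hφ hf hf0)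
    (integrable_of_vanish hφ hg hg0)]
  simp only [hh, h0]

/-! ### Integration by parts -/

/-- Compact support of a single factor removes the boundary term. The weight φ supplies it, so no
decay of the solution is needed. -/
theorem integral_pd_mul {f g : Eu n → ℝ} (hf : ContDiff ℝ 1 f) (hg : ContDiff ℝ 1 g)
    (hc : HasCompactSupport f) (j : Fin n) :
    ∫ x, f x * pd j g x = - ∫ x, pd j f x * g x := by
  have hf' : Continuous (pd j f) := (contDiff_pd hf (k := 0) (by simp) j).continuous
  have hg' : Continuous (pd j g) := (contDiff_pd hg (k := 0) (by simp) j).continuous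
  refine integral_mul_fderiv_eq_neg_fderiv_mul_of_integrable ?_ ?_ ?_
    (fun x _ => hf.differentiable one_ne_zero x) (fun x _ => hg.differentiable one_ne_zero x)
  · exact integrable_of_vanish hc (hf'.mul hg.continuous) fun x hx => by
      change pd j f x * g x = 0
      rw [pd_eq_zero hx, zero_mul]
  · exact integrable_of_vanish hc (hf.continuous.mul hg') fun x hx => by
      simp only [image_eq_zero_of_notMem_tsupport hx, zero_mul]
  · exact integrable_of_vanish hc (hf.continuous.mul hg.continuous) fun x hx => by
      simp only [image_eq_zero_of_notMem_tsupport hx, zero_mul]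

theorem hasCompactSupport_pd {φ : Eu n → ℝ} (hφ : HasCompactSupport φ) (j : Fin n) :
    HasCompactSupport (pd j φ) :=
  HasCompactSupport.intro hφ.isCompact fun _ hx => pd_eq_zero hx j

variable {φ a b : Eu n → ℝ}

/-- `∫ (∇φ·∇h + Δφ h) = 0`. -/
theorem integral_gradDot_add_lap (hφ : ContDiff ℝ ∞ φ) (hφc : HasCompactSupport φ)
    {h : Eu n → ℝ} (hh : ContDiff ℝ 1 h) : ∫ x, (gradDot φ h x + lap φ x * h x) = 0 := by
  have hc : ∀ k, Continuous (pd k h) := fun k => (contDiff_pd hh (k := 0) (by simp) k).continuous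
  have h1 : ∀ k, Integrable fun x => pd k φ x * pd k h x := fun k =>
    integrable_of_vanish hφc ((contDiff_pd_top hφ k).continuous.mul (hc k)) fun x hx => by
      simp only [pd_eq_zero hx, zero_mul]
  have h2 : ∀ k, Integrable fun x => pd k (pd k φ) x * h x := fun k =>
    integrable_of_vanish hφc ((contDiff_pd_top (contDiff_pd_top hφ k) k).continuous.mul
      hh.continuous) fun x hx => by simp only [pd_pd_eq_zero hx, zero_mul]
  have e : ∀ x, gradDot φ h x + lap φ x * h x =
      ∑ k, (pd k φ x * pd k h x + pd k (pd k φ) x * h x) := fun x => by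
    rw [gradDot, lap, Finset.sum_mul, Finset.sum_add_distrib]
  simp only [e]
  have h3 : ∀ k, Integrable fun x => pd k φ x * pd k h x + pd k (pd k φ) x * h x :=
    fun k => (h1 k).add (h2 k)
  rw [integral_finsetSum _ fun k _ => h3 k]
  refine Finset.sum_eq_zero fun k _ => ?_
  rw [integral_add (h1 k) (h2 k), integral_pd_mul ((contDiff_pd_top hφ k).of_le (by simp)) hh
    (hasCompactSupport_pd hφc k)]
  ring

theorem pd_rotField (M : Matrix (Fin n) (Fin n) ℝ) (k l : Fin n) (x : Eu n) :
    pd k (fun y : Eu n => (rotField M y) l) x = M l k := by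
  simp only [rotField_apply]
  have h1 : ∀ m, ContDiff ℝ 1 fun y : Eu n => y m := fun m =>
    (EuclideanSpace.proj m : Eu n →L[ℝ] ℝ).contDiff
  rw [pd_sum (f := fun m (y : Eu n) => M l m * y m) _ fun m => contDiff_const.mul (h1 m)]
  have : ∀ m, pd k (fun y : Eu n => M l m * y m) x = if m = k then M l m else 0 := by
    intro m
    rw [pd_const_mul _ (h1 m), pd]
    have h2 : fderiv ℝ (fun y : Eu n => y m) x = (EuclideanSpace.proj m : Eu n →L[ℝ] ℝ) :=
      (EuclideanSpace.proj m : Eu n →L[ℝ] ℝ).fderiv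
    rw [h2]
    simp
  simp [this]

theorem skew_apply {M : Matrix (Fin n) (Fin n) ℝ} (hM : M = -Mᵀ) (i j : Fin n) :
    M i j = - M j i := by
  conv_lhs => rw [hM]
  simp

/-- `∫ A·∇h = 0` for a skew-symmetric rotation field. -/
theorem integral_rotD {M : Matrix (Fin n) (Fin n) ℝ} (hM : M = -Mᵀ)
    {h : Eu n → ℝ} (hh : ContDiff ℝ 1 h) (hc : HasCompactSupport h) : ∫ x, rotD M h x = 0 := by
  have h0 : ∀ l, Continuous (pd l h) := fun k => (contDiff_pd hh (k := 0) (by simp) k).continuous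
  have hA : ∀ l, ContDiff ℝ 1 fun x : Eu n => (rotField M x) l := fun l =>
    (contDiff_rotField_apply M l).of_le (by simp)
  have h1 : ∀ l, Integrable fun x => (rotField M x) l * pd l h x := fun l =>
    integrable_of_vanish hc ((hA l).continuous.mul (h0 l)) fun x hx => by
      simp only [pd_eq_zero hx, mul_zero]
  simp only [rotD]
  rw [integral_finsetSum _ fun l _ => h1 l]
  refine Finset.sum_eq_zero fun l _ => ?_
  have h2 := integral_pd_mul hh (hA l) hc l
  -- The l-th component of Mx does not depend on x_l, so A is divergence free term by term.
  have hMl : M l l = 0 := by have := skew_apply hM l l; linarith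
  simp only [pd_rotField, hMl, mul_zero, integral_zero] at h2
  simp only [mul_comm ((rotField M _) l)]
  linarith

theorem pd_gradDot (hφ : ContDiff ℝ ∞ φ) (ha : ContDiff ℝ ∞ a) (j : Fin n) (x : Eu n) :
    pd j (gradDot φ a) x = ∑ k, (pd k φ x * pd j (pd k a) x + pd k a x * pd j (pd k φ) x) := by
  have h1 := fun k => (contDiff_pd_top hφ k).of_le (m := 1) (by simp)
  have h2 := fun k => (contDiff_pd_top ha k).of_le (m := 1) (by simp)
  change pd j (fun y => ∑ k, pd k φ y * pd k a y) x = _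
  rw [pd_sum _ fun k => (h1 k).mul (h2 k)]
  exact Finset.sum_congr rfl fun k _ => pd_mul (h1 k) (h2 k) j x

theorem gradDot_mul {f g : Eu n → ℝ} (hf : ContDiff ℝ 1 f) (hg : ContDiff ℝ 1 g) (x : Eu n) :
    gradDot φ (fun y => f y * g y) x = f x * gradDot φ g x + g x * gradDot φ f x := by
  simp only [gradDot, pd_mul hf hg, Finset.mul_sum]
  rw [← Finset.sum_add_distrib]
  exact Finset.sum_congr rfl fun k _ => by ring

theorem gradDot_add {f g : Eu n → ℝ} (hf : ContDiff ℝ 1 f) (hg : ContDiff ℝ 1 g) (x : Eu n) :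
    gradDot φ (fun y => f y + g y) x = gradDot φ f x + gradDot φ g x := by
  simp only [gradDot, pd_add hf hg, mul_add]
  rw [← Finset.sum_add_distrib]

theorem rotD_mul (M : Matrix (Fin n) (Fin n) ℝ) {f g : Eu n → ℝ} (hf : ContDiff ℝ 1 f)
    (hg : ContDiff ℝ 1 g) (x : Eu n) :
    rotD M (fun y => f y * g y) x = f x * rotD M g x + g x * rotD M f x := by
  simp only [rotD, pd_mul hf hg, Finset.mul_sum]
  rw [← Finset.sum_add_distrib]
  exact Finset.sum_congr rfl fun k _ => by ring

/-- `∫ (-Δf) h = ∫ ∇f·∇h`, with the compact support on `h`. -/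
theorem integral_lap_mul {f h : Eu n → ℝ} (hf : ContDiff ℝ ∞ f) (hh : ContDiff ℝ 1 h)
    (hc : HasCompactSupport h) : ∫ x, (h x * lap f x + gradDot f h x) = 0 := by
  have hc' : ∀ k, Continuous (pd k h) := fun k => (contDiff_pd hh (k := 0) (by simp) k).continuous
  have h1 : ∀ k, Integrable fun x => pd k f x * pd k h x := fun k =>
    integrable_of_vanish hc ((contDiff_pd_top hf k).continuous.mul (hc' k)) fun x hx => by
      simp only [pd_eq_zero hx, mul_zero]
  have h2 : ∀ k, Integrable fun x => h x * pd k (pd k f) x := fun k =>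
    integrable_of_vanish hc (hh.continuous.mul
      (contDiff_pd_top (contDiff_pd_top hf k) k).continuous) fun x hx => by
      simp only [image_eq_zero_of_notMem_tsupport hx, zero_mul]
  have e : ∀ x, h x * lap f x + gradDot f h x =
      ∑ k, (h x * pd k (pd k f) x + pd k f x * pd k h x) := fun x => by
    rw [gradDot, lap, Finset.mul_sum, Finset.sum_add_distrib]
  simp only [e]
  have h3 : ∀ k, Integrable fun x => h x * pd k (pd k f) x + pd k f x * pd k h x :=
    fun k => (h2 k).add (h1 k)
  rw [integral_finsetSum _ fun k _ => h3 k]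
  refine Finset.sum_eq_zero fun k _ => ?_
  rw [integral_add (h2 k) (h1 k), integral_pd_mul hh ((contDiff_pd_top hf k).of_le (by simp)) hc]
  simp only [mul_comm (pd k h _)]
  ring

end PartialDerivatives

/-! ### Virial identities for smooth real functions -/

section VirialIdentities

variable {n : ℕ} {φ a b : Eu n → ℝ}

theorem integral_add_eq_zero {f g : Eu n → ℝ} (hf : Integrable f) (hg : Integrable g)
    (hf0 : ∫ x, f x = 0) (hg0 : ∫ x, g x = 0) : ∫ x, (f x + g x) = 0 := by
  rw [integral_add hf hg, hf0, hg0, add_zero]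

theorem integral_mul_eq_zero (c : ℝ) {f : Eu n → ℝ} (hf0 : ∫ x, f x = 0) :
    ∫ x, c * f x = 0 := by
  rw [integral_const_mul, hf0, mul_zero]

theorem integrable_gradDot_add_lap (hφ : ContDiff ℝ ∞ φ) (hφc : HasCompactSupport φ)
    {h : Eu n → ℝ} (hh : ContDiff ℝ 1 h) : Integrable fun x => gradDot φ h x + lap φ x * h x :=
  integrable_of_vanish hφc ((continuous_gradDot (hφ.of_le (by simp)) hh).add
    ((contDiff_lap hφ).continuous.mul hh.continuous)) fun x hx => by
      rw [gradDot_eq_zero hx, lap_eq_zero hx]; ring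

theorem integrable_lap_mul {f h : Eu n → ℝ} (hf : ContDiff ℝ ∞ f) (hh : ContDiff ℝ 1 h)
    (hc : HasCompactSupport h) : Integrable fun x => h x * lap f x + gradDot f h x :=
  integrable_of_vanish hc ((hh.continuous.mul (contDiff_lap hf).continuous).add
    (continuous_gradDot (hf.of_le (by simp)) hh)) fun x hx => by
      rw [image_eq_zero_of_notMem_tsupport hx, gradDot, Finset.sum_eq_zero fun k _ => by
        rw [pd_eq_zero hx, mul_zero]]
      ring

theorem gradDot_comm (f g : Eu n → ℝ) (x : Eu n) : gradDot f g x = gradDot g f x :=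
  Finset.sum_congr rfl fun _ _ => mul_comm _ _

/-- The Hessian form `∑ φ_{jk} a_j a_k`. -/
def hess (φ a : Eu n → ℝ) (x : Eu n) : ℝ :=
  ∑ j, ∑ k, pd j (pd k φ) x * (pd j a x * pd k a x)

theorem contDiff_hess (hφ : ContDiff ℝ ∞ φ) (ha : ContDiff ℝ ∞ a) : ContDiff ℝ ∞ (hess φ a) :=
  ContDiff.sum fun j _ => ContDiff.sum fun k _ =>
    (contDiff_pd_top (contDiff_pd_top hφ k) j).mul
      ((contDiff_pd_top ha j).mul (contDiff_pd_top ha k))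

theorem hess_eq_zero {x : Eu n} (hx : x ∉ tsupport φ) (a : Eu n → ℝ) : hess φ a x = 0 :=
  Finset.sum_eq_zero fun j _ => Finset.sum_eq_zero fun k _ => by
    rw [pd_pd_eq_zero hx, zero_mul]

theorem hasCompactSupport_lap (hφc : HasCompactSupport φ) : HasCompactSupport (lap φ) :=
  HasCompactSupport.intro hφc.isCompact fun _ hx => lap_eq_zero hx

theorem hasCompactSupport_morY (hφc : HasCompactSupport φ) : HasCompactSupport (morY φ a) :=
  HasCompactSupport.intro hφc.isCompact fun _ hx => morY_eq_zero hx a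

/-- The terms with second derivatives of a, namely 2∑ ∂_jφ-weighted products of ∂a and ∂²a, are
collected into ∇φ·∇|∇a|² by symmetry of the Hessian of a. They can then be integrated by parts,
which leaves only first derivatives of a. -/
theorem gradDot_morY (hφ : ContDiff ℝ ∞ φ) (ha : ContDiff ℝ ∞ a) (x : Eu n) :
    gradDot a (morY φ a) x = gradDot φ (gradDot a a) x + 2 * hess φ a x +
      a x * gradDot (lap φ) a x + lap φ x * gradDot a a x := by
  have h1 : ∀ j, pd j (morY φ a) x = 2 * pd j (gradDot φ a) x +
      (lap φ x * pd j a x + a x * pd j (lap φ) x) := by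
    intro j
    change pd j (fun y => 2 * gradDot φ a y + lap φ y * a y) x = _
    rw [pd_add (contDiff_const.mul ((contDiff_gradDot hφ ha).of_le (by simp)))
      (((contDiff_lap hφ).mul ha).of_le (by simp)),
      pd_const_mul _ ((contDiff_gradDot hφ ha).of_le (by simp)),
      pd_mul ((contDiff_lap hφ).of_le (by simp)) (ha.of_le (by simp))]
  have h2 : gradDot φ (gradDot a a) x = 2 * ∑ j, ∑ k, pd j a x * (pd k φ x * pd j (pd k a) x) := by
    have h3 : ∀ k, pd k (gradDot a a) x = ∑ j, 2 * (pd j a x * pd k (pd j a) x) := by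
      intro k
      rw [pd_gradDot ha ha k x]
      exact Finset.sum_congr rfl fun j _ => by ring
    simp only [gradDot.eq_1 φ, h3, Finset.mul_sum]
    rw [Finset.sum_comm]
    refine Finset.sum_congr rfl fun j _ => Finset.sum_congr rfl fun k _ => ?_
    rw [pd_comm ha k j]
    ring
  rw [h2]
  simp only [gradDot, h1, pd_gradDot hφ ha, hess, Finset.mul_sum]
  simp only [← Finset.sum_add_distrib]
  refine Finset.sum_congr rfl fun j _ => ?_
  simp only [Finset.mul_sum, mul_add, Finset.sum_add_distrib]
  have e1 : ∑ k, pd j a x * (2 * (pd k φ x * pd j (pd k a) x)) =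
      ∑ k, 2 * (pd j a x * (pd k φ x * pd j (pd k a) x)) :=
    Finset.sum_congr rfl fun k _ => by ring
  have e2 : ∑ k, pd j a x * (2 * (pd k a x * pd j (pd k φ) x)) =
      ∑ k, 2 * (pd j (pd k φ) x * (pd j a x * pd k a x)) :=
    Finset.sum_congr rfl fun k _ => by ring
  rw [e1, e2]
  ring

theorem gradDot_sq (ha : ContDiff ℝ ∞ a) (x : Eu n) :
    gradDot φ (fun y => a y * a y) x = 2 * (a x * gradDot φ a x) := by
  rw [gradDot_mul (ha.of_le (by simp)) (ha.of_le (by simp))]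
  ring

/-- The contribution of `-Δ` to the virial identity. -/
theorem integral_lap_morY (hφ : ContDiff ℝ ∞ φ) (hφc : HasCompactSupport φ)
    (ha : ContDiff ℝ ∞ a) :
    ∫ x, -2 * (lap a x * morY φ a x) = ∫ x, (4 * hess φ a x - lap (lap φ) x * (a x * a x)) := by
  have hY := contDiff_morY hφ ha
  have hq : ContDiff ℝ 1 (gradDot a a) := (contDiff_gradDot ha ha).of_le (by simp)
  have hs : ContDiff ℝ 1 fun y => a y * a y := (ha.mul ha).of_le (by simp)
  have hYc : HasCompactSupport (morY φ a) := hasCompactSupport_morY hφc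
  have hY1 : ContDiff ℝ 1 (morY φ a) := hY.of_le (by simp)
  refine integral_eq_of_sub_eq hφc
    -- The difference of the two integrands is a sum of three exact divergences: of (Ya)∇a, of
    -- |∇a|²∇φ and of a²∇Δφ.
    (h := fun x => -2 * (morY φ a x * lap a x + gradDot a (morY φ a) x) +
      (2 * (gradDot φ (gradDot a a) x + lap φ x * gradDot a a x) +
      (gradDot (lap φ) (fun y => a y * a y) x + lap (lap φ) x * (a x * a x)))) ?_ ?_ ?_ ?_ ?_ ?_
  · exact continuous_const.mul ((contDiff_lap ha).continuous.mul hY.continuous)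
  · exact (continuous_const.mul (contDiff_hess hφ ha).continuous).sub
      ((contDiff_lap (contDiff_lap hφ)).continuous.mul hs.continuous)
  · intro x hx
    rw [morY_eq_zero hx]; ring
  · intro x hx
    rw [hess_eq_zero hx, lap_lap_eq_zero hx]; ring
  · intro x
    rw [gradDot_morY hφ ha, gradDot_sq ha]
    ring
  · refine integral_add_eq_zero ((integrable_lap_mul ha hY1 hYc).const_mul _)
      (((integrable_gradDot_add_lap hφ hφc hq).const_mul _).add
        (integrable_gradDot_add_lap (contDiff_lap hφ) (hasCompactSupport_lap hφc) hs))
      (integral_mul_eq_zero _ (integral_lap_mul ha hY1 hYc)) ?_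
    exact integral_add_eq_zero ((integrable_gradDot_add_lap hφ hφc hq).const_mul _)
        (integrable_gradDot_add_lap (contDiff_lap hφ) (hasCompactSupport_lap hφc) hs)
      (integral_mul_eq_zero _ (integral_gradDot_add_lap hφ hφc hq))
      (integral_gradDot_add_lap (contDiff_lap hφ) (hasCompactSupport_lap hφc) hs)

/-- The contribution of the potential to the virial identity. -/
theorem integral_potential_morY (hφ : ContDiff ℝ ∞ φ) (hφc : HasCompactSupport φ)
    (ha : ContDiff ℝ ∞ a) {V : Eu n → ℝ} (hV : ContDiff ℝ 1 V) :
    ∫ x, 2 * (V x * a x * morY φ a x) = ∫ x, -2 * (gradDot φ V x * (a x * a x)) := by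
  have hs : ContDiff ℝ 1 fun y => a y * a y := (ha.mul ha).of_le (by simp)
  have hVs : ContDiff ℝ 1 fun y => V y * (a y * a y) := hV.mul hs
  refine integral_eq_of_sub_eq hφc
    (h := fun x => 2 * (gradDot φ (fun y => V y * (a y * a y)) x + lap φ x * (V x * (a x * a x))))
    ?_ ?_ ?_ ?_ ?_ (integral_mul_eq_zero _ (integral_gradDot_add_lap hφ hφc hVs))
  · exact continuous_const.mul ((hV.continuous.mul ha.continuous).mul
      (contDiff_morY hφ ha).continuous)
  · exact continuous_const.mul ((continuous_gradDot (hφ.of_le (by simp)) hV).mul hs.continuous)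
  · intro x hx
    rw [morY_eq_zero hx]; ring
  · intro x hx
    rw [gradDot_eq_zero hx]; ring
  · intro x
    rw [gradDot_mul hV hs, gradDot_sq ha, morY]
    ring

/-- The contribution of the power nonlinearity to the virial identity. -/
theorem integral_power_morY (hφ : ContDiff ℝ ∞ φ) (hφc : HasCompactSupport φ)
    (ha : ContDiff ℝ ∞ a) (hb : ContDiff ℝ ∞ b) {p : ℝ} (hp : 1 ≤ p) :
    ∫ x, 2 * ((a x * a x + b x * b x) ^ ((p - 1) / 2) * (a x * morY φ a x + b x * morY φ b x)) =
      ∫ x, 2 * (p - 1) / (p + 1) * (lap φ x * (a x * a x + b x * b x) ^ ((p + 1) / 2)) := by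
  have hsa : ContDiff ℝ 1 fun y => a y * a y := (ha.mul ha).of_le (by simp)
  have hsb : ContDiff ℝ 1 fun y => b y * b y := (hb.mul hb).of_le (by simp)
  have hw : ContDiff ℝ 1 fun y => a y * a y + b y * b y := hsa.add hsb
  -- With w = a² + b², the power w^{(p+1)/2} is C¹ even across zeros of w, because the exponent is
  -- at least 1.
  have hp1 : 1 ≤ (p + 1) / 2 := by linarith
  have hh : ContDiff ℝ 1 fun y => (a y * a y + b y * b y) ^ ((p + 1) / 2) :=
    (Real.contDiff_rpow_const_of_le (n := 1) (by exact_mod_cast hp1)).comp hw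
  have hz : Continuous fun y => (a y * a y + b y * b y) ^ ((p - 1) / 2) :=
    hw.continuous.rpow_const fun x => Or.inr (by linarith)
  have hgrad : ∀ x, gradDot φ (fun y => (a y * a y + b y * b y) ^ ((p + 1) / 2)) x =
      (p + 1) / 2 * (a x * a x + b x * b x) ^ ((p - 1) / 2) *
        gradDot φ (fun y => a y * a y + b y * b y) x := by
    intro x
    simp only [gradDot, Finset.mul_sum]
    refine Finset.sum_congr rfl fun k _ => ?_
    have h1 := (Real.hasDerivAt_rpow_const (x := a x * a x + b x * b x) (p := (p + 1) / 2)
      (Or.inr hp1)).comp_hasFDerivAt x (hw.differentiable one_ne_zero x).hasFDerivAt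
    have h2 : pd k (fun y => (a y * a y + b y * b y) ^ ((p + 1) / 2)) x =
        ((p + 1) / 2 * (a x * a x + b x * b x) ^ ((p + 1) / 2 - 1)) *
        pd k (fun y => a y * a y + b y * b y) x := by
      change fderiv ℝ _ x _ = _
      have h3 := h1.fderiv
      simp only [Function.comp_def] at h3
      rw [h3]
      rfl
    rw [h2, show (p + 1) / 2 - 1 = (p - 1) / 2 by ring]
    ring
  have hzw : ∀ x, (a x * a x + b x * b x) ^ ((p + 1) / 2) =
      (a x * a x + b x * b x) ^ ((p - 1) / 2) * (a x * a x + b x * b x) := by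
    intro x
    have h0 : 0 ≤ a x * a x + b x * b x := add_nonneg (mul_self_nonneg _) (mul_self_nonneg _)
    rcases h0.eq_or_lt with h | h
    · rw [← h, mul_zero, Real.zero_rpow (by linarith)]
    · conv_rhs => rw [← Real.rpow_add_one h.ne']
      congr 1
      ring
  refine integral_eq_of_sub_eq hφc
    -- The factor 4/(p+1) comes from w^{(p-1)/2}∇w = (2/(p+1))∇w^{(p+1)/2}; the coefficient left on
    -- Δφ is 2 - 4/(p+1) = 2(p-1)/(p+1).
    (h := fun x => 4 / (p + 1) * (gradDot φ (fun y => (a y * a y + b y * b y) ^ ((p + 1) / 2)) x +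
      lap φ x * (a x * a x + b x * b x) ^ ((p + 1) / 2)))
    ?_ ?_ ?_ ?_ ?_ (integral_mul_eq_zero _ (integral_gradDot_add_lap hφ hφc hh))
  · exact continuous_const.mul (hz.mul ((ha.continuous.mul (contDiff_morY hφ ha).continuous).add
      (hb.continuous.mul (contDiff_morY hφ hb).continuous)))
  · exact continuous_const.mul ((contDiff_lap hφ).continuous.mul hh.continuous)
  · intro x hx
    rw [morY_eq_zero hx, morY_eq_zero hx]; ring
  · intro x hx
    rw [lap_eq_zero hx]; ring
  · intro x
    rw [hgrad, gradDot_add hsa hsb, gradDot_sq ha, gradDot_sq hb, hzw, morY, morY]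
    have : p + 1 ≠ 0 := by linarith
    field_simp
    ring

/-- The rotation field annihilates `φ`, hence commutes with `∇φ·∇`. -/
theorem gradDot_rotD {M : Matrix (Fin n) (Fin n) ℝ} (hM : M = -Mᵀ) (hφ : ContDiff ℝ ∞ φ)
    (hB : ∀ x, rotD M φ x = 0) (ha : ContDiff ℝ ∞ a) (x : Eu n) :
    gradDot φ (rotD M a) x = rotD M (gradDot φ a) x := by
  have hA : ∀ l, ContDiff ℝ 1 fun x : Eu n => (rotField M x) l := fun l =>
    (contDiff_rotField_apply M l).of_le (by simp)
  have hpd : ∀ {f : Eu n → ℝ}, ContDiff ℝ ∞ f → ∀ k, pd k (rotD M f) x =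
      ∑ l, ((rotField M x) l * pd k (pd l f) x + pd l f x * M l k) := by
    intro f hf k
    have h2 := fun l => (contDiff_pd_top hf l).of_le (m := 1) (by simp)
    change pd k (fun y => ∑ l, (rotField M y) l * pd l f y) x = _
    rw [pd_sum _ fun l => (hA l).mul (h2 l)]
    refine Finset.sum_congr rfl fun l _ => ?_
    rw [pd_mul (hA l) (h2 l), pd_rotField]
  -- Differentiating Bφ = 0 in the k-th direction gives the derivative of ∂_kφ along A. This is
  -- exactly what cancels the zeroth-order part of the commutator of B with X.
  have hφk : ∀ k, ∑ l, (rotField M x) l * pd l (pd k φ) x = ∑ l, pd l φ x * M k l := by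
    intro k
    have h1 := hpd hφ k
    have h2 : pd k (rotD M φ) x = 0 := by
      have : rotD M φ = fun _ => 0 := funext hB
      rw [this, pd]; simp
    rw [h2, Finset.sum_add_distrib] at h1
    have h3 : ∑ l, pd l φ x * M l k = - ∑ l, pd l φ x * M k l := by
      rw [← Finset.sum_neg_distrib]
      exact Finset.sum_congr rfl fun l _ => by rw [skew_apply hM l k]; ring
    have h4 : ∑ l, (rotField M x) l * pd k (pd l φ) x = ∑ l, (rotField M x) l * pd l (pd k φ) x :=
      Finset.sum_congr rfl fun l _ => by rw [pd_comm hφ]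
    rw [h3, h4] at h1
    linarith
  have e1 : rotD M (gradDot φ a) x = ∑ k, pd k a x * (∑ l, (rotField M x) l * pd l (pd k φ) x) +
      ∑ k, ∑ l, pd k φ x * ((rotField M x) l * pd k (pd l a) x) := by
    simp only [rotD, pd_gradDot hφ ha, Finset.mul_sum]
    rw [← Finset.sum_add_distrib, Finset.sum_comm]
    refine Finset.sum_congr rfl fun k _ => ?_
    rw [← Finset.sum_add_distrib]
    refine Finset.sum_congr rfl fun l _ => ?_
    rw [pd_comm ha k l]
    ring
  rw [e1]
  simp only [hφk, gradDot, hpd ha, Finset.mul_sum]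
  rw [Finset.sum_comm, ← Finset.sum_add_distrib]
  have e2 : ∀ l, ∑ k, pd k φ x * ((rotField M x) l * pd k (pd l a) x + pd l a x * M l k) =
      ∑ k, pd k φ x * ((rotField M x) l * pd k (pd l a) x) +
      ∑ k, pd l a x * (pd k φ x * M l k) := by
    intro l
    rw [← Finset.sum_add_distrib]
    exact Finset.sum_congr rfl fun k _ => by ring
  simp only [e2, Finset.sum_add_distrib]
  rw [Finset.sum_comm, add_comm]

/-- The right-hand side is symmetric in a and b, whereas the rotation enters the virial identity
through the antisymmetric combination; hence it contributes nothing. The proof integrates by parts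
with X and with B, the remaining terms matching because X and B commute. -/
theorem integral_rotD_morY {M : Matrix (Fin n) (Fin n) ℝ} (hM : M = -Mᵀ) (hφ : ContDiff ℝ ∞ φ)
    (hφc : HasCompactSupport φ) (hB : ∀ x, rotD M φ x = 0) (ha : ContDiff ℝ ∞ a)
    (hb : ContDiff ℝ ∞ b) :
    ∫ x, rotD M a x * morY φ b x = ∫ x, (rotD M a x * gradDot φ b x + rotD M b x * gradDot φ a x) := by
  have hBa := contDiff_rotD M ha
  have hBb := contDiff_rotD M hb
  have hXa := contDiff_gradDot hφ ha
  have hXb := contDiff_gradDot hφ hb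
  have h1 : ContDiff ℝ 1 fun x => b x * rotD M a x := (hb.mul hBa).of_le (by simp)
  have h2 : ContDiff ℝ 1 fun x => b x * gradDot φ a x := (hb.mul hXa).of_le (by simp)
  have h2c : HasCompactSupport fun x => b x * gradDot φ a x :=
    HasCompactSupport.intro hφc.isCompact fun x hx => by rw [gradDot_eq_zero hx, mul_zero]
  have hi : Integrable fun x => rotD M (fun x => b x * gradDot φ a x) x := by
    refine integrable_of_vanish h2c (contDiff_rotD M (hb.mul hXa)).continuous fun x hx => ?_
    exact Finset.sum_eq_zero fun l _ => by rw [pd_eq_zero hx, mul_zero]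
  refine integral_eq_of_sub_eq hφc
    (h := fun x => (gradDot φ (fun x => b x * rotD M a x) x + lap φ x * (b x * rotD M a x)) +
      -1 * rotD M (fun x => b x * gradDot φ a x) x) ?_ ?_ ?_ ?_ ?_
    (integral_add_eq_zero (integrable_gradDot_add_lap hφ hφc h1) (hi.const_mul _)
      (integral_gradDot_add_lap hφ hφc h1) (integral_mul_eq_zero _ (integral_rotD hM h2 h2c)))
  · exact hBa.continuous.mul (contDiff_morY hφ hb).continuous
  · exact (hBa.continuous.mul hXb.continuous).add (hBb.continuous.mul hXa.continuous)
  · intro x hx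
    rw [morY_eq_zero hx]; ring
  · intro x hx
    rw [gradDot_eq_zero hx, gradDot_eq_zero hx]; ring
  · intro x
    rw [gradDot_mul (hb.of_le (by simp)) (hBa.of_le (by simp)),
      rotD_mul M (hb.of_le (by simp)) (hXa.of_le (by simp)), gradDot_rotD hM hφ hB ha, morY]
    ring

/-- `∫ φ (b Δa - a Δb) = ∫ (a ∇φ·∇b - b ∇φ·∇a)`. -/
theorem integral_mul_lap_sub (hφ : ContDiff ℝ ∞ φ) (hφc : HasCompactSupport φ)
    (ha : ContDiff ℝ ∞ a) (hb : ContDiff ℝ ∞ b) :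
    ∫ x, φ x * (b x * lap a x - a x * lap b x) =
      ∫ x, (a x * gradDot φ b x - b x * gradDot φ a x) := by
  have h1 : ContDiff ℝ 1 fun x => φ x * b x := (hφ.mul hb).of_le (by simp)
  have h2 : ContDiff ℝ 1 fun x => φ x * a x := (hφ.mul ha).of_le (by simp)
  have h1c : HasCompactSupport fun x => φ x * b x := hφc.mul_right
  have h2c : HasCompactSupport fun x => φ x * a x := hφc.mul_right
  have hφ1 : ContDiff ℝ 1 φ := hφ.of_le (by simp)
  refine integral_eq_of_sub_eq hφc
    (h := fun x => (φ x * b x * lap a x + gradDot a (fun x => φ x * b x) x) +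
      -1 * (φ x * a x * lap b x + gradDot b (fun x => φ x * a x) x)) ?_ ?_ ?_ ?_ ?_
    (integral_add_eq_zero (integrable_lap_mul ha h1 h1c)
      ((integrable_lap_mul hb h2 h2c).const_mul _)
      (integral_lap_mul ha h1 h1c) (integral_mul_eq_zero _ (integral_lap_mul hb h2 h2c)))
  · exact hφ.continuous.mul ((hb.continuous.mul (contDiff_lap ha).continuous).sub
      (ha.continuous.mul (contDiff_lap hb).continuous))
  · exact (ha.continuous.mul (contDiff_gradDot hφ hb).continuous).sub
      (hb.continuous.mul (contDiff_gradDot hφ ha).continuous)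
  · intro x hx
    rw [image_eq_zero_of_notMem_tsupport hx]; ring
  · intro x hx
    rw [gradDot_eq_zero hx, gradDot_eq_zero hx]; ring
  · intro x
    rw [gradDot_mul hφ1 (hb.of_le (by simp)), gradDot_mul hφ1 (ha.of_le (by simp)),
      gradDot_comm a φ, gradDot_comm b φ, gradDot_comm b a]
    ring

/-- As Bφ = 0, the integrand is half of B(φa²), and A is divergence free. So the rotation does not
affect the localized mass. -/
theorem integral_mul_rotD {M : Matrix (Fin n) (Fin n) ℝ} (hM : M = -Mᵀ) (hφ : ContDiff ℝ ∞ φ)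
    (hφc : HasCompactSupport φ) (hB : ∀ x, rotD M φ x = 0) (ha : ContDiff ℝ ∞ a) :
    ∫ x, φ x * (a x * rotD M a x) = 0 := by
  have h1 : ContDiff ℝ 1 fun x => φ x * (a x * a x) := (hφ.mul (ha.mul ha)).of_le (by simp)
  have h2 := integral_rotD hM h1 hφc.mul_right
  have e : ∀ x, φ x * (a x * rotD M a x) = 1 / 2 * rotD M (fun x => φ x * (a x * a x)) x := by
    intro x
    rw [rotD_mul M (hφ.of_le (by simp)) ((ha.mul ha).of_le (by simp)),
      rotD_mul M (ha.of_le (by simp)) (ha.of_le (by simp)), hB]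
    ring
  simp only [e]
  exact integral_mul_eq_zero _ h2

/-- Antisymmetry of `2 ∇φ·∇ + Δφ`. -/
theorem integral_mul_morY (hφ : ContDiff ℝ ∞ φ) (hφc : HasCompactSupport φ)
    (ha : ContDiff ℝ ∞ a) (hb : ContDiff ℝ ∞ b) :
    ∫ x, a x * morY φ b x = ∫ x, - (b x * morY φ a x) := by
  have h1 : ContDiff ℝ 1 fun x => a x * b x := (ha.mul hb).of_le (by simp)
  refine integral_eq_of_sub_eq hφc
    (h := fun x => 2 * (gradDot φ (fun x => a x * b x) x + lap φ x * (a x * b x))) ?_ ?_ ?_ ?_ ?_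
    (integral_mul_eq_zero _ (integral_gradDot_add_lap hφ hφc h1))
  · exact ha.continuous.mul (contDiff_morY hφ hb).continuous
  · exact (hb.continuous.mul (contDiff_morY hφ ha).continuous).neg
  · intro x hx
    rw [morY_eq_zero hx]; ring
  · intro x hx
    rw [morY_eq_zero hx]; ring
  · intro x
    rw [gradDot_mul (ha.of_le (by simp)) (hb.of_le (by simp)), morY, morY]
    ring

/-- The integrands differ by the divergence of ab∇φ. This rewrites the current with the
antisymmetric operator Y, the form in which it is differentiated in time. -/
theorem integral_gradDot_sub (hφ : ContDiff ℝ ∞ φ) (hφc : HasCompactSupport φ)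
    (ha : ContDiff ℝ ∞ a) (hb : ContDiff ℝ ∞ b) :
    ∫ x, (a x * gradDot φ b x - b x * gradDot φ a x) = ∫ x, a x * morY φ b x := by
  have h1 : ContDiff ℝ 1 fun x => a x * b x := (ha.mul hb).of_le (by simp)
  refine integral_eq_of_sub_eq hφc
    (h := fun x => -1 * (gradDot φ (fun x => a x * b x) x + lap φ x * (a x * b x))) ?_ ?_ ?_ ?_ ?_
    (integral_mul_eq_zero _ (integral_gradDot_add_lap hφ hφc h1))
  · exact (ha.continuous.mul (contDiff_gradDot hφ hb).continuous).sub
      (hb.continuous.mul (contDiff_gradDot hφ ha).continuous)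
  · exact ha.continuous.mul (contDiff_morY hφ hb).continuous
  · intro x hx
    rw [gradDot_eq_zero hx, gradDot_eq_zero hx]; ring
  · intro x hx
    rw [morY_eq_zero hx]; ring
  · intro x
    rw [gradDot_mul (ha.of_le (by simp)) (hb.of_le (by simp)), morY]
    ring

end VirialIdentities

/-! ### The mollified equation and its commutators -/

section MollifiedEquation

variable {n : ℕ}

/-- The real part of a complex function. -/
def reF (f : Eu n → ℂ) (x : Eu n) : ℝ := (f x).re

/-- The imaginary part of a complex function. -/
def imF (f : Eu n → ℂ) (x : Eu n) : ℝ := (f x).im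

theorem contDiff_reF {f : Eu n → ℂ} (hf : ContDiff ℝ ∞ f) : ContDiff ℝ ∞ (reF f) :=
  Complex.reCLM.contDiff.comp hf

theorem contDiff_imF {f : Eu n → ℂ} (hf : ContDiff ℝ ∞ f) : ContDiff ℝ ∞ (imF f) :=
  Complex.imCLM.contDiff.comp hf

theorem pd_reF {f : Eu n → ℂ} (hf : ContDiff ℝ ∞ f) (j : Fin n) (x : Eu n) :
    pd j (reF f) x = (fderiv ℝ f x (EuclideanSpace.single j 1)).re := by
  have h := (Complex.reCLM.hasFDerivAt (x := f x)).comp x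
    (hf.differentiable (by simp) x).hasFDerivAt
  change fderiv ℝ (Complex.reCLM ∘ f) x _ = _
  rw [h.fderiv]
  rfl

theorem pd_imF {f : Eu n → ℂ} (hf : ContDiff ℝ ∞ f) (j : Fin n) (x : Eu n) :
    pd j (imF f) x = (fderiv ℝ f x (EuclideanSpace.single j 1)).im := by
  have h := (Complex.imCLM.hasFDerivAt (x := f x)).comp x
    (hf.differentiable (by simp) x).hasFDerivAt
  change fderiv ℝ (Complex.imCLM ∘ f) x _ = _
  rw [h.fderiv]
  rfl

theorem gradient_apply_pd (f : Eu n → ℝ) (x : Eu n) (j : Fin n) : (∇ f x) j = pd j f x :=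
  gradient_apply f x j

/-- The complex form of the operator `2 ∇φ·∇ + Δφ`, applied to a function with given gradient. -/
def morC (φ : Eu n → ℝ) (f : Eu n → ℂ) (g : Eu n → EuclideanSpace ℂ (Fin n)) (x : Eu n) : ℂ :=
  2 * dotC (∇ φ x) (g x) + (lap φ x : ℂ) * f x

theorem dotC_re (a : Eu n) (z : EuclideanSpace ℂ (Fin n)) : (dotC a z).re = ∑ j, a j * (z j).re := by
  simp [dotC]

theorem dotC_im (a : Eu n) (z : EuclideanSpace ℂ (Fin n)) : (dotC a z).im = ∑ j, a j * (z j).im := by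
  simp [dotC]

section FixedTime

variable {f : Eu n → ℂ} {g : Eu n → EuclideanSpace ℂ (Fin n)} (k : ℕ)
  (φ : Eu n → ℝ) (x : Eu n)

theorem pd_reF_mol (h : IsWeakGrad f g) (j : Fin n) : pd j (reF (mol k f)) x = (mol k g x j).re := by
  rw [pd_reF (contDiff_mol k h.1), fderiv_mol h, dotC_single]

theorem pd_imF_mol (h : IsWeakGrad f g) (j : Fin n) : pd j (imF (mol k f)) x = (mol k g x j).im := by
  rw [pd_imF (contDiff_mol k h.1), fderiv_mol h, dotC_single]

theorem gradDot_reF_mol (h : IsWeakGrad f g) : gradDot φ (reF (mol k f)) x = (dotC (∇ φ x) (mol k g x)).re := by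
  simp only [gradDot, pd_reF_mol k x h, dotC_re, gradient_apply_pd]

theorem gradDot_imF_mol (h : IsWeakGrad f g) : gradDot φ (imF (mol k f)) x = (dotC (∇ φ x) (mol k g x)).im := by
  simp only [gradDot, pd_imF_mol k x h, dotC_im, gradient_apply_pd]

theorem morY_reF_mol (h : IsWeakGrad f g) : morY φ (reF (mol k f)) x = (morC φ (mol k f) (mol k g) x).re := by
  rw [morY, gradDot_reF_mol k φ x h, morC]
  simp [reF]

theorem morY_imF_mol (h : IsWeakGrad f g) : morY φ (imF (mol k f)) x = (morC φ (mol k f) (mol k g) x).im := by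
  rw [morY, gradDot_imF_mol k φ x h, morC]
  simp [imF]

theorem rotD_reF_mol (h : IsWeakGrad f g) (M : Matrix (Fin n) (Fin n) ℝ) :
    rotD M (reF (mol k f)) x = (dotC (rotField M x) (mol k g x)).re := by
  simp only [rotD, pd_reF_mol k x h, dotC_re]

theorem rotD_imF_mol (h : IsWeakGrad f g) (M : Matrix (Fin n) (Fin n) ℝ) :
    rotD M (imF (mol k f)) x = (dotC (rotField M x) (mol k g x)).im := by
  simp only [rotD, pd_imF_mol k x h, dotC_im]

theorem locallyIntegrable_coord {g : Eu n → EuclideanSpace ℂ (Fin n)} (hg : LocallyIntegrable g)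
    (j : Fin n) : LocallyIntegrable fun x => g x j := fun x => by
  obtain ⟨s, hs, hi⟩ := hg x
  exact ⟨s, hs, ((EuclideanSpace.proj j :
    EuclideanSpace ℂ (Fin n) →L[ℂ] ℂ).restrictScalars ℝ).integrable_comp hi⟩

/-- The Laplacian term of the equation as a sum of convolutions. -/
theorem integral_gradient_kern_eq_sum (hg : LocallyIntegrable g) :
    ∫ y, dotC (∇ (fun y => kern n k (x - y)) y) (g y) =
      -∑ j, cv (fun y => fderiv ℝ (kern n k) y (EuclideanSpace.single j 1)) (fun y => g y j) x := by
  have hi : ∀ j, Integrable fun y =>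
      fderiv ℝ (kern n k) (x - y) (EuclideanSpace.single j 1) • g y j := fun j => by
    refine integrable_cv (η := fun y => fderiv ℝ (kern n k) y (EuclideanSpace.single j 1)) ?_ ?_
      (locallyIntegrable_coord hg j) x
    · exact ((contDiff_kern k).continuous_fderiv (by simp)).clm_apply continuous_const
    · exact ((hasCompactSupport_kern k).fderiv ℝ).comp_left
        (g := fun L : Eu n →L[ℝ] ℝ => L (EuclideanSpace.single j 1)) rfl
  have e : ∀ y, dotC (∇ (fun y => kern n k (x - y)) y) (g y) =
      -∑ j, fderiv ℝ (kern n k) (x - y) (EuclideanSpace.single j 1) • g y j := by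
    intro y
    rw [dotC, ← Finset.sum_neg_distrib]
    refine Finset.sum_congr rfl fun j _ => ?_
    rw [gradient_kern_sub, Complex.real_smul]
    push_cast
    ring
  simp only [e]
  rw [integral_neg, integral_finsetSum _ fun j _ => hi j]
  rfl

/-- The Laplacian term of the equation, tested against a mollifying kernel. -/
theorem integral_gradient_kern (h : IsWeakGrad f g) :
    ∫ y, dotC (∇ (fun y => kern n k (x - y)) y) (g y) =
      -((lap (reF (mol k f)) x : ℂ) + Complex.I * lap (imF (mol k f)) x) := by
  have hgj := locallyIntegrable_coord h.2.1
  have hcd : ∀ j, ContDiff ℝ ∞ (mol k fun y => g y j) := fun j => contDiff_mol k (hgj j)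
  have h1 : ∀ j, cv (fun y => fderiv ℝ (kern n k) y (EuclideanSpace.single j 1))
      (fun y => g y j) x = (pd j (pd j (reF (mol k f))) x : ℂ) +
        Complex.I * pd j (pd j (imF (mol k f))) x := by
    intro j
    rw [← fderiv_cv (contDiff_kern k) (hasCompactSupport_kern k) (hgj j)]
    have e1 : pd j (reF (mol k f)) = reF (mol k fun y => g y j) := by
      ext y; rw [pd_reF_mol k y h, mol_apply k h.2.1]; rfl
    have e2 : pd j (imF (mol k f)) = imF (mol k fun y => g y j) := by
      ext y; rw [pd_imF_mol k y h, mol_apply k h.2.1]; rfl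
    rw [e1, e2, pd_reF (hcd j), pd_imF (hcd j), mul_comm]
    exact (Complex.re_add_im _).symm
  rw [integral_gradient_kern_eq_sum k x h.2.1]
  simp only [h1, Finset.sum_add_distrib, ← Finset.mul_sum, lap]
  push_cast
  rfl

end FixedTime

/-- The right-hand side of the equation for `(f, ∇f) = (f, g)`, mollified. -/
def rhsC (M : Matrix (Fin n) (Fin n) ℝ) (V : Eu n → ℝ) (lam p : ℝ) (k : ℕ) (f : Eu n → ℂ)
    (g : Eu n → EuclideanSpace ℂ (Fin n)) (x : Eu n) : ℂ :=
  (∫ y, dotC (∇ (fun y => kern n k (x - y)) y) (g y))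
    + mol k (fun y => V y • f y) x - (lam : ℂ) * mol k (fun y => powNL p (f y)) x
    + mol k (fun y => Complex.I * dotC (rotField M y) (g y)) x

/-- The equation satisfied by the mollified solution. -/
theorem SolvesNLS.hasDerivWithinAt_mol {M : Matrix (Fin n) (Fin n) ℝ} {V : Eu n → ℝ} {lam p : ℝ}
    {T : EReal} {u : ℝ → Eu n → ℂ} (hu : SolvesNLS M V lam p T u) (k : ℕ) (x : Eu n) {t : ℝ}
    (ht : t ∈ timeInterval T) :
    HasDerivWithinAt (fun s => mol k (u s) x)
      (-Complex.I * rhsC M V lam p k (u t) (weakGrad (u t)) x) (timeInterval T) t := by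
  have h1 := (hu _ (isTest_kern_sub k x) t ht).const_mul (-Complex.I)
  have e1 : (fun s => -Complex.I * (Complex.I * ∫ y, ((kern n k (x - y) : ℝ) : ℂ) * u s y)) =
      fun s => mol k (u s) x := by
    ext s
    rw [← mul_assoc, neg_mul, Complex.I_mul_I, neg_neg, one_mul]
    simp only [mol, cv, Complex.real_smul]
  rw [e1] at h1
  convert! h1 using 2

variable (M : Matrix (Fin n) (Fin n) ℝ) (V : Eu n → ℝ) (lam p : ℝ) (R : ℝ) (k : ℕ)
  (f : Eu n → ℂ) (g : Eu n → EuclideanSpace ℂ (Fin n))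

/-- Restriction to the ball of radius `R + 1`. -/
def cut {F : Type*} [Zero F] (R : ℝ) (w : Eu n → F) : Eu n → F :=
  (Metric.ball 0 (R + 1)).indicator w

/-- The commutator of mollification with the linear lower order terms. -/
def errLin (x : Eu n) : ℂ :=
  (mol k (cut R fun y => V y • f y) x - V x • mol k f x) +
    Complex.I * (mol k (cut R fun y => dotC (rotField M y) (g y)) x -
      dotC (rotField M x) (mol k g x))

/-- The commutator of mollification with the power nonlinearity. -/
def errPow (x : Eu n) : ℂ :=
  mol k (cut R fun y => powNL p (f y)) x - powNL p (mol k f x)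

variable {M V lam p R k f g}

theorem mol_I_mul (h : Eu n → ℂ) (x : Eu n) :
    mol k (fun y => Complex.I * h y) x = Complex.I * mol k h x := by
  simp only [mol, cv, Complex.real_smul]
  rw [← integral_const_mul]
  congr 1
  ext y
  ring

/-- On the ball, mollified products see only values within distance 1, so cutting at radius R + 1
changes nothing there. The Laplacian has constant coefficients and produces no commutator. -/
theorem rhsC_eq (h : IsWeakGrad f g) {x : Eu n} (hx : x ∈ Metric.ball (0 : Eu n) R) :
    rhsC M V lam p k f g x =
      -((lap (reF (mol k f)) x : ℂ) + Complex.I * lap (imF (mol k f)) x) + V x • mol k f x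
      - lam * powNL p (mol k f x) + Complex.I * dotC (rotField M x) (mol k g x)
      + (errLin M V R k f g x - lam * errPow p R k f x) := by
  rw [rhsC, errLin, errPow, integral_gradient_kern k x h, mol_I_mul]
  simp only [cut]
  rw [mol_indicator k _ hx, mol_indicator k _ hx, mol_indicator k _ hx]
  ring

end MollifiedEquation

/-! ### Mass and virial identities for mollified functions at a fixed time -/

section FixedTimeIdentities

variable {n : ℕ}

/-- The Hessian form of `φ` on complex vectors. -/
def hessC (φ : Eu n → ℝ) (g : Eu n → EuclideanSpace ℂ (Fin n)) (x : Eu n) : ℝ :=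
  ∑ j, ∑ k, pd j (pd k φ) x * ((g x j).re * (g x k).re + (g x j).im * (g x k).im)

/-- The virial current `2 Im ∫ f̄ ∇φ·g`. -/
def virialK (φ : Eu n → ℝ) (f : Eu n → ℂ) (g : Eu n → EuclideanSpace ℂ (Fin n)) : ℝ :=
  2 * (∫ x, starRingEnd ℂ (f x) * dotC (∇ φ x) (g x)).im

/-- The second derivative in the virial identity. -/
def virialP (φ V : Eu n → ℝ) (lam p : ℝ) (f : Eu n → ℂ) (g : Eu n → EuclideanSpace ℂ (Fin n)) : ℝ :=
  4 * (∫ x, hessC φ g x) - (∫ x, lap (lap φ) x * ‖f x‖ ^ 2)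
    - 2 * (∫ x, gradDot φ V x * ‖f x‖ ^ 2)
    - 2 * lam * (p - 1) / (p + 1) * (∫ x, lap φ x * ‖f x‖ ^ (p + 1))

/-- The right-hand side of the equation, for smooth functions. -/
def rhsSmooth (M : Matrix (Fin n) (Fin n) ℝ) (V : Eu n → ℝ) (lam p : ℝ) (v : Eu n → ℂ)
    (w : Eu n → EuclideanSpace ℂ (Fin n)) (x : Eu n) : ℂ :=
  -((lap (reF v) x : ℂ) + Complex.I * lap (imF v) x) + V x • v x
      - lam * powNL p (v x) + Complex.I * dotC (rotField M x) (w x)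

theorem norm_sq_eq (f : Eu n → ℂ) (x : Eu n) :
    ‖f x‖ ^ 2 = reF f x * reF f x + imF f x * imF f x := by
  rw [← Complex.normSq_eq_norm_sq, Complex.normSq_apply]; rfl

theorem norm_rpow_eq (f : Eu n → ℂ) (x : Eu n) (q : ℝ) :
    (reF f x * reF f x + imF f x * imF f x) ^ (q / 2) = ‖f x‖ ^ q := by
  rw [← norm_sq_eq, ← Real.rpow_natCast, ← Real.rpow_mul (norm_nonneg _)]
  congr 1
  push_cast
  ring

variable {φ V : Eu n → ℝ} {f : Eu n → ℂ} {g : Eu n → EuclideanSpace ℂ (Fin n)}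
  {M : Matrix (Fin n) (Fin n) ℝ} {lam p : ℝ} (k : ℕ)

theorem hessC_mol (h : IsWeakGrad f g) (x : Eu n) :
    hessC φ (mol k g) x = hess φ (reF (mol k f)) x + hess φ (imF (mol k f)) x := by
  simp only [hessC, hess, ← Finset.sum_add_distrib]
  refine Finset.sum_congr rfl fun i _ => Finset.sum_congr rfl fun j _ => ?_
  rw [pd_reF_mol k x h, pd_reF_mol k x h, pd_imF_mol k x h, pd_imF_mol k x h]
  ring

/-- With v = a + ib the imaginary part of v̄ Xv is a Xb - b Xa, and antisymmetrization turns its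
integral into that of a Yb. -/
theorem virialK_mol (h : IsWeakGrad f g) (hφ : ContDiff ℝ ∞ φ) (hφc : HasCompactSupport φ) :
    virialK φ (mol k f) (mol k g) = 2 * ∫ x, reF (mol k f) x * morY φ (imF (mol k f)) x := by
  have ha := contDiff_reF (contDiff_mol k h.1)
  have hb := contDiff_imF (contDiff_mol k h.1)
  have hv : Continuous (mol k f) := (contDiff_mol k h.1).continuous
  have hw : Continuous (mol k g) := (contDiff_mol k h.2.1).continuous
  have hgr : Continuous fun x => dotC (∇ φ x) (mol k g x) := by
    have : ∀ x, dotC (∇ φ x) (mol k g x) =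
        ∑ j, ((pd j φ x : ℝ) : ℂ) * (mol k g x) j := fun x => by
      simp only [dotC, gradient_apply_pd]
    simp only [this]
    refine continuous_finsetSum _ fun j _ => ?_
    exact (Complex.continuous_ofReal.comp (contDiff_pd_top hφ j).continuous).mul
      ((EuclideanSpace.proj j : EuclideanSpace ℂ (Fin n) →L[ℂ] ℂ).continuous.comp hw)
  have hint : Integrable fun x => starRingEnd ℂ (mol k f x) * dotC (∇ φ x) (mol k g x) := by
    refine Continuous.integrable_of_hasCompactSupport
      ((Complex.continuous_conj.comp hv).mul hgr) (HasCompactSupport.intro hφc.isCompact ?_)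
    intro x hx
    have : dotC (∇ φ x) (mol k g x) = 0 :=
      Finset.sum_eq_zero fun j _ => by rw [gradient_apply_pd, pd_eq_zero hx]; simp
    rw [this, mul_zero]
  rw [virialK, ← integral_gradDot_sub hφ hφc ha hb]
  congr 1
  have h1 := Complex.imCLM.integral_comp_comm hint
  simp only [Complex.imCLM_apply] at h1
  rw [← h1]
  congr 1
  ext x
  rw [gradDot_reF_mol k φ x h, gradDot_imF_mol k φ x h]
  simp only [Complex.mul_im, Complex.conj_re, Complex.conj_im, reF, imF]
  ring

theorem inner_eq (z w : ℂ) : inner ℝ z w = z.re * w.re + z.im * w.im := by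
  rw [Complex.inner, Complex.mul_re, Complex.conj_re, Complex.conj_im]; ring

theorem rhsSmooth_re (h : IsWeakGrad f g) (x : Eu n) :
    (rhsSmooth M V lam p (mol k f) (mol k g) x).re = -lap (reF (mol k f)) x +
      V x * reF (mol k f) x - lam * (‖mol k f x‖ ^ (p - 1) * reF (mol k f) x)
      - rotD M (imF (mol k f)) x := by
  rw [rhsSmooth, rotD_imF_mol k x h]
  simp [powNL, reF]
  ring

theorem rhsSmooth_im (h : IsWeakGrad f g) (x : Eu n) :
    (rhsSmooth M V lam p (mol k f) (mol k g) x).im = -lap (imF (mol k f)) x +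
      V x * imF (mol k f) x - lam * (‖mol k f x‖ ^ (p - 1) * imF (mol k f) x)
      + rotD M (reF (mol k f)) x := by
  rw [rhsSmooth, rotD_reF_mol k x h]
  simp [powNL, imF]

/-- The mass identity for the mollified equation, without error terms. -/
theorem integral_inner_rhsSmooth (h : IsWeakGrad f g) (hφ : ContDiff ℝ ∞ φ)
    (hφc : HasCompactSupport φ) (hM : M = -Mᵀ) (hB : ∀ x, rotD M φ x = 0)
    :
    2 * ∫ x, inner ℝ (φ x • (Complex.I * mol k f x)) (rhsSmooth M V lam p (mol k f) (mol k g) x) =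
      virialK φ (mol k f) (mol k g) := by
  have ha := contDiff_reF (contDiff_mol k h.1)
  have hb := contDiff_imF (contDiff_mol k h.1)
  rw [virialK_mol k h hφ hφc, ← integral_gradDot_sub hφ hφc ha hb,
    ← integral_mul_lap_sub hφ hφc ha hb]
  congr 1
  -- The potential and the power multiply v by real factors, hence are pointwise orthogonal to iv
  -- and disappear.
  have e : ∀ x, inner ℝ (φ x • (Complex.I * mol k f x))
      (rhsSmooth M V lam p (mol k f) (mol k g) x) =
      φ x * (imF (mol k f) x * lap (reF (mol k f)) x - reF (mol k f) x * lap (imF (mol k f)) x) +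
      (φ x * (reF (mol k f) x * rotD M (reF (mol k f)) x) +
        φ x * (imF (mol k f) x * rotD M (imF (mol k f)) x)) := by
    intro x
    rw [inner_eq, rhsSmooth_re k h, rhsSmooth_im k h]
    simp [reF, imF]
    ring
  simp only [e]
  have hi : ∀ {a : Eu n → ℝ}, ContDiff ℝ ∞ a → Integrable fun x => φ x * (a x * rotD M a x) :=
    fun {a} ha => integrable_of_vanish hφc
      (hφ.continuous.mul (ha.continuous.mul (contDiff_rotD M ha).continuous)) fun x hx => by
        rw [image_eq_zero_of_notMem_tsupport hx, zero_mul]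
  rw [integral_add, integral_add_eq_zero (hi ha) (hi hb) (integral_mul_rotD hM hφ hφc hB ha)
    (integral_mul_rotD hM hφ hφc hB hb), add_zero]
  · refine integrable_of_vanish hφc (hφ.continuous.mul
      ((hb.continuous.mul (contDiff_lap ha).continuous).sub
        (ha.continuous.mul (contDiff_lap hb).continuous))) fun x hx => by
        rw [image_eq_zero_of_notMem_tsupport hx, zero_mul]
  · exact (hi ha).add (hi hb)

/-- The virial identity for the mollified equation, without error terms. -/
theorem integral_inner_rhsSmooth_morC (h : IsWeakGrad f g) (hφ : ContDiff ℝ ∞ φ)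
    (hφc : HasCompactSupport φ) (hM : M = -Mᵀ) (hB : ∀ x, rotD M φ x = 0)
    (hV : ContDiff ℝ 1 V) (hp : 1 ≤ p) :
    2 * ∫ x, inner ℝ (rhsSmooth M V lam p (mol k f) (mol k g) x) (morC φ (mol k f) (mol k g) x) =
      virialP φ V lam p (mol k f) (mol k g) := by
  have ha := contDiff_reF (contDiff_mol k h.1)
  have hb := contDiff_imF (contDiff_mol k h.1)
  set a := reF (mol k f) with hadef
  set b := imF (mol k f) with hbdef
  have hYa := contDiff_morY hφ ha
  have hYb := contDiff_morY hφ hb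
  have hv : Continuous (mol k f) := (contDiff_mol k h.1).continuous
  have hz : Continuous fun x => ‖mol k f x‖ ^ (p - 1) :=
    hv.norm.rpow_const fun x => Or.inr (by linarith)
  have hz' : Continuous fun x => ‖mol k f x‖ ^ (p + 1) :=
    hv.norm.rpow_const fun x => Or.inr (by linarith)
  have e : ∀ x, 2 * inner ℝ (rhsSmooth M V lam p (mol k f) (mol k g) x)
      (morC φ (mol k f) (mol k g) x) =
      -2 * (lap a x * morY φ a x) + -2 * (lap b x * morY φ b x) +
      (2 * (V x * a x * morY φ a x) + 2 * (V x * b x * morY φ b x)) +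
      (-lam * (2 * (‖mol k f x‖ ^ (p - 1) * (a x * morY φ a x + b x * morY φ b x))) +
        2 * (rotD M a x * morY φ b x - rotD M b x * morY φ a x)) := by
    intro x
    rw [inner_eq, rhsSmooth_re k h, rhsSmooth_im k h, ← morY_reF_mol k φ x h,
      ← morY_imF_mol k φ x h]
    ring
  have i1 : ∀ {a : Eu n → ℝ}, ContDiff ℝ ∞ a → Integrable fun x => -2 * (lap a x * morY φ a x) :=
    fun {a} ha => integrable_of_vanish hφc (continuous_const.mul
      ((contDiff_lap ha).continuous.mul (contDiff_morY hφ ha).continuous)) fun x hx => by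
        rw [morY_eq_zero hx]; ring
  have i2 : ∀ {a : Eu n → ℝ}, ContDiff ℝ ∞ a → Integrable fun x => 2 * (V x * a x * morY φ a x) :=
    fun {a} ha => integrable_of_vanish hφc (continuous_const.mul
      ((hV.continuous.mul ha.continuous).mul (contDiff_morY hφ ha).continuous)) fun x hx => by
        rw [morY_eq_zero hx]; ring
  have i3 : Integrable fun x =>
      2 * (‖mol k f x‖ ^ (p - 1) * (a x * morY φ a x + b x * morY φ b x)) :=
    integrable_of_vanish hφc (continuous_const.mul (hz.mul ((ha.continuous.mul hYa.continuous).add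
      (hb.continuous.mul hYb.continuous)))) fun x hx => by
        rw [morY_eq_zero hx, morY_eq_zero hx]; ring
  have i4 : ∀ {a b : Eu n → ℝ}, ContDiff ℝ ∞ a → ContDiff ℝ ∞ b →
      Integrable fun x => rotD M a x * morY φ b x :=
    fun {a b} ha hb => integrable_of_vanish hφc
      ((contDiff_rotD M ha).continuous.mul (contDiff_morY hφ hb).continuous) fun x hx => by
        rw [morY_eq_zero hx]; ring
  -- The rotation cancels by the symmetry in a and b of `integral_rotD_morY`.
  have r4 : ∫ x, 2 * (rotD M a x * morY φ b x - rotD M b x * morY φ a x) = 0 := by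
    rw [integral_const_mul, integral_sub (i4 ha hb) (i4 hb ha),
      integral_rotD_morY hM hφ hφc hB ha hb, integral_rotD_morY hM hφ hφc hB hb ha]
    simp only [add_comm, sub_self, mul_zero]
  have r3 := integral_power_morY hφ hφc ha hb hp
  simp only [hadef, hbdef, norm_rpow_eq] at r3
  rw [← hadef, ← hbdef] at r3
  rw [← integral_const_mul]
  simp only [e]
  have i4' : Integrable fun x => 2 * (rotD M a x * morY φ b x - rotD M b x * morY φ a x) :=
    ((i4 ha hb).sub (i4 hb ha)).const_mul 2
  have s1 : Integrable fun x => -2 * (lap a x * morY φ a x) + -2 * (lap b x * morY φ b x) :=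
    (i1 ha).add (i1 hb)
  have s2 : Integrable fun x => 2 * (V x * a x * morY φ a x) + 2 * (V x * b x * morY φ b x) :=
    (i2 ha).add (i2 hb)
  have s12 : Integrable fun x =>
      -2 * (lap a x * morY φ a x) + -2 * (lap b x * morY φ b x) +
        (2 * (V x * a x * morY φ a x) + 2 * (V x * b x * morY φ b x)) := s1.add s2
  have s3 : Integrable fun x =>
      -lam * (2 * (‖mol k f x‖ ^ (p - 1) * (a x * morY φ a x + b x * morY φ b x))) +
        2 * (rotD M a x * morY φ b x - rotD M b x * morY φ a x) := (i3.const_mul (-lam)).add i4'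
  rw [integral_add s12 s3, integral_add s1 s2,
    integral_add (i1 ha) (i1 hb), integral_add (i2 ha) (i2 hb),
    integral_add (i3.const_mul (-lam)) i4', r4, integral_const_mul (-lam), r3,
    integral_lap_morY hφ hφc ha, integral_lap_morY hφ hφc hb,
    integral_potential_morY hφ hφc ha hV, integral_potential_morY hφ hφc hb hV]
  have j1 : ∀ {a : Eu n → ℝ}, ContDiff ℝ ∞ a → Integrable (hess φ a) := fun {a} ha =>
    integrable_of_vanish hφc (contDiff_hess hφ ha).continuous fun x hx => hess_eq_zero hx a
  have j2 : ∀ {a : Eu n → ℝ}, ContDiff ℝ ∞ a →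
      Integrable fun x => lap (lap φ) x * (a x * a x) := fun {a} ha =>
    integrable_of_vanish hφc ((contDiff_lap (contDiff_lap hφ)).continuous.mul
      (ha.continuous.mul ha.continuous)) fun x hx => by rw [lap_lap_eq_zero hx, zero_mul]
  have j3 : ∀ {a : Eu n → ℝ}, ContDiff ℝ ∞ a →
      Integrable fun x => gradDot φ V x * (a x * a x) := fun {a} ha =>
    integrable_of_vanish hφc ((continuous_gradDot (hφ.of_le (by simp)) hV).mul
      (ha.continuous.mul ha.continuous)) fun x hx => by rw [gradDot_eq_zero hx, zero_mul]
  rw [integral_sub ((j1 ha).const_mul 4) (j2 ha), integral_sub ((j1 hb).const_mul 4) (j2 hb)]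
  simp only [integral_const_mul]
  rw [virialP]
  simp only [norm_sq_eq, hessC_mol k h, mul_add]
  rw [← hadef, ← hbdef, integral_add (j1 ha) (j1 hb), integral_add (j2 ha) (j2 hb),
    integral_add (j3 ha) (j3 hb)]
  ring

end FixedTimeIdentities

/-! ### Continuity and boundedness of the localized functionals -/

section Functionals

variable {n : ℕ} {ι F : Type*} [NormedAddCommGroup F] [NormedSpace ℝ F] {l : Filter ι}
  {s r : ℝ≥0∞} {R : ℝ} {c : Eu n → ℝ}

theorem LpTendsto.mol (k : ℕ) (hs : 1 ≤ s) (hs' : s ≠ ⊤) {f : ι → Eu n → F} {g : Eu n → F}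
    (h : LpTendsto l s volume f g) :
    LpTendsto l s volume (fun i => RNLS.mol k (f i)) (RNLS.mol k g) := by
  refine ⟨h.ev.mono fun i hi => memLp_mol k hs hs' hi, memLp_mol k hs hs' h.lim, ?_⟩
  refine tendsto_of_tendsto_of_tendsto_of_le_of_le' tendsto_const_nhds h.tendsto
    (Eventually.of_forall fun i => zero_le) ?_
  filter_upwards [h.ev] with i hi
  rw [← mol_sub k (hi.locallyIntegrable hs) (h.lim.locallyIntegrable hs)]
  exact eLpNorm_mol_le k (hi.sub h.lim).1 hs hs'

theorem LpBdd.mol (hs : 1 ≤ s) (hs' : s ≠ ⊤) {f : ι → Eu n → F} (h : LpBdd s volume f) :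
    LpBdd s volume (fun i : ι × ℕ => RNLS.mol i.2 (f i.1)) :=
  h.of_eLpNorm_le Prod.fst (fun i => (memLp_mol i.2 hs hs' (h.memLp i.1)).1)
    fun i => eLpNorm_mol_le i.2 (h.memLp i.1).1 hs hs'

theorem continuous_smul_id (hc : Continuous c) :
    Continuous fun x => c x • ContinuousLinearMap.id ℝ F := hc.smul continuous_const

theorem LpTendsto.smul_weight (hc : Continuous c) {f : ι → Eu n → F} {g : Eu n → F}
    (h : LpTendsto l s (ballMeas n R) f g) :
    LpTendsto l s (ballMeas n R) (fun i x => c x • f i x) (fun x => c x • g x) :=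
  h.clm (continuous_smul_id hc)

theorem LpBdd.smul_weight (hc : Continuous c) {f : ι → Eu n → F}
    (h : LpBdd s (ballMeas n R) f) : LpBdd s (ballMeas n R) (fun i x => c x • f i x) :=
  h.clm (continuous_smul_id hc)

theorem memLp_smul_weight (hc : Continuous c) {f : Eu n → F}
    (h : MemLp f s (ballMeas n R)) : MemLp (fun x => c x • f x) s (ballMeas n R) :=
  memLp_clm (continuous_smul_id hc) h

theorem innerSL_smul (a : ℝ) (z w : ℂ) : innerSL ℝ (a • z) w = a * inner ℝ z w := by
  rw [innerSL_apply_apply, real_inner_smul_left]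

section Weighted

variable [ENNReal.HolderTriple s r 1] {f f' : ι → Eu n → ℂ} {g g' : Eu n → ℂ}

theorem integrable_mul_inner (hc : Continuous c) (hcR : ∀ x, x ∉ Metric.ball (0 : Eu n) R → c x = 0)
    (hg : MemLp g s (ballMeas n R)) (hg' : MemLp g' r (ballMeas n R)) :
    Integrable fun x => c x * inner ℝ (g x) (g' x) := by
  refine integrable_of_ballMeas (R := R) ?_ fun x hx => by rw [hcR x hx, zero_mul]
  have := integrable_bilin (innerSL ℝ) (memLp_smul_weight hc hg) hg'
  exact this.congr (Eventually.of_forall fun x => innerSL_smul _ _ _)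

theorem integral_mul_inner_eq (hcR : ∀ x, x ∉ Metric.ball (0 : Eu n) R → c x = 0) :
    ∫ x, c x * inner ℝ (g x) (g' x) = ∫ x, innerSL ℝ (c x • g x) (g' x) ∂ballMeas n R := by
  rw [← integral_ballMeas (R := R) fun x hx => by rw [hcR x hx, zero_mul]]
  simp only [innerSL_smul]

theorem tendsto_integral_mul_inner (hr : 1 ≤ r) (hc : Continuous c)
    (hcR : ∀ x, x ∉ Metric.ball (0 : Eu n) R → c x = 0)
    (hf : LpTendsto l s (ballMeas n R) f g) (hf' : LpTendsto l r (ballMeas n R) f' g') :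
    Tendsto (fun i => ∫ x, c x * inner ℝ (f i x) (f' i x)) l
      (𝓝 (∫ x, c x * inner ℝ (g x) (g' x))) := by
  simp only [integral_mul_inner_eq hcR]
  exact (hf.smul_weight hc).integral_bilin (innerSL ℝ) hr hf'

theorem exists_abs_integral_mul_inner_le (hc : Continuous c)
    (hcR : ∀ x, x ∉ Metric.ball (0 : Eu n) R → c x = 0)
    (hf : LpBdd s (ballMeas n R) f) (hf' : LpBdd r (ballMeas n R) f') :
    ∃ C, ∀ i, |∫ x, c x * inner ℝ (f i x) (f' i x)| ≤ C := by
  simp only [integral_mul_inner_eq hcR]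
  exact (hf.smul_weight hc).integral_bilin (innerSL ℝ) hf'

end Weighted

theorem norm_sq_eq_inner (z : ℂ) : ‖z‖ ^ 2 = inner ℝ z z := (real_inner_self_eq_norm_sq z).symm

/-- This makes the power term a bilinear pairing between the conjugate spaces L^{(p+1)/p} and
L^{p+1}. -/
theorem norm_rpow_eq_inner {p : ℝ} (hp : 1 ≤ p) (z : ℂ) :
    ‖z‖ ^ (p + 1) = inner ℝ (powNL p z) z := by
  have h : powNL p z = (‖z‖ ^ (p - 1)) • z := by rw [powNL, Complex.real_smul]
  rw [h, inner_smul_left, real_inner_self_eq_norm_sq]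
  rcases eq_or_ne z 0 with rfl | hz
  · simp [Real.zero_rpow (by linarith : p + 1 ≠ 0)]
  · rw [← Real.rpow_natCast, conj_trivial, ← Real.rpow_add (norm_pos_iff.2 hz)]
    congr 1
    push_cast
    ring

theorem hessC_eq (φ : Eu n → ℝ) (g : Eu n → EuclideanSpace ℂ (Fin n)) (x : Eu n) :
    hessC φ g x = ∑ j, ∑ k, pd j (pd k φ) x * inner ℝ (g x j) (g x k) := by
  simp only [hessC, inner_eq]

theorem one_le_ofReal_add {p : ℝ} (hp : 1 ≤ p) : 1 ≤ ENNReal.ofReal (p + 1) := by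
  rw [← ENNReal.ofReal_one]; exact ENNReal.ofReal_le_ofReal (by linarith)

theorem one_le_ofReal_div {p : ℝ} (hp : 1 ≤ p) : 1 ≤ ENNReal.ofReal ((p + 1) / p) := by
  rw [← ENNReal.ofReal_one]
  exact ENNReal.ofReal_le_ofReal ((one_le_div (by linarith)).2 (by linarith))

section Coordinates

variable {f : ι → Eu n → EuclideanSpace ℂ (Fin n)} {g : Eu n → EuclideanSpace ℂ (Fin n)}

theorem memLp_coord (h : MemLp g s (ballMeas n R)) (j : Fin n) :
    MemLp (fun x => g x j) s (ballMeas n R) :=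
  memLp_clm (B := fun _ => (EuclideanSpace.proj j : EuclideanSpace ℂ (Fin n) →L[ℂ] ℂ).restrictScalars ℝ)
    continuous_const h

theorem LpTendsto.coord (h : LpTendsto l s (ballMeas n R) f g) (j : Fin n) :
    LpTendsto l s (ballMeas n R) (fun i x => f i x j) (fun x => g x j) :=
  h.clm (B := fun _ => (EuclideanSpace.proj j : EuclideanSpace ℂ (Fin n) →L[ℂ] ℂ).restrictScalars ℝ)
    continuous_const

theorem LpBdd.coord (h : LpBdd s (ballMeas n R) f) (j : Fin n) :
    LpBdd s (ballMeas n R) (fun i x => f i x j) :=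
  h.clm (B := fun _ => (EuclideanSpace.proj j : EuclideanSpace ℂ (Fin n) →L[ℂ] ℂ).restrictScalars ℝ)
    continuous_const

variable {a : Eu n → Eu n}

theorem continuous_dotB (ha : Continuous a) : Continuous fun x => dotB n (a x) :=
  (dotB n).continuous.comp ha

theorem memLp_dotC (ha : Continuous a) (h : MemLp g s (ballMeas n R)) :
    MemLp (fun x => dotC (a x) (g x)) s (ballMeas n R) := by
  simpa only [dotB_apply] using memLp_clm (continuous_dotB ha) h

theorem LpTendsto.dotC (ha : Continuous a) (h : LpTendsto l s (ballMeas n R) f g) :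
    LpTendsto l s (ballMeas n R) (fun i x => RNLS.dotC (a x) (f i x))
      (fun x => RNLS.dotC (a x) (g x)) := by
  simpa only [dotB_apply] using h.clm (continuous_dotB ha)

theorem LpBdd.dotC (ha : Continuous a) (h : LpBdd s (ballMeas n R) f) :
    LpBdd s (ballMeas n R) (fun i x => RNLS.dotC (a x) (f i x)) := by
  simpa only [dotB_apply] using h.clm (continuous_dotB ha)

end Coordinates

theorem continuous_gradient {φ : Eu n → ℝ} (hφ : ContDiff ℝ 1 φ) : Continuous (∇ φ) :=
  (InnerProductSpace.toDual ℝ (Eu n)).symm.continuous.comp (hφ.continuous_fderiv one_ne_zero)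

theorem gradient_eq_zero {φ : Eu n → ℝ} {x : Eu n} (hx : x ∉ tsupport φ) : ∇ φ x = 0 := by
  ext j
  rw [gradient_apply_pd, pd_eq_zero hx]
  rfl

section Virial

variable {φ V : Eu n → ℝ} {lam p : ℝ} {f : ι → Eu n → ℂ} {f₀ : Eu n → ℂ}
  {g : ι → Eu n → EuclideanSpace ℂ (Fin n)} {g₀ : Eu n → EuclideanSpace ℂ (Fin n)}

/-- The pairing `(z, w) ↦ z̄ w`. -/
def conjMul : ℂ →L[ℝ] ℂ →L[ℝ] ℂ :=
  (ContinuousLinearMap.mul ℝ ℂ).comp (Complex.conjCLE : ℂ →L[ℝ] ℂ)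

theorem integrable_virialK (hφ : ContDiff ℝ ∞ φ) (hR : tsupport φ ⊆ Metric.ball 0 R)
    (hf : MemLp f₀ 2 (ballMeas n R)) (hg : MemLp g₀ 2 (ballMeas n R)) :
    Integrable fun x => starRingEnd ℂ (f₀ x) * dotC (∇ φ x) (g₀ x) := by
  refine integrable_of_ballMeas (R := R) ?_ fun x hx => by
    rw [gradient_eq_zero fun h => hx (hR h)]; simp [dotC]
  exact integrable_bilin conjMul hf (memLp_dotC (continuous_gradient (hφ.of_le (by simp))) hg)

theorem tendsto_virialK (hφ : ContDiff ℝ ∞ φ) (hR : tsupport φ ⊆ Metric.ball 0 R)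
    (hf : LpTendsto l 2 (ballMeas n R) f f₀) (hg : LpTendsto l 2 (ballMeas n R) g g₀) :
    Tendsto (fun i => virialK φ (f i) (g i)) l (𝓝 (virialK φ f₀ g₀)) := by
  have e : ∀ (a : Eu n → ℂ) (b : Eu n → EuclideanSpace ℂ (Fin n)), virialK φ a b =
      2 * (∫ x, conjMul (a x) (dotC (∇ φ x) (b x)) ∂ballMeas n R).im := fun a b => by
    rw [virialK, ← integral_ballMeas (R := R)]
    · rfl
    · intro x hx
      rw [gradient_eq_zero fun h => hx (hR h)]; simp [dotC]
  simp only [e]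
  exact ((Complex.continuous_im.tendsto _).comp
    (hf.integral_bilin conjMul one_le_two
      (hg.dotC (continuous_gradient (hφ.of_le (by simp)))))).const_mul 2

theorem weight_eq_zero {c : Eu n → ℝ} (h : ∀ x, x ∉ tsupport φ → c x = 0)
    (hR : tsupport φ ⊆ Metric.ball 0 R) (x : Eu n) (hx : x ∉ Metric.ball (0 : Eu n) R) :
    c x = 0 := h x fun h' => hx (hR h')

theorem tendsto_virialJ (hφ : ContDiff ℝ ∞ φ) (hR : tsupport φ ⊆ Metric.ball 0 R)
    (hf : LpTendsto l 2 (ballMeas n R) f f₀) :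
    Tendsto (fun i => ∫ x, φ x * ‖f i x‖ ^ 2) l (𝓝 (∫ x, φ x * ‖f₀ x‖ ^ 2)) := by
  simp only [norm_sq_eq_inner]
  exact tendsto_integral_mul_inner one_le_two hφ.continuous
    (weight_eq_zero (fun _ hx => image_eq_zero_of_notMem_tsupport hx) hR) hf hf

theorem continuous_pd_pd (hφ : ContDiff ℝ ∞ φ) (j k : Fin n) : Continuous (pd j (pd k φ)) :=
  (contDiff_pd_top (contDiff_pd_top hφ k) j).continuous

theorem integrable_hessC_term (hφ : ContDiff ℝ ∞ φ) (hR : tsupport φ ⊆ Metric.ball 0 R)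
    (hg : MemLp g₀ 2 (ballMeas n R)) (j k : Fin n) :
    Integrable fun x => pd j (pd k φ) x * inner ℝ (g₀ x j) (g₀ x k) :=
  integrable_mul_inner (continuous_pd_pd hφ j k)
    (weight_eq_zero (fun _ hx => pd_pd_eq_zero hx j k) hR) (memLp_coord hg j) (memLp_coord hg k)

theorem integrable_hessC (hφ : ContDiff ℝ ∞ φ) (hR : tsupport φ ⊆ Metric.ball 0 R)
    (hg : MemLp g₀ 2 (ballMeas n R)) : Integrable (hessC φ g₀) := by
  simp only [funext (hessC_eq φ g₀)]
  exact integrable_finsetSum _ fun j _ => integrable_finsetSum _ fun k _ =>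
    integrable_hessC_term hφ hR hg j k

theorem integral_hessC (hφ : ContDiff ℝ ∞ φ) (hR : tsupport φ ⊆ Metric.ball 0 R)
    (hg : MemLp g₀ 2 (ballMeas n R)) :
    ∫ x, hessC φ g₀ x = ∑ j, ∑ k, ∫ x, pd j (pd k φ) x * inner ℝ (g₀ x j) (g₀ x k) := by
  simp only [hessC_eq]
  rw [integral_finsetSum _ fun j _ => integrable_finsetSum _ fun k _ =>
    integrable_hessC_term hφ hR hg j k]
  refine Finset.sum_congr rfl fun j _ => integral_finsetSum _ fun k _ =>
    integrable_hessC_term hφ hR hg j k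

/-- Used along two filters: as the scale of mollification tends to zero, and in time, where it gives
continuity of the limiting second derivative. -/
theorem tendsto_virialP (hφ : ContDiff ℝ ∞ φ) (hR : tsupport φ ⊆ Metric.ball 0 R)
    (hV : ContDiff ℝ 1 V) (hp : 1 ≤ p)
    (hf : LpTendsto l 2 (ballMeas n R) f f₀) (hg : LpTendsto l 2 (ballMeas n R) g g₀)
    (hf' : LpTendsto l (ENNReal.ofReal (p + 1)) (ballMeas n R) f f₀) :
    Tendsto (fun i => virialP φ V lam p (f i) (g i)) l (𝓝 (virialP φ V lam p f₀ g₀)) := by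
  have := holderTriple_powNL hp
  have h1 : Tendsto (fun i => ∫ x, hessC φ (g i) x) l (𝓝 (∫ x, hessC φ g₀ x)) := by
    rw [integral_hessC hφ hR hg.lim]
    refine Tendsto.congr' (f₁ := fun i => ∑ j, ∑ k, ∫ x, pd j (pd k φ) x *
      inner ℝ (g i x j) (g i x k)) ?_ ?_
    · filter_upwards [hg.ev] with i hi using (integral_hessC hφ hR hi).symm
    · exact tendsto_finsetSum _ fun j _ => tendsto_finsetSum _ fun k _ =>
        tendsto_integral_mul_inner one_le_two (continuous_pd_pd hφ j k)
        (weight_eq_zero (fun x hx => pd_pd_eq_zero hx j k) hR) (hg.coord j) (hg.coord k)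
  have h2 : Tendsto (fun i => ∫ x, lap (lap φ) x * ‖f i x‖ ^ 2) l
      (𝓝 (∫ x, lap (lap φ) x * ‖f₀ x‖ ^ 2)) := by
    simp only [norm_sq_eq_inner]
    exact tendsto_integral_mul_inner one_le_two (contDiff_lap (contDiff_lap hφ)).continuous
      (weight_eq_zero (fun x hx => lap_lap_eq_zero hx) hR) hf hf
  have h3 : Tendsto (fun i => ∫ x, gradDot φ V x * ‖f i x‖ ^ 2) l
      (𝓝 (∫ x, gradDot φ V x * ‖f₀ x‖ ^ 2)) := by
    simp only [norm_sq_eq_inner]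
    exact tendsto_integral_mul_inner one_le_two (continuous_gradDot (hφ.of_le (by simp)) hV)
      (weight_eq_zero (fun x hx => gradDot_eq_zero hx V) hR) hf hf
  have h4 : Tendsto (fun i => ∫ x, lap φ x * ‖f i x‖ ^ (p + 1)) l
      (𝓝 (∫ x, lap φ x * ‖f₀ x‖ ^ (p + 1))) := by
    simp only [norm_rpow_eq_inner hp]
    exact tendsto_integral_mul_inner (one_le_ofReal_add hp) (contDiff_lap hφ).continuous
      (weight_eq_zero (fun x hx => lap_eq_zero hx) hR) (hf'.powNL hp) hf'
  exact (((h1.const_mul 4).sub h2).sub (h3.const_mul 2)).sub (h4.const_mul _)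

theorem exists_abs_virialP_le (hφ : ContDiff ℝ ∞ φ) (hR : tsupport φ ⊆ Metric.ball 0 R)
    (hV : ContDiff ℝ 1 V) (hp : 1 ≤ p)
    (hf : LpBdd 2 (ballMeas n R) f) (hg : LpBdd 2 (ballMeas n R) g)
    (hf' : LpBdd (ENNReal.ofReal (p + 1)) (ballMeas n R) f) :
    ∃ C, ∀ i, |virialP φ V lam p (f i) (g i)| ≤ C := by
  have := holderTriple_powNL hp
  have h1 : ∃ C, ∀ i, |∫ x, hessC φ (g i) x| ≤ C := by
    choose D hD using fun j k => exists_abs_integral_mul_inner_le (continuous_pd_pd hφ j k)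
        (weight_eq_zero (fun x hx => pd_pd_eq_zero hx j k) hR) (hg.coord j) (hg.coord k)
    refine ⟨∑ j, ∑ k, D j k, fun i => ?_⟩
    rw [integral_hessC hφ hR (hg.memLp i)]
    exact (Finset.abs_sum_le_sum_abs _ _).trans (Finset.sum_le_sum fun j _ =>
      (Finset.abs_sum_le_sum_abs _ _).trans (Finset.sum_le_sum fun k _ => hD j k i))
  have h2 : ∃ C, ∀ i, |∫ x, lap (lap φ) x * ‖f i x‖ ^ 2| ≤ C := by
    simp only [norm_sq_eq_inner]
    exact exists_abs_integral_mul_inner_le (contDiff_lap (contDiff_lap hφ)).continuous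
      (weight_eq_zero (fun x hx => lap_lap_eq_zero hx) hR) hf hf
  have h3 : ∃ C, ∀ i, |∫ x, gradDot φ V x * ‖f i x‖ ^ 2| ≤ C := by
    simp only [norm_sq_eq_inner]
    exact exists_abs_integral_mul_inner_le (continuous_gradDot (hφ.of_le (by simp)) hV)
      (weight_eq_zero (fun x hx => gradDot_eq_zero hx V) hR) hf hf
  have h4 : ∃ C, ∀ i, |∫ x, lap φ x * ‖f i x‖ ^ (p + 1)| ≤ C := by
    simp only [norm_rpow_eq_inner hp]
    exact exists_abs_integral_mul_inner_le (contDiff_lap hφ).continuous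
      (weight_eq_zero (fun x hx => lap_eq_zero hx) hR) (hf'.powNL hp) hf'
  obtain ⟨C1, h1⟩ := h1
  obtain ⟨C2, h2⟩ := h2
  obtain ⟨C3, h3⟩ := h3
  obtain ⟨C4, h4⟩ := h4
  refine ⟨4 * C1 + C2 + 2 * C3 + |2 * lam * (p - 1) / (p + 1)| * C4, fun i => ?_⟩
  have h4' := mul_le_mul_of_nonneg_left (h4 i) (abs_nonneg (2 * lam * (p - 1) / (p + 1)))
  rw [← abs_mul] at h4'
  have := abs_le.1 (h1 i)
  have := abs_le.1 (h2 i)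
  have := abs_le.1 (h3 i)
  have := abs_le.1 h4'
  rw [virialP, abs_le]
  constructor <;> linarith

/-- The operator `2 ∇φ·∇ + Δφ` is continuous from `H¹` to `L²`. -/
theorem LpTendsto.morC (hφ : ContDiff ℝ ∞ φ) (hs : 1 ≤ s)
    (hf : LpTendsto l s (ballMeas n R) f f₀) (hg : LpTendsto l s (ballMeas n R) g g₀) :
    LpTendsto l s (ballMeas n R) (fun i => RNLS.morC φ (f i) (g i)) (RNLS.morC φ f₀ g₀) := by
  have h1 := (hg.dotC (continuous_gradient (hφ.of_le (by simp)))).smul_weight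
    (continuous_const (y := (2 : ℝ)))
  have h2 := h1.add hs (hf.smul_weight (contDiff_lap hφ).continuous)
  simp only [Complex.real_smul] at h2
  exact_mod_cast h2

theorem LpBdd.morC (hφ : ContDiff ℝ ∞ φ) (hs : 1 ≤ s)
    (hf : LpBdd s (ballMeas n R) f) (hg : LpBdd s (ballMeas n R) g) :
    LpBdd s (ballMeas n R) (fun i => RNLS.morC φ (f i) (g i)) := by
  have h1 := (hg.dotC (continuous_gradient (hφ.of_le (by simp)))).smul_weight
    (continuous_const (y := (2 : ℝ)))
  have h2 := h1.add hs (hf.smul_weight (contDiff_lap hφ).continuous)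
  simp only [Complex.real_smul] at h2
  exact_mod_cast h2

theorem morC_eq_zero {x : Eu n} (hx : x ∉ tsupport φ) (a : Eu n → ℂ)
    (b : Eu n → EuclideanSpace ℂ (Fin n)) : RNLS.morC φ a b x = 0 := by
  rw [RNLS.morC, gradient_eq_zero hx, lap_eq_zero hx]
  simp [RNLS.dotC]

end Virial

end Functionals

/-! ### Time derivatives of the mollified functionals -/

section RegularCurves

variable {n : ℕ}

/-- A curve `u` with spatial gradient `g` that is continuous in `H¹` and locally in `L^{p+1}`,
and whose mollifications satisfy the mollified equation. -/
structure IsRegularCurve (M : Matrix (Fin n) (Fin n) ℝ) (V : Eu n → ℝ) (lam p : ℝ) (I : Set ℝ)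
    (u : ℝ → Eu n → ℂ) (g : ℝ → Eu n → EuclideanSpace ℂ (Fin n)) : Prop where
  isWeakGrad : ∀ t ∈ I, IsWeakGrad (u t) (g t)
  lpTendsto : ∀ t ∈ I, LpTendsto (𝓝[I] t) 2 volume u (u t)
  lpTendsto_grad : ∀ t ∈ I, LpTendsto (𝓝[I] t) 2 volume g (g t)
  lpTendsto_pow : ∀ R, 0 < R → ∀ t ∈ I,
    LpTendsto (𝓝[I] t) (ENNReal.ofReal (p + 1)) (ballMeas n R) u (u t)
  hasDerivWithinAt : ∀ k x, ∀ t ∈ I, HasDerivWithinAt (fun s => mol k (u s) x)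
    (-Complex.I * rhsC M V lam p k (u t) (g t) x) I t

theorem locallyIntegrable_of_ballMeas {F : Type*} [NormedAddCommGroup F] {h : Eu n → F}
    (hh : ∀ R, 0 < R → MemLp h 1 (ballMeas n R)) : LocallyIntegrable h := fun x =>
  ⟨Metric.ball 0 (‖x‖ + 1), Metric.isOpen_ball.mem_nhds (by simp),
    memLp_one_iff_integrable.1 (hh _ (by positivity))⟩

theorem continuous_rotField (M : Matrix (Fin n) (Fin n) ℝ) : Continuous (rotField M) := by
  refine (PiLp.continuous_toLp 2 _).comp ?_
  exact Continuous.matrix_mulVec continuous_const (PiLp.continuous_ofLp 2 _)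

variable {M : Matrix (Fin n) (Fin n) ℝ} {V φ : Eu n → ℝ} {lam p R : ℝ} {I : Set ℝ}
  {u : ℝ → Eu n → ℂ} {g : ℝ → Eu n → EuclideanSpace ℂ (Fin n)} {t : ℝ}

theorem continuous_rhsC_of_memLp {f : Eu n → ℂ} {g : Eu n → EuclideanSpace ℂ (Fin n)} (k : ℕ)
    (h : IsWeakGrad f g) (hV : Continuous V) (hp : 1 ≤ p)
    (hf : MemLp f 2 volume) (hg : MemLp g 2 volume)
    (hf' : ∀ R, 0 < R → MemLp f (ENNReal.ofReal (p + 1)) (ballMeas n R)) :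
    Continuous (rhsC M V lam p k f g) := by
  have h1 : Continuous fun x => ∫ y, dotC (∇ (fun y => kern n k (x - y)) y) (g y) := by
    simp only [integral_gradient_kern k _ h]
    have ha := contDiff_lap (contDiff_reF (contDiff_mol k h.1))
    have hb := contDiff_lap (contDiff_imF (contDiff_mol k h.1))
    exact ((Complex.continuous_ofReal.comp ha.continuous).add
      (continuous_const.mul (Complex.continuous_ofReal.comp hb.continuous))).neg
  have h2 : LocallyIntegrable fun y => V y • f y := locallyIntegrable_of_ballMeas fun R _ =>
    (memLp_smul_weight hV (hf.mono_measure (ballMeas_le R))).mono_exponent one_le_two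
  have h3 : LocallyIntegrable fun y => powNL p (f y) := locallyIntegrable_of_ballMeas fun R hR =>
    (memLp_powNL hp (hf' R hR)).1.mono_exponent (one_le_ofReal_div hp)
  have h4 : LocallyIntegrable fun y => dotC (rotField M y) (g y) :=
    locallyIntegrable_of_ballMeas fun R _ =>
      (memLp_dotC (continuous_rotField M) (hg.mono_measure (ballMeas_le R))).mono_exponent
        one_le_two
  unfold rhsC
  simp only [mol_I_mul]
  exact ((h1.add (contDiff_mol k h2).continuous).sub
    (continuous_const.mul (contDiff_mol k h3).continuous)).add
    (continuous_const.mul (contDiff_mol k h4).continuous)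

theorem exists_norm_cv_le_of_lpBdd {F : Type*} [NormedAddCommGroup F] [NormedSpace ℝ F]
    {ι : Type*} {h : ι → Eu n → F} {η : Eu n → ℝ} (hη : Continuous η)
    (hs : ∀ x, 1 ≤ ‖x‖ → η x = 0) (hh : LpBdd 1 (ballMeas n (R + 1)) h) :
    ∃ C, ∀ i, ∀ x ∈ Metric.ball (0 : Eu n) R, ‖cv η (h i) x‖ ≤ C := by
  obtain ⟨D, hD⟩ := hh.bdd
  obtain ⟨C, hC0, hC⟩ := exists_norm_cv_le (F := F) hη hs R
  exact ⟨C * D, fun i x hx => (hC _ (hh.memLp i) x hx).trans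
    (mul_le_mul_of_nonneg_left (hD i) hC0)⟩

namespace IsRegularCurve

theorem memLp (hc : IsRegularCurve M V lam p I u g) (ht : t ∈ I) : MemLp (u t) 2 volume :=
  (hc.lpTendsto t ht).lim

theorem memLp_grad (hc : IsRegularCurve M V lam p I u g) (ht : t ∈ I) : MemLp (g t) 2 volume :=
  (hc.lpTendsto_grad t ht).lim

theorem lpBdd (hc : IsRegularCurve M V lam p I u g) (hI : IsCompact I) :
    LpBdd 2 volume (fun t : I => u t) :=
  LpBdd.of_compact hI one_le_two (fun _ ht => hc.memLp ht) hc.lpTendsto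

theorem lpBdd_grad (hc : IsRegularCurve M V lam p I u g) (hI : IsCompact I) :
    LpBdd 2 volume (fun t : I => g t) :=
  LpBdd.of_compact hI one_le_two (fun _ ht => hc.memLp_grad ht) hc.lpTendsto_grad

theorem lpBdd_pow (hc : IsRegularCurve M V lam p I u g) (hI : IsCompact I) (hp : 1 ≤ p)
    (hR : 0 < R) : LpBdd (ENNReal.ofReal (p + 1)) (ballMeas n R) (fun t : I => u t) :=
  LpBdd.of_compact hI (one_le_ofReal_add hp) (fun t ht => (hc.lpTendsto_pow R hR t ht).lim)
    (hc.lpTendsto_pow R hR)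

theorem continuous_rhsC (hc : IsRegularCurve M V lam p I u g) (hV : Continuous V) (hp : 1 ≤ p)
    (k : ℕ) (ht : t ∈ I) : Continuous (rhsC M V lam p k (u t) (g t)) :=
  continuous_rhsC_of_memLp k (hc.isWeakGrad t ht) hV hp (hc.memLp ht) (hc.memLp_grad ht)
    fun R hR => (hc.lpTendsto_pow R hR t ht).lim

/-- Each term is a convolution with a fixed kernel of a family bounded in L¹ of a ball; for the
Laplacian one derivative is moved to the kernel. The bound depends on k and serves only to
differentiate at fixed k. -/
theorem exists_norm_rhsC_le (hc : IsRegularCurve M V lam p I u g) (hI : IsCompact I)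
    (hV : Continuous V) (hp : 1 ≤ p) (k : ℕ) (hR : 0 < R) :
    ∃ C, ∀ t ∈ I, ∀ x ∈ Metric.ball (0 : Eu n) R, ‖rhsC M V lam p k (u t) (g t) x‖ ≤ C := by
  have hR1 : 0 < R + 1 := by linarith
  have hη := (contDiff_kern (n := n) k).continuous
  have hb := (hc.lpBdd hI).mono_measure (ballMeas_le (R + 1))
  have hg := (hc.lpBdd_grad hI).mono_measure (ballMeas_le (R + 1))
  have h1 : ∀ j, ∃ C, ∀ t : I, ∀ x ∈ Metric.ball (0 : Eu n) R,
      ‖cv (fun y => fderiv ℝ (kern n k) y (EuclideanSpace.single j 1))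
        (fun y => g t y j) x‖ ≤ C := fun j =>
    exists_norm_cv_le_of_lpBdd
      (((contDiff_kern k).continuous_fderiv (by simp)).clm_apply continuous_const)
      (fun x hx => fderiv_kern_eq_zero k _ x hx) ((hg.coord j).mono_exponent one_le_two)
  choose C1 h1 using h1
  obtain ⟨C2, h2⟩ := exists_norm_cv_le_of_lpBdd hη (kern_eq_zero k)
    ((hb.smul_weight hV).mono_exponent one_le_two)
  obtain ⟨C3, h3⟩ := exists_norm_cv_le_of_lpBdd hη (kern_eq_zero k)
    ((hc.lpBdd_pow hI hp hR1).powNL hp |>.mono_exponent (one_le_ofReal_div hp))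
  obtain ⟨C4, h4⟩ := exists_norm_cv_le_of_lpBdd hη (kern_eq_zero k)
    ((hg.dotC (continuous_rotField M)).mono_exponent one_le_two)
  refine ⟨∑ j, C1 j + C2 + ‖(lam : ℂ)‖ * C3 + C4, fun t ht x hx => ?_⟩
  rw [rhsC, integral_gradient_kern_eq_sum k x (hc.isWeakGrad t ht).2.1, mol_I_mul]
  refine (norm_add_le _ _).trans (add_le_add ((norm_sub_le _ _).trans (add_le_add
    ((norm_add_le _ _).trans (add_le_add ?_ (h2 ⟨t, ht⟩ x hx))) ?_)) ?_)
  · rw [norm_neg]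
    exact (norm_sum_le _ _).trans (Finset.sum_le_sum fun j _ => h1 j ⟨t, ht⟩ x hx)
  · rw [norm_mul]
    exact mul_le_mul_of_nonneg_left (h3 ⟨t, ht⟩ x hx) (norm_nonneg _)
  · rw [norm_mul, Complex.norm_I, one_mul]
    exact h4 ⟨t, ht⟩ x hx

/-- The mollified curve is differentiable in time with values in `L²` of a ball. -/
theorem lpTendsto_slope (hc : IsRegularCurve M V lam p I u g) (hI : IsCompact I)
    (hIc : Convex ℝ I) (hV : Continuous V) (hp : 1 ≤ p) (k : ℕ) (hR : 0 < R) (ht : t ∈ I) :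
    LpTendsto (𝓝[I \ {t}] t) 2 (ballMeas n R)
      (fun s x => (s - t)⁻¹ • (mol k (u s) x - mol k (u t) x))
      (fun x => -Complex.I * rhsC M V lam p k (u t) (g t) x) := by
  obtain ⟨C, hC⟩ := hc.exists_norm_rhsC_le hI hV hp k hR
  have hcont := hc.continuous_rhsC hV hp k ht
  have hn : ∀ s x, ‖-Complex.I * rhsC M V lam p k (u s) (g s) x‖ =
      ‖rhsC M V lam p k (u s) (g s) x‖ := fun s x => by simp
  have hmem : ∀ᶠ s in 𝓝[I \ {t}] t, s ∈ I \ {t} := eventually_mem_nhdsWithin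
  refine LpTendsto.of_bdd_pointwise (C := C + C) (by simp) ?_ ?_ ?_ ?_
  · filter_upwards [hmem] with s hs
    have h1 := (contDiff_mol k (hc.isWeakGrad s hs.1).1).continuous
    have h2 := (contDiff_mol k (hc.isWeakGrad t ht).1).continuous
    have h3 : Continuous fun x => (s - t)⁻¹ • (mol k (u s) x - mol k (u t) x) := by fun_prop
    exact h3.aestronglyMeasurable
  · refine MemLp.of_bound (continuous_const.mul hcont).aestronglyMeasurable C ?_
    filter_upwards [ae_ballMeas_mem R] with x hx
    rw [hn]
    exact hC t ht x hx
  · filter_upwards [hmem] with s hs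
    filter_upwards [ae_ballMeas_mem R] with x hx
    refine (norm_sub_le _ _).trans (add_le_add ?_ ((hn t x).trans_le (hC t ht x hx)))
    -- The mean value inequality bounds the difference quotients uniformly in x, so pointwise
    -- differentiability upgrades to L².
    have h1 := hIc.norm_image_sub_le_of_norm_hasDerivWithin_le (C := C)
      (fun r hr => hc.hasDerivWithinAt k x r hr)
      (fun r hr => (hn r x).trans_le (hC r hr x hx)) ht hs.1
    rw [norm_smul, norm_inv]
    have h2 : 0 < ‖s - t‖ := norm_pos_iff.2 (sub_ne_zero.2 hs.2)
    rw [inv_mul_le_iff₀ h2, mul_comm]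
    exact h1
  · refine Eventually.of_forall fun x => ?_
    exact hasDerivWithinAt_iff_tendsto_slope.1 (hc.hasDerivWithinAt k x t ht)

theorem lpTendsto_mol_curve (hc : IsRegularCurve M V lam p I u g) (k : ℕ) (ht : t ∈ I) :
    LpTendsto (𝓝[I \ {t}] t) 2 (ballMeas n R) (fun s => mol k (u s)) (mol k (u t)) :=
  (((hc.lpTendsto t ht).mol k one_le_two (by simp)).mono_measure (ballMeas_le R)).comp
    (nhdsWithin_mono t Set.sdiff_subset)

theorem lpTendsto_mol_grad (hc : IsRegularCurve M V lam p I u g) (k : ℕ) (ht : t ∈ I) :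
    LpTendsto (𝓝[I \ {t}] t) 2 (ballMeas n R) (fun s => mol k (g s)) (mol k (g t)) :=
  (((hc.lpTendsto_grad t ht).mol k one_le_two (by simp)).mono_measure (ballMeas_le R)).comp
    (nhdsWithin_mono t Set.sdiff_subset)

/-- The time derivative of the localized mass of the mollified curve. -/
theorem hasDerivWithinAt_virialJ (hc : IsRegularCurve M V lam p I u g) (hI : IsCompact I)
    (hIc : Convex ℝ I) (hV : Continuous V) (hp : 1 ≤ p) (hφ : ContDiff ℝ ∞ φ)
    (hR0 : 0 < R) (hR : tsupport φ ⊆ Metric.ball 0 R) (k : ℕ) (ht : t ∈ I) :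
    HasDerivWithinAt (fun s => ∫ x, φ x * ‖mol k (u s) x‖ ^ 2)
      (2 * ∫ x, inner ℝ (φ x • (Complex.I * mol k (u t) x)) (rhsC M V lam p k (u t) (g t) x))
      I t := by
  have hz := weight_eq_zero (fun _ hx => image_eq_zero_of_notMem_tsupport (f := φ) hx) hR
  have hL := hc.lpTendsto_mol_curve (R := R) k ht
  -- By polarization |v_s|² - |v_t|² is the inner product of v_s - v_t with v_s + v_t, so only the
  -- slope of v enters.
  have h1 := tendsto_integral_mul_inner one_le_two hφ.continuous hz
    (hc.lpTendsto_slope hI hIc hV hp k hR0 ht) (hL.add one_le_two (LpTendsto.const hL.lim))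
  rw [hasDerivWithinAt_iff_tendsto_slope]
  have e : 2 * ∫ x, inner ℝ (φ x • (Complex.I * mol k (u t) x)) (rhsC M V lam p k (u t) (g t) x) =
      ∫ x, φ x * inner ℝ (-Complex.I * rhsC M V lam p k (u t) (g t) x)
        (mol k (u t) x + mol k (u t) x) := by
    rw [← integral_const_mul]
    congr 1
    ext x
    simp only [inner_eq, Complex.real_smul, Complex.mul_re, Complex.mul_im, Complex.add_re,
      Complex.add_im, Complex.neg_re, Complex.neg_im, Complex.I_re, Complex.I_im,
      Complex.ofReal_re, Complex.ofReal_im]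
    ring
  rw [e]
  refine h1.congr' ?_
  filter_upwards [eventually_mem_nhdsWithin, hL.ev] with s hs hs'
  have i1 : Integrable fun x => φ x * ‖mol k (u s) x‖ ^ 2 := by
    simp only [norm_sq_eq_inner]
    exact integrable_mul_inner hφ.continuous hz hs' hs'
  have i2 : Integrable fun x => φ x * ‖mol k (u t) x‖ ^ 2 := by
    simp only [norm_sq_eq_inner]
    exact integrable_mul_inner hφ.continuous hz hL.lim hL.lim
  rw [slope_def_module, ← integral_sub i1 i2, smul_eq_mul, ← integral_const_mul]
  congr 1
  ext x
  rw [real_inner_smul_left, ← mul_sub, inner_sub_left, inner_add_right, inner_add_right,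
    real_inner_self_eq_norm_sq, real_inner_self_eq_norm_sq,
    real_inner_comm (mol k (u s) x) (mol k (u t) x)]
  ring

/-- The time derivative of the virial current of the mollified curve. -/
theorem hasDerivWithinAt_virialK (hc : IsRegularCurve M V lam p I u g) (hI : IsCompact I)
    (hIc : Convex ℝ I) (hV : Continuous V) (hp : 1 ≤ p) (hφ : ContDiff ℝ ∞ φ)
    (hφc : HasCompactSupport φ)
    (hR0 : 0 < R) (hR : tsupport φ ⊆ Metric.ball 0 R) (k : ℕ) (ht : t ∈ I) :
    HasDerivWithinAt (fun s => virialK φ (mol k (u s)) (mol k (g s)))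
      (2 * ∫ x, inner ℝ (rhsC M V lam p k (u t) (g t) x) (morC φ (mol k (u t)) (mol k (g t)) x))
      I t := by
  have hL := hc.lpTendsto_mol_curve (R := R) k ht
  have hG := hc.lpTendsto_mol_grad (R := R) k ht
  have hY := hL.morC hφ one_le_two hG
  have hD := hc.lpTendsto_slope hI hIc hV hp k hR0 ht
  have re : ∀ {f : ℝ → Eu n → ℂ} {f₀ : Eu n → ℂ}, LpTendsto (𝓝[I \ {t}] t) 2 (ballMeas n R) f f₀ →
      LpTendsto (𝓝[I \ {t}] t) 2 (ballMeas n R) (fun s x => (f s x).re) (fun x => (f₀ x).re) :=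
    fun h => h.clm (B := fun _ => Complex.reCLM) continuous_const
  have im : ∀ {f : ℝ → Eu n → ℂ} {f₀ : Eu n → ℂ}, LpTendsto (𝓝[I \ {t}] t) 2 (ballMeas n R) f f₀ →
      LpTendsto (𝓝[I \ {t}] t) 2 (ballMeas n R) (fun s x => (f s x).im) (fun x => (f₀ x).im) :=
    fun h => h.clm (B := fun _ => Complex.imCLM) continuous_const
  have hYt : LpTendsto (𝓝[I \ {t}] t) 2 (ballMeas n R)
      (fun _ => morC φ (mol k (u t)) (mol k (g t))) _ := LpTendsto.const hY.lim
  have h1 := ((re hD).integral_bilin (ContinuousLinearMap.mul ℝ ℝ) one_le_two (im hY)).sub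
    ((im hD).integral_bilin (ContinuousLinearMap.mul ℝ ℝ) one_le_two (re hYt))
  have h2 := h1.const_mul 2
  rw [hasDerivWithinAt_iff_tendsto_slope]
  have i1 := integrable_bilin (ContinuousLinearMap.mul ℝ ℝ) (re hD).lim (im hY).lim
  have i2 := integrable_bilin (ContinuousLinearMap.mul ℝ ℝ) (im hD).lim (re hYt).lim
  rw [← integral_sub i1 i2] at h2
  have hw := hc.isWeakGrad t ht
  have e : ∫ x, inner ℝ (rhsC M V lam p k (u t) (g t) x)
        (morC φ (mol k (u t)) (mol k (g t)) x) =
      ∫ x, (ContinuousLinearMap.mul ℝ ℝ (-Complex.I * rhsC M V lam p k (u t) (g t) x).re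
        (morC φ (mol k (u t)) (mol k (g t)) x).im -
        ContinuousLinearMap.mul ℝ ℝ (-Complex.I * rhsC M V lam p k (u t) (g t) x).im
        (morC φ (mol k (u t)) (mol k (g t)) x).re) ∂ballMeas n R := by
    rw [← integral_ballMeas (R := R) fun x hx => by
      rw [morC_eq_zero fun h => hx (hR h), inner_zero_right]]
    congr 1
    ext x
    simp only [inner_eq, ContinuousLinearMap.mul_apply', Complex.mul_re, Complex.mul_im,
      Complex.neg_re, Complex.neg_im, Complex.I_re, Complex.I_im]
    ring
  rw [e]
  refine h2.congr' ?_
  filter_upwards [eventually_mem_nhdsWithin, hD.ev, hY.ev] with s hs hDs hYs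
  have hws := hc.isWeakGrad s hs.1
  have ha := contDiff_reF (contDiff_mol k hw.1)
  have hb := contDiff_imF (contDiff_mol k hw.1)
  have has := contDiff_reF (contDiff_mol k hws.1)
  have hbs := contDiff_imF (contDiff_mol k hws.1)
  have hint : ∀ {a b : Eu n → ℝ}, ContDiff ℝ ∞ a → ContDiff ℝ ∞ b →
      Integrable fun x => a x * morY φ b x := fun {a b} ha hb => integrable_of_vanish hφc
    (ha.continuous.mul (contDiff_morY hφ hb).continuous) fun x hx => by
      rw [morY_eq_zero hx, mul_zero]
  rw [slope_def_module, virialK_mol k hws hφ hφc, virialK_mol k hw hφ hφc]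
  -- Antisymmetry of Y moves the increment off the differentiated factor. The difference quotient of
  -- the current then involves only the slope of v, never that of ∇v.
  have e1 : ∫ x, reF (mol k (u t)) x * morY φ (imF (mol k (u t))) x =
      (∫ x, reF (mol k (u t)) x * morY φ (imF (mol k (u s))) x) +
      ∫ x, (imF (mol k (u s)) x - imF (mol k (u t)) x) * morY φ (reF (mol k (u t))) x := by
    simp only [sub_mul]
    rw [integral_sub (hint hbs ha) (hint hb ha), integral_mul_morY hφ hφc ha hb,
      integral_mul_morY hφ hφc ha hbs, integral_neg, integral_neg]
    ring
  rw [e1, ← mul_sub, sub_add_eq_sub_sub, ← integral_sub (hint has hbs) (hint ha hbs), smul_eq_mul,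
    mul_left_comm, mul_sub (s - t)⁻¹, ← integral_const_mul, ← integral_const_mul]
  refine congrArg (2 * ·) (congrArg₂ (· - ·) ?_ ?_)
  · rw [integral_ballMeas]
    · congr 1
      ext x
      rw [morY_imF_mol k φ x hws]
      simp only [ContinuousLinearMap.mul_apply', Complex.smul_re, Complex.sub_re, smul_eq_mul, reF]
      ring
    · intro x hx
      rw [morC_eq_zero fun h => hx (hR h)]
      simp
  · rw [integral_ballMeas]
    · congr 1
      ext x
      rw [morY_reF_mol k φ x hw]
      simp only [ContinuousLinearMap.mul_apply', Complex.smul_im, Complex.sub_im, smul_eq_mul, imF]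
      ring
    · intro x hx
      rw [morC_eq_zero fun h => hx (hR h)]
      simp

end IsRegularCurve

end RegularCurves

/-! ### Vanishing of the commutators -/

section MollificationErrors

variable {n : ℕ} {ι F : Type*} [NormedAddCommGroup F] [NormedSpace ℝ F] {s : ℝ≥0∞} {R : ℝ}

theorem memLp_cut {F : Type*} [NormedAddCommGroup F] {h : Eu n → F} (hh : MemLp h s (ballMeas n (R + 1))) :
    MemLp (cut R h) s volume := (memLp_indicator_iff_restrict measurableSet_ball).2 hh

theorem lpTendsto_mol_cut [CompleteSpace F] (hs : 1 ≤ s) (hs' : s ≠ ⊤) {h : Eu n → F}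
    (hh : MemLp h s (ballMeas n (R + 1))) :
    LpTendsto atTop s (ballMeas n R) (fun k => mol k (cut R h)) h := by
  refine ((lpTendsto_mol hs hs' (memLp_cut hh)).mono_measure (ballMeas_le R)).congr_ae
    (Eventually.of_forall fun k => EventuallyEq.rfl) ?_
  filter_upwards [ae_ballMeas_mem R] with x hx
  exact Set.indicator_of_mem (Metric.ball_subset_ball (by linarith) hx) h

theorem LpBdd.mol_cut (hs : 1 ≤ s) (hs' : s ≠ ⊤) {f : ι → Eu n → F}
    (h : LpBdd s (ballMeas n (R + 1)) f) :
    LpBdd s (ballMeas n R) (fun i : ι × ℕ => RNLS.mol i.2 (cut R (f i.1))) :=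
  ((h.of_eLpNorm_le id (fun i => (memLp_cut (h.memLp i)).1) fun i => by
    rw [cut, eLpNorm_indicator_eq_eLpNorm_restrict measurableSet_ball]
    rfl : LpBdd s volume fun i => cut R (f i)).mol hs hs').mono_measure (ballMeas_le R)

theorem mol_cut_ae (k : ℕ) (h : Eu n → F) :
    RNLS.mol k (cut R h) =ᵐ[ballMeas n R] RNLS.mol k h := by
  filter_upwards [ae_ballMeas_mem R] with x hx using mol_indicator k h hx

theorem lpTendsto_mol_ball [CompleteSpace F] (hs : 1 ≤ s) (hs' : s ≠ ⊤) {h : Eu n → F}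
    (hh : MemLp h s (ballMeas n (R + 1))) :
    LpTendsto atTop s (ballMeas n R) (fun k => mol k h) h :=
  (lpTendsto_mol_cut hs hs' hh).congr_ae (Eventually.of_forall fun k => mol_cut_ae k h)
    EventuallyEq.rfl

theorem LpBdd.mol_ball (hs : 1 ≤ s) (hs' : s ≠ ⊤) {f : ι → Eu n → F}
    (h : LpBdd s (ballMeas n (R + 1)) f) :
    LpBdd s (ballMeas n R) (fun i : ι × ℕ => RNLS.mol i.2 (f i.1)) := by
  refine (h.mol_cut hs hs').of_le (C := 1)
    (fun i => ((h.mol_cut hs hs').memLp i).1.congr (mol_cut_ae i.2 _)) fun i => ?_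
  filter_upwards [mol_cut_ae (R := R) i.2 (f i.1)] with x hx
  rw [hx, one_mul]

variable {M : Matrix (Fin n) (Fin n) ℝ} {V φ : Eu n → ℝ} {lam p : ℝ}

/-- Both halves of each commutator converge to the same function in L² of the ball, since Vf and A·g
are already locally in L². No derivative of the coefficients is needed. -/
theorem lpTendsto_errLin (hV : Continuous V) {f : Eu n → ℂ} {g : Eu n → EuclideanSpace ℂ (Fin n)}
    (hf : MemLp f 2 volume) (hg : MemLp g 2 volume) :
    LpTendsto atTop 2 (ballMeas n R) (fun k => errLin M V R k f g) (fun _ => 0) := by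
  have hf1 := hf.mono_measure (ballMeas_le (n := n) (R + 1))
  have hg1 := hg.mono_measure (ballMeas_le (n := n) (R + 1))
  have hA := continuous_rotField M
  have h1 := (lpTendsto_mol_cut one_le_two (by simp) (memLp_smul_weight hV hf1)).sub one_le_two
    ((lpTendsto_mol_ball one_le_two (by simp) hf1).smul_weight hV)
  have h2 := ((lpTendsto_mol_cut one_le_two (by simp) (memLp_dotC hA hg1)).sub one_le_two
    ((lpTendsto_mol_ball one_le_two (by simp) hg1).dotC hA)).clm
      (B := fun _ => ContinuousLinearMap.mul ℝ ℂ Complex.I) continuous_const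
  have h3 := h1.add one_le_two h2
  simp only [sub_self, map_zero, add_zero] at h3
  exact h3

theorem LpBdd.errLin (hV : Continuous V) {f : ι → Eu n → ℂ}
    {g : ι → Eu n → EuclideanSpace ℂ (Fin n)}
    (hf : LpBdd 2 volume f) (hg : LpBdd 2 volume g) :
    LpBdd 2 (ballMeas n R) (fun i : ι × ℕ => RNLS.errLin M V R i.2 (f i.1) (g i.1)) := by
  have hf1 := hf.mono_measure (ballMeas_le (n := n) (R + 1))
  have hg1 := hg.mono_measure (ballMeas_le (n := n) (R + 1))
  have hA := continuous_rotField M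
  have h1 := ((hf1.smul_weight hV).mol_cut one_le_two (by simp)).sub one_le_two
    ((hf1.mol_ball one_le_two (by simp)).smul_weight hV)
  have h2 := (((hg1.dotC hA).mol_cut one_le_two (by simp)).sub one_le_two
    ((hg1.mol_ball one_le_two (by simp)).dotC hA)).clm
      (B := fun _ => ContinuousLinearMap.mul ℝ ℂ Complex.I) continuous_const
  exact h1.add one_le_two h2

/-- The power of the mollification and the mollification of the power have the same limit, by
continuity of the power from L^{p+1} to L^{(p+1)/p}. -/
theorem lpTendsto_errPow (hp : 1 ≤ p) {f : Eu n → ℂ}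
    (hf : MemLp f (ENNReal.ofReal (p + 1)) (ballMeas n (R + 1))) :
    LpTendsto atTop (ENNReal.ofReal ((p + 1) / p)) (ballMeas n R)
      (fun k => errPow p R k f) (fun _ => 0) := by
  have h1 := (lpTendsto_mol_cut (one_le_ofReal_div hp) (by simp) (memLp_powNL hp hf).1).sub
    (one_le_ofReal_div hp) ((lpTendsto_mol_ball (one_le_ofReal_add hp) (by simp) hf).powNL hp)
  simp only [sub_self] at h1
  exact h1

theorem LpBdd.errPow (hp : 1 ≤ p) {f : ι → Eu n → ℂ}
    (hf : LpBdd (ENNReal.ofReal (p + 1)) (ballMeas n (R + 1)) f) :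
    LpBdd (ENNReal.ofReal ((p + 1) / p)) (ballMeas n R)
      (fun i : ι × ℕ => RNLS.errPow p R i.2 (f i.1)) :=
  ((hf.powNL hp).mol_cut (one_le_ofReal_div hp) (by simp)).sub
    (one_le_ofReal_div hp) ((hf.mol_ball (one_le_ofReal_add hp) (by simp)).powNL hp)

/-- The contribution of the commutators, tested against `Y`. -/
def errPair (M : Matrix (Fin n) (Fin n) ℝ) (V : Eu n → ℝ) (lam p R : ℝ) (k : ℕ) (f : Eu n → ℂ)
    (g : Eu n → EuclideanSpace ℂ (Fin n)) (Y : Eu n → ℂ) : ℝ :=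
  2 * (∫ x, inner ℝ (errLin M V R k f g x) (Y x) ∂ballMeas n R) -
    2 * lam * ∫ x, inner ℝ (errPow p R k f x) (Y x) ∂ballMeas n R

theorem abs_errPair_le (hp : 1 ≤ p) {k : ℕ} {f : Eu n → ℂ}
    {g : Eu n → EuclideanSpace ℂ (Fin n)} {Y : Eu n → ℂ}
    (h1 : MemLp (errLin M V R k f g) 2 (ballMeas n R))
    (h2 : MemLp (errPow p R k f) (ENNReal.ofReal ((p + 1) / p)) (ballMeas n R))
    (hY : MemLp Y 2 (ballMeas n R)) (hY' : MemLp Y (ENNReal.ofReal (p + 1)) (ballMeas n R)) :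
    |errPair M V lam p R k f g Y| ≤ 2 * ‖(innerSL ℝ : ℂ →L[ℝ] ℂ →L[ℝ] ℝ)‖ *
      ((eLpNorm (errLin M V R k f g) 2 (ballMeas n R)).toReal *
        (eLpNorm Y 2 (ballMeas n R)).toReal + |lam| *
      ((eLpNorm (errPow p R k f) (ENNReal.ofReal ((p + 1) / p)) (ballMeas n R)).toReal *
        (eLpNorm Y (ENNReal.ofReal (p + 1)) (ballMeas n R)).toReal)) := by
  have := holderTriple_powNL hp
  have e1 : |∫ x, inner ℝ (errLin M V R k f g x) (Y x) ∂ballMeas n R| ≤ _ :=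
    norm_integral_bilin_le (innerSL ℝ : ℂ →L[ℝ] ℂ →L[ℝ] ℝ) h1 hY
  have e2 : |∫ x, inner ℝ (errPow p R k f x) (Y x) ∂ballMeas n R| ≤ _ :=
    norm_integral_bilin_le (innerSL ℝ : ℂ →L[ℝ] ℂ →L[ℝ] ℝ) h2 hY'
  rw [errPair]
  refine (abs_sub _ _).trans ?_
  rw [abs_mul, abs_mul, abs_mul, abs_two]
  have e2' := mul_le_mul_of_nonneg_left e2 (abs_nonneg lam)
  linarith

/-- The equation for the mollified solution, tested against `Y`, with the commutators split off. -/
theorem integral_inner_rhsC {k : ℕ} {f : Eu n → ℂ}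
    {g : Eu n → EuclideanSpace ℂ (Fin n)} {Y : Eu n → ℂ} (hp : 1 ≤ p) (hw : IsWeakGrad f g)
    (hV : Continuous V) (h1 : MemLp (errLin M V R k f g) 2 (ballMeas n R))
    (h2 : MemLp (errPow p R k f) (ENNReal.ofReal ((p + 1) / p)) (ballMeas n R))
    (hYc : Continuous Y) (hYR : ∀ x, x ∉ Metric.ball (0 : Eu n) R → Y x = 0) :
    2 * ∫ x, inner ℝ (rhsC M V lam p k f g x) (Y x) =
      2 * (∫ x, inner ℝ (rhsSmooth M V lam p (mol k f) (mol k g) x) (Y x)) +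
        errPair M V lam p R k f g Y := by
  have := holderTriple_powNL hp
  have hY : ∀ s, MemLp Y s (ballMeas n R) := fun s => by
    obtain ⟨C, -, hC⟩ := exists_bound_ball hYc R
    refine MemLp.of_bound hYc.aestronglyMeasurable C ?_
    filter_upwards [ae_ballMeas_mem R] with x hx using hC x hx
  have hv := (contDiff_mol k hw.1).continuous
  have hg := (contDiff_mol k hw.2.1).continuous
  have hS : Continuous (rhsSmooth M V lam p (mol k f) (mol k g)) := by
    have ha := (contDiff_lap (contDiff_reF (contDiff_mol k hw.1))).continuous
    have hb := (contDiff_lap (contDiff_imF (contDiff_mol k hw.1))).continuous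
    have hd : Continuous fun x => dotC (rotField M x) (mol k g x) := by
      simp only [← dotB_apply]
      exact ((dotB n).continuous.comp (continuous_rotField M)).clm_apply hg
    have hN : Continuous fun x => powNL p (mol k f x) := (continuous_powNL hp).comp hv
    unfold rhsSmooth
    fun_prop
  have hS2 : MemLp (rhsSmooth M V lam p (mol k f) (mol k g)) 2 (ballMeas n R) := by
    obtain ⟨C, -, hC⟩ := exists_bound_ball hS R
    refine MemLp.of_bound hS.aestronglyMeasurable C ?_
    filter_upwards [ae_ballMeas_mem R] with x hx using hC x hx
  have i0 : Integrable (fun x => inner ℝ (rhsSmooth M V lam p (mol k f) (mol k g) x) (Y x))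
      (ballMeas n R) := integrable_bilin (innerSL ℝ) hS2 (hY 2)
  have i1 : Integrable (fun x => inner ℝ (errLin M V R k f g x) (Y x)) (ballMeas n R) :=
    integrable_bilin (innerSL ℝ) h1 (hY 2)
  have i2 : Integrable (fun x => inner ℝ (errPow p R k f x) (Y x)) (ballMeas n R) :=
    integrable_bilin (innerSL ℝ) h2 (hY (ENNReal.ofReal (p + 1)))
  rw [← integral_ballMeas (R := R) fun x hx => by rw [hYR x hx, inner_zero_right],
    ← integral_ballMeas (R := R)
      (h := fun x => inner ℝ (rhsSmooth M V lam p (mol k f) (mol k g) x) (Y x))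
      fun x hx => by rw [hYR x hx, inner_zero_right]]
  have e : ∫ x, inner ℝ (rhsC M V lam p k f g x) (Y x) ∂ballMeas n R =
      ∫ x, (inner ℝ (rhsSmooth M V lam p (mol k f) (mol k g) x) (Y x) +
        (inner ℝ (errLin M V R k f g x) (Y x) - lam * inner ℝ (errPow p R k f x) (Y x)))
        ∂ballMeas n R := by
    refine integral_congr_ae ?_
    filter_upwards [ae_ballMeas_mem R] with x hx
    rw [rhsC_eq hw hx]
    have : ((lam : ℂ) * errPow p R k f x) = lam • errPow p R k f x := (Complex.real_smul).symm
    rw [this, inner_add_left, inner_sub_left, real_inner_smul_left]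
    rfl
  have i3 : Integrable (fun x => inner ℝ (errLin M V R k f g x) (Y x) -
      lam * inner ℝ (errPow p R k f x) (Y x)) (ballMeas n R) := i1.sub (i2.const_mul lam)
  rw [e, integral_add i0 i3, integral_sub i1 (i2.const_mul lam), integral_const_mul, errPair]
  ring

/-- The constant is independent of the functions, so it can be used at each time although the
L^{p+1} norm of the gradient is not bounded uniformly in time. -/
theorem exists_eLpNorm_morC_le (hφ : ContDiff ℝ ∞ φ) (R : ℝ) :
    ∃ C, 0 ≤ C ∧ ∀ s, 1 ≤ s → ∀ (f : Eu n → ℂ) (g : Eu n → EuclideanSpace ℂ (Fin n)),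
      MemLp f s (ballMeas n R) → MemLp g s (ballMeas n R) →
      (eLpNorm (morC φ f g) s (ballMeas n R)).toReal ≤
        C * ((eLpNorm f s (ballMeas n R)).toReal + (eLpNorm g s (ballMeas n R)).toReal) := by
  obtain ⟨C1, h01, h1⟩ := exists_bound_ball (continuous_gradient (hφ.of_le (by simp))) R
  obtain ⟨C2, h02, h2⟩ := exists_bound_ball (contDiff_lap hφ).continuous R
  have hC : 0 ≤ 2 * C1 + C2 := by positivity
  refine ⟨2 * C1 + C2, hC, fun s hs f g hf hg => ?_⟩
  have e1 : eLpNorm (morC φ f g) s (ballMeas n R) ≤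
      ENNReal.ofReal (2 * C1 + C2) * eLpNorm (fun x => ‖f x‖ + ‖g x‖) s (ballMeas n R) := by
    refine eLpNorm_le_mul_eLpNorm_of_ae_le_mul ?_ s
    filter_upwards [ae_ballMeas_mem R] with x hx
    rw [morC, Real.norm_of_nonneg (by positivity)]
    have b1 := norm_dotC_le (∇ φ x) (g x)
    have b2 := mul_le_mul_of_nonneg_right (h1 x hx) (norm_nonneg (g x))
    have b3 := mul_le_mul_of_nonneg_right (h2 x hx) (norm_nonneg (f x))
    refine (norm_add_le _ _).trans ?_
    rw [norm_mul, norm_mul, Complex.norm_ofNat, Complex.norm_real]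
    nlinarith [mul_nonneg h01 (norm_nonneg (f x)), mul_nonneg h02 (norm_nonneg (g x))]
  have e2 : eLpNorm (fun x => ‖f x‖ + ‖g x‖) s (ballMeas n R) ≤
      eLpNorm f s (ballMeas n R) + eLpNorm g s (ballMeas n R) := by
    rw [← eLpNorm_norm f, ← eLpNorm_norm g]
    exact eLpNorm_add_le hf.norm.1 hg.norm.1 hs
  have e3 := ENNReal.toReal_mono (ENNReal.mul_ne_top ENNReal.ofReal_ne_top
    (ENNReal.add_ne_top.2 ⟨hf.2.ne, hg.2.ne⟩)) (e1.trans (mul_le_mul_right e2 _))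
  rwa [ENNReal.toReal_mul, ENNReal.toReal_ofReal hC, ENNReal.toReal_add hf.2.ne hg.2.ne] at e3

end MollificationErrors

/-! ### Passage to the limit and the integrable majorant -/

section Limit

/-- Passage to the limit in a sequence of derivatives that are dominated and converge almost
everywhere to a continuous function. -/
theorem hasDerivWithinAt_of_tendsto_of_dominated {τ : ℝ} {Φ Φ' : ℕ → ℝ → ℝ} {F Ψ b : ℝ → ℝ}
    (hd : ∀ k, ∀ t ∈ Set.Icc 0 τ, HasDerivWithinAt (Φ k) (Φ' k t) (Set.Icc 0 τ) t)
    (hlim : ∀ t ∈ Set.Icc 0 τ, Tendsto (fun k => Φ k t) atTop (𝓝 (F t)))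
    (hΨ : ContinuousOn Ψ (Set.Icc 0 τ)) (hb : IntegrableOn b (Set.Icc 0 τ))
    (hbd : ∀ᵐ t ∂volume.restrict (Set.Icc 0 τ), ∀ k, ‖Φ' k t‖ ≤ b t)
    (hlim' : ∀ᵐ t ∂volume.restrict (Set.Icc 0 τ),
      Tendsto (fun k => Φ' k t) atTop (𝓝 (Ψ t))) {t : ℝ} (ht : t ∈ Set.Icc 0 τ) :
    HasDerivWithinAt F (Ψ t) (Set.Icc 0 τ) t := by
  have h0τ : 0 ≤ τ := ht.1.trans ht.2
  have h0 : (0 : ℝ) ∈ Set.Icc 0 τ := ⟨le_rfl, h0τ⟩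
  have hda : ∀ k, ∀ s ∈ Set.Ioo 0 τ, HasDerivAt (Φ k) (Φ' k s) s := fun k s hs =>
    (hd k s (Set.Ioo_subset_Icc_self hs)).hasDerivAt (Icc_mem_nhds hs.1 hs.2)
  -- Measurability in time comes for free: off the endpoints `Φ' k` is a derivative.
  have hm : ∀ k, AEStronglyMeasurable (Φ' k) (volume.restrict (Set.Icc 0 τ)) := fun k => by
    rw [← restrict_Ioo_eq_restrict_Icc]
    refine (measurable_deriv (Φ k)).aestronglyMeasurable.congr ?_
    filter_upwards [ae_restrict_mem measurableSet_Ioo] with s hs using (hda k s hs).deriv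
  have hi : ∀ k, IntegrableOn (Φ' k) (Set.Icc 0 τ) := fun k =>
    Integrable.mono' hb (hm k) (hbd.mono fun s hs => hs k)
  have key : ∀ s ∈ Set.Icc 0 τ, F s = F 0 + ∫ r in (0 : ℝ)..s, Ψ r := by
    intro s hs
    have hsub : Set.Icc 0 s ⊆ Set.Icc 0 τ := Set.Icc_subset_Icc_right hs.2
    have hsub' : Set.Ioc 0 s ⊆ Set.Icc 0 τ := Set.Ioc_subset_Icc_self.trans hsub
    have h1 : ∀ k, ∫ r in (0 : ℝ)..s, Φ' k r = Φ k s - Φ k 0 := fun k =>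
      intervalIntegral.integral_eq_sub_of_hasDerivAt_of_le hs.1
        (fun r hr => ((hd k r (hsub hr)).continuousWithinAt).mono hsub)
        (fun r hr => hda k r ⟨hr.1, hr.2.trans_le hs.2⟩)
        ((intervalIntegrable_iff_integrableOn_Ioc_of_le hs.1).2 ((hi k).mono_set hsub'))
    have h2 : Tendsto (fun k => ∫ r in (0 : ℝ)..s, Φ' k r) atTop
        (𝓝 (∫ r in (0 : ℝ)..s, Ψ r)) := by
      simp only [intervalIntegral.integral_of_le hs.1]
      refine tendsto_integral_of_dominated_convergence b
        (fun k => (hi k).1.mono_measure (Measure.restrict_mono_set _ hsub')) (hb.mono_set hsub')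
        (fun k => ?_) ?_
      · have h5 : ∀ᵐ r ∂volume.restrict (Set.Ioc 0 s), ∀ k, ‖Φ' k r‖ ≤ b r :=
          ae_mono (Measure.restrict_mono_set _ hsub') hbd
        exact h5.mono fun r hr => hr k
      · exact ae_mono (Measure.restrict_mono_set _ hsub') hlim'
    simp only [h1] at h2
    have h3 := tendsto_nhds_unique h2 ((hlim s hs).sub (hlim 0 h0))
    rw [h3]
    ring
  -- A continuous extension to the line makes the fundamental theorem of calculus available at the
  -- endpoints too.
  have hext : Continuous (Set.IccExtend h0τ ((Set.Icc 0 τ).domRestrict Ψ)) :=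
    (continuousOn_iff_continuous_domRestrict.1 hΨ).Icc_extend'
  have hE : ∀ s ∈ Set.Icc 0 τ, Set.IccExtend h0τ ((Set.Icc 0 τ).domRestrict Ψ) s = Ψ s :=
    fun s hs => by rw [Set.IccExtend_of_mem h0τ _ hs]; rfl
  have h4 := ((hext.integral_hasStrictDerivAt 0 t).hasDerivAt.const_add (F 0)).hasDerivWithinAt
    (s := Set.Icc 0 τ)
  rw [hE t ht] at h4
  have key' : ∀ s ∈ Set.Icc 0 τ,
      F s = F 0 + ∫ r in (0 : ℝ)..s, Set.IccExtend h0τ ((Set.Icc 0 τ).domRestrict Ψ) r := by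
    intro s hs
    rw [key s hs]
    congr 1
    refine intervalIntegral.integral_congr fun r hr => ?_
    rw [Set.uIcc_of_le hs.1] at hr
    exact (hE r ⟨hr.1, hr.2.trans hs.2⟩).symm
  exact h4.congr key' (key' t ht)

variable {n : ℕ} {M : Matrix (Fin n) (Fin n) ℝ} {V φ : Eu n → ℝ} {lam p R τ : ℝ} {I : Set ℝ}
  {u : ℝ → Eu n → ℂ} {g : ℝ → Eu n → EuclideanSpace ℂ (Fin n)} {t : ℝ}

namespace IsRegularCurve

/-- The mollified gradient is continuous in time with values in `L^s` of a ball. -/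
theorem continuousOn_eLpNorm_mol_grad (hc : IsRegularCurve M V lam p I u g) {s : ℝ≥0∞}
    (hs : 1 ≤ s) (hs' : s ≠ ⊤) (k : ℕ) (R : ℝ) :
    ContinuousOn (fun t => (eLpNorm (mol k (g t)) s (ballMeas n R)).toReal) I := by
  intro t ht
  -- The gradient is known to be continuous in time only in L². At fixed k, convolution turns this
  -- into uniform convergence on the ball, hence into convergence in every L^s with s finite.
  obtain ⟨C, hC0, hC⟩ := exists_norm_cv_le (F := EuclideanSpace ℂ (Fin n))
    (contDiff_kern (n := n) k).continuous (kern_eq_zero k) R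
  have hg := (hc.lpTendsto_grad t ht).mono_measure (ballMeas_le (n := n) (R + 1))
  have hg1 := hg.mono_exponent one_le_two
  have hlim : Tendsto (fun r => C * (eLpNorm (fun x => g r x - g t x) 1
      (ballMeas n (R + 1))).toReal) (𝓝[I] t) (𝓝 0) := by
    simpa using ((ENNReal.tendsto_toReal ENNReal.zero_ne_top).comp hg1.tendsto).const_mul C
  have hle : ∀ r ∈ I, ∀ x ∈ Metric.ball (0 : Eu n) R, ‖mol k (g r) x - mol k (g t) x‖ ≤
      C * (eLpNorm (fun x => g r x - g t x) 1 (ballMeas n (R + 1))).toReal := fun r hr x hx => by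
    have h2 : MemLp (fun x => g r x - g t x) 1 (ballMeas n (R + 1)) :=
      (((hc.memLp_grad hr).sub (hc.memLp_grad ht)).mono_measure (ballMeas_le _)).mono_exponent
        one_le_two
    rw [← congrFun (mol_sub k (hc.isWeakGrad r hr).2.1 (hc.isWeakGrad t ht).2.1) x]
    exact hC _ h2 x hx
  have hcont : ∀ r ∈ I, Continuous (mol k (g r)) := fun r hr =>
    (contDiff_mol k (hc.isWeakGrad r hr).2.1).continuous
  have h : LpTendsto (𝓝[I] t) s (ballMeas n R) (fun r => mol k (g r)) (mol k (g t)) := by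
    refine LpTendsto.of_bdd_pointwise (C := 1) hs' ?_ ?_ ?_ ?_
    · filter_upwards [eventually_mem_nhdsWithin] with r hr using (hcont r hr).aestronglyMeasurable
    · obtain ⟨D, -, hD⟩ := exists_bound_ball (hcont t ht) R
      refine MemLp.of_bound (hcont t ht).aestronglyMeasurable D ?_
      filter_upwards [ae_ballMeas_mem R] with x hx using hD x hx
    · filter_upwards [eventually_mem_nhdsWithin, hlim.eventually_lt_const one_pos] with r hr h1
      filter_upwards [ae_ballMeas_mem R] with x hx using (hle r hr x hx).trans h1.le
    · filter_upwards [ae_ballMeas_mem R] with x hx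
      rw [tendsto_iff_norm_sub_tendsto_zero]
      refine tendsto_of_tendsto_of_tendsto_of_le_of_le' tendsto_const_nhds hlim
        (Eventually.of_forall fun r => norm_nonneg _) ?_
      filter_upwards [eventually_mem_nhdsWithin] with r hr using hle r hr x hx
  exact h.eLpNorm_tendsto hs

/-- The mollified gradients are dominated in `L^s` by an integrable function of time. -/
theorem exists_integrable_bound_grad (hc : IsRegularCurve M V lam p (Set.Icc 0 τ) u g)
    {s q : ℝ≥0∞} (hs : 1 ≤ s) (hs' : s ≠ ⊤) (hq : 1 ≤ q) (R : ℝ) {H : ℝ → ℝ≥0∞}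
    (hH : eLpNorm H q (volume.restrict (Set.Icc 0 τ)) < ⊤)
    (hgH : ∀ t ∈ Set.Icc 0 τ, eLpNorm (g t) s volume ≤ H t) :
    ∃ G : ℝ → ℝ, IntegrableOn G (Set.Icc 0 τ) ∧ ∀ᵐ t ∂volume.restrict (Set.Icc 0 τ),
      ∀ k, (eLpNorm (mol k (g t)) s (ballMeas n R)).toReal ≤ G t := by
  set N : ℕ → ℝ → ℝ := fun k t => (eLpNorm (mol k (g t)) s (ballMeas n R)).toReal with hN
  -- `H` is not assumed measurable in time. The supremum of the mollified norms is measurable, being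
  -- a countable supremum of continuous functions, and lies below `H`.
  set G : ℝ → ℝ≥0∞ := fun t => ⨆ k, ENNReal.ofReal (N k t) with hG
  have hGm : AEMeasurable G (volume.restrict (Set.Icc 0 τ)) := AEMeasurable.iSup fun k =>
    ((hc.continuousOn_eLpNorm_mol_grad hs hs' k R).aemeasurable measurableSet_Icc).ennreal_ofReal
  have hGH : ∀ t ∈ Set.Icc 0 τ, G t ≤ H t := fun t ht => iSup_le fun k =>
    ENNReal.ofReal_toReal_le.trans (((eLpNorm_mono_measure _ (ballMeas_le R)).trans
      (eLpNorm_mol_le k (hc.memLp_grad ht).1 hs hs')).trans (hgH t ht))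
  have hGq : eLpNorm G q (volume.restrict (Set.Icc 0 τ)) < ⊤ := by
    refine lt_of_le_of_lt (eLpNorm_mono_enorm_ae ?_) hH
    filter_upwards [ae_restrict_mem measurableSet_Icc] with t ht
    simpa using hGH t ht
  have hG1 : eLpNorm G 1 (volume.restrict (Set.Icc 0 τ)) < ⊤ := by
    have h1 : MemLp G q (volume.restrict (Set.Icc 0 τ)) := ⟨hGm.aestronglyMeasurable, hGq⟩
    exact (h1.mono_exponent hq).2
  have hGi : ∫⁻ t in Set.Icc 0 τ, G t ≠ ⊤ := by
    rw [eLpNorm_one_eq_lintegral_enorm] at hG1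
    simpa using hG1.ne
  refine ⟨fun t => (G t).toReal, integrable_toReal_of_lintegral_ne_top hGm hGi, ?_⟩
  filter_upwards [ae_lt_top' hGm hGi] with t ht k
  have h1 : ENNReal.ofReal (N k t) ≤ G t := le_iSup (fun k => ENNReal.ofReal (N k t)) k
  have h2 := ENNReal.toReal_mono ht.ne h1
  rwa [ENNReal.toReal_ofReal ENNReal.toReal_nonneg] at h2

end IsRegularCurve

end Limit

/-! ### The mass and virial identities along regular curves -/

section RegularCurveVirial

variable {n : ℕ} {M : Matrix (Fin n) (Fin n) ℝ} {V φ : Eu n → ℝ} {lam p R τ : ℝ} {I : Set ℝ}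
  {u : ℝ → Eu n → ℂ} {g : ℝ → Eu n → EuclideanSpace ℂ (Fin n)} {t : ℝ}

theorem exists_abs_virialK_le {ι : Type*} {f : ι → Eu n → ℂ}
    {g : ι → Eu n → EuclideanSpace ℂ (Fin n)}
    (hφ : ContDiff ℝ ∞ φ) (hR : tsupport φ ⊆ Metric.ball 0 R)
    (hf : LpBdd 2 (ballMeas n R) f) (hg : LpBdd 2 (ballMeas n R) g) :
    ∃ C, ∀ i, |virialK φ (f i) (g i)| ≤ C := by
  obtain ⟨C, hC⟩ := hf.integral_bilin conjMul
    (hg.dotC (continuous_gradient (hφ.of_le (by simp))))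
  refine ⟨2 * C, fun i => ?_⟩
  have h := hC i
  rw [integral_ballMeas] at h
  · rw [virialK, abs_mul, abs_two]
    exact mul_le_mul_of_nonneg_left ((Complex.abs_im_le_norm _).trans h) zero_le_two
  · intro x hx
    rw [gradient_eq_zero fun h => hx (hR h)]
    simp [dotC]

/-- The commutators tend to zero in norm, so boundedness of the test functions in the dual norms
suffices. -/
theorem tendsto_errPair_zero (hV : Continuous V) (hp : 1 ≤ p) {f : Eu n → ℂ}
    {g : Eu n → EuclideanSpace ℂ (Fin n)} (hf : MemLp f 2 volume) (hg : MemLp g 2 volume)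
    (hf' : MemLp f (ENNReal.ofReal (p + 1)) (ballMeas n (R + 1))) {Y : ℕ → Eu n → ℂ} {B : ℝ}
    (hY : ∀ k, MemLp (Y k) 2 (ballMeas n R))
    (hY' : ∀ k, MemLp (Y k) (ENNReal.ofReal (p + 1)) (ballMeas n R))
    (hB : ∀ k, (eLpNorm (Y k) 2 (ballMeas n R)).toReal ≤ B)
    (hB' : ∀ k, (eLpNorm (Y k) (ENNReal.ofReal (p + 1)) (ballMeas n R)).toReal ≤ B) :
    Tendsto (fun k => errPair M V lam p R k f g (Y k)) atTop (𝓝 0) := by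
  have h1 := lpTendsto_errLin (M := M) (R := R) hV hf hg
  have h2 := lpTendsto_errPow hp hf'
  have h1' := (ENNReal.tendsto_toReal ENNReal.zero_ne_top).comp h1.tendsto
  have h2' := (ENNReal.tendsto_toReal ENNReal.zero_ne_top).comp h2.tendsto
  simp only [sub_zero, Function.comp_def, ENNReal.toReal_zero] at h1' h2'
  have h3 := ((h1'.mul_const B).add ((h2'.mul_const B).const_mul |lam|)).const_mul
    (2 * ‖(innerSL ℝ : ℂ →L[ℝ] ℂ →L[ℝ] ℝ)‖)
  simp only [zero_mul, mul_zero, add_zero] at h3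
  refine squeeze_zero_norm' ?_ h3
  filter_upwards [h1.ev, h2.ev] with k hk1 hk2
  refine (abs_errPair_le hp hk1 hk2 (hY k) (hY' k)).trans ?_
  gcongr
  · exact hB k
  · exact hB' k

namespace IsRegularCurve

/-- The norms of Y stay explicit because for the current they vary with time and are only
integrable. -/
theorem exists_abs_errPair_le (hc : IsRegularCurve M V lam p I u g) (hI : IsCompact I)
    (hV : Continuous V) (hp : 1 ≤ p) (hR : 0 < R) :
    ∃ C, 0 ≤ C ∧ ∀ t ∈ I, ∀ k, ∀ Y : Eu n → ℂ, MemLp Y 2 (ballMeas n R) →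
      MemLp Y (ENNReal.ofReal (p + 1)) (ballMeas n R) →
      |errPair M V lam p R k (u t) (g t) Y| ≤ C * ((eLpNorm Y 2 (ballMeas n R)).toReal +
        (eLpNorm Y (ENNReal.ofReal (p + 1)) (ballMeas n R)).toReal) := by
  have h1 := LpBdd.errLin (M := M) (R := R) hV (hc.lpBdd hI) (hc.lpBdd_grad hI)
  have h2 := LpBdd.errPow hp (hc.lpBdd_pow hI hp (by linarith : 0 < R + 1))
  obtain ⟨A, hA⟩ := h1.bdd
  obtain ⟨D, hD⟩ := h2.bdd
  refine ⟨2 * ‖(innerSL ℝ : ℂ →L[ℝ] ℂ →L[ℝ] ℝ)‖ * max (max A 0) (|lam| * max D 0),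
    by positivity, fun t ht k Y hY hY' => ?_⟩
  refine (abs_errPair_le hp (h1.memLp (⟨t, ht⟩, k)) (h2.memLp (⟨t, ht⟩, k)) hY hY').trans ?_
  rw [mul_assoc (2 * _), mul_add (max _ _)]
  have a1 := (hA (⟨t, ht⟩, k)).trans (le_max_left A 0)
  have a2 := mul_le_mul_of_nonneg_left ((hD (⟨t, ht⟩, k)).trans (le_max_left D 0))
    (abs_nonneg lam)
  have a3 : 0 ≤ 2 * ‖(innerSL ℝ : ℂ →L[ℝ] ℂ →L[ℝ] ℝ)‖ := by positivity
  refine mul_le_mul_of_nonneg_left (add_le_add ?_ ?_) a3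
  · exact mul_le_mul_of_nonneg_right (a1.trans (le_max_left _ _)) ENNReal.toReal_nonneg
  · rw [← mul_assoc]
    exact mul_le_mul_of_nonneg_right (a2.trans (le_max_right _ _)) ENNReal.toReal_nonneg

theorem memLp_err (hc : IsRegularCurve M V lam p I u g) (hI : IsCompact I)
    (hV : Continuous V) (hp : 1 ≤ p) (hR : 0 < R) (k : ℕ) (ht : t ∈ I) :
    MemLp (errLin M V R k (u t) (g t)) 2 (ballMeas n R) ∧
      MemLp (errPow p R k (u t)) (ENNReal.ofReal ((p + 1) / p)) (ballMeas n R) :=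
  ⟨(LpBdd.errLin (M := M) (R := R) hV (hc.lpBdd hI) (hc.lpBdd_grad hI)).memLp (⟨t, ht⟩, k),
    (LpBdd.errPow hp (hc.lpBdd_pow hI hp (by linarith : 0 < R + 1))).memLp (⟨t, ht⟩, k)⟩

theorem lpTendsto_mol_atTop (hc : IsRegularCurve M V lam p I u g) (R : ℝ) (ht : t ∈ I) :
    LpTendsto atTop 2 (ballMeas n R) (fun k => mol k (u t)) (u t) :=
  (lpTendsto_mol one_le_two (by simp) (hc.memLp ht)).mono_measure (ballMeas_le R)

theorem lpTendsto_mol_grad_atTop (hc : IsRegularCurve M V lam p I u g) (R : ℝ) (ht : t ∈ I) :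
    LpTendsto atTop 2 (ballMeas n R) (fun k => mol k (g t)) (g t) :=
  (lpTendsto_mol one_le_two (by simp) (hc.memLp_grad ht)).mono_measure (ballMeas_le R)

theorem lpBdd_mol (hc : IsRegularCurve M V lam p I u g) (hI : IsCompact I) (R : ℝ) :
    LpBdd 2 (ballMeas n R) (fun i : I × ℕ => mol i.2 (u i.1)) :=
  ((hc.lpBdd hI).mol one_le_two (by simp)).mono_measure (ballMeas_le R)

theorem lpBdd_mol_grad (hc : IsRegularCurve M V lam p I u g) (hI : IsCompact I) (R : ℝ) :
    LpBdd 2 (ballMeas n R) (fun i : I × ℕ => mol i.2 (g i.1)) :=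
  ((hc.lpBdd_grad hI).mol one_le_two (by simp)).mono_measure (ballMeas_le R)

theorem lpBdd_mol_pow (hc : IsRegularCurve M V lam p I u g) (hI : IsCompact I) (hp : 1 ≤ p)
    (hR : 0 < R) :
    LpBdd (ENNReal.ofReal (p + 1)) (ballMeas n R) (fun i : I × ℕ => mol i.2 (u i.1)) :=
  (hc.lpBdd_pow hI hp (by linarith : 0 < R + 1)).mol_ball (one_le_ofReal_add hp) (by simp)

/-- The localized mass of a regular curve is differentiable; its derivative is the virial
current. -/
theorem hasDerivWithinAt_mass (hc : IsRegularCurve M V lam p (Set.Icc 0 τ) u g)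
    (hV : Continuous V) (hp : 1 ≤ p) (hM : M = -Mᵀ) (hφ : ContDiff ℝ ∞ φ)
    (hφc : HasCompactSupport φ) (hB : ∀ x, rotD M φ x = 0) (hR0 : 0 < R)
    (hR : tsupport φ ⊆ Metric.ball 0 R) (ht : t ∈ Set.Icc 0 τ) :
    HasDerivWithinAt (fun s => ∫ x, φ x * ‖u s x‖ ^ 2) (virialK φ (u t) (g t))
      (Set.Icc 0 τ) t := by
  have hI : IsCompact (Set.Icc 0 τ) := isCompact_Icc
  have hU2 := hc.lpBdd_mol hI R
  have hG2 := hc.lpBdd_mol_grad hI R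
  have hUp := hc.lpBdd_mol_pow hI hp hR0
  have hrot : ∀ {s : ℝ≥0∞}, LpBdd s (ballMeas n R)
      (fun i : Set.Icc 0 τ × ℕ => mol i.2 (u i.1)) → LpBdd s (ballMeas n R)
      (fun (i : Set.Icc 0 τ × ℕ) x => φ x • (Complex.I * mol i.2 (u i.1) x)) := fun h =>
    LpBdd.smul_weight hφ.continuous (h.clm
      (B := fun _ => ContinuousLinearMap.mul ℝ ℂ Complex.I) continuous_const)
  -- The test function iφv contains no gradient. It is bounded in L² and in L^{p+1} uniformly in
  -- time and scale, so a constant majorant suffices.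
  have hY2 := hrot hU2
  have hYp := hrot hUp
  obtain ⟨B1, hB1⟩ := hY2.bdd
  obtain ⟨B2, hB2⟩ := hYp.bdd
  obtain ⟨C1, hC1⟩ := exists_abs_virialK_le hφ hR hU2 hG2
  obtain ⟨C2, hC20, hC2⟩ := hc.exists_abs_errPair_le hI hV hp hR0
  refine hasDerivWithinAt_of_tendsto_of_dominated
    (Φ := fun k s => ∫ x, φ x * ‖mol k (u s) x‖ ^ 2)
    (Φ' := fun k s => virialK φ (mol k (u s)) (mol k (g s)) +
      errPair M V lam p R k (u s) (g s) fun x => φ x • (Complex.I * mol k (u s) x))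
    (Ψ := fun s => virialK φ (u s) (g s)) (b := fun _ => C1 + C2 * (B1 + B2))
    (fun k s hs => ?_) (fun s hs => tendsto_virialJ hφ hR (hc.lpTendsto_mol_atTop R hs))
    (fun s hs => tendsto_virialK hφ hR ((hc.lpTendsto s hs).mono_measure (ballMeas_le R))
      ((hc.lpTendsto_grad s hs).mono_measure (ballMeas_le R)))
    (integrableOn_const (by simp)) ?_ ?_ ht
  · have h1 := hc.hasDerivWithinAt_virialJ hI (convex_Icc 0 τ) hV hp hφ hR0 hR k hs
    have hw := hc.isWeakGrad s hs
    obtain ⟨e1, e2⟩ := hc.memLp_err hI hV hp hR0 k hs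
    have h2 := integral_inner_rhsC (M := M) (V := V) (lam := lam) hp hw hV e1 e2
      (Y := fun x => φ x • (Complex.I * mol k (u s) x))
      (hφ.continuous.smul (continuous_const.mul (contDiff_mol k hw.1).continuous))
      (fun x hx => by
        rw [weight_eq_zero (fun _ hx => image_eq_zero_of_notMem_tsupport hx) hR x hx, zero_smul])
    have h3 := integral_inner_rhsSmooth (V := V) (lam := lam) (p := p) k hw hφ hφc hM hB
    simp only [fun x => real_inner_comm (rhsSmooth M V lam p (mol k (u s)) (mol k (g s)) x)
      (φ x • (Complex.I * mol k (u s) x))] at h3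
    simp only [fun x => real_inner_comm (rhsC M V lam p k (u s) (g s) x)
      (φ x • (Complex.I * mol k (u s) x))] at h1
    rwa [h2, h3] at h1
  · filter_upwards [ae_restrict_mem measurableSet_Icc] with s hs k
    have h1 := hC1 (⟨s, hs⟩, k)
    have h2 := hC2 s hs k _ (hY2.memLp (⟨s, hs⟩, k)) (hYp.memLp (⟨s, hs⟩, k))
    have h3 := mul_le_mul_of_nonneg_left
      (add_le_add (hB1 (⟨s, hs⟩, k)) (hB2 (⟨s, hs⟩, k))) hC20
    exact (norm_add_le _ _).trans (add_le_add h1 (h2.trans h3))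
  · filter_upwards [ae_restrict_mem measurableSet_Icc] with s hs
    have h1 := tendsto_virialK hφ hR (hc.lpTendsto_mol_atTop R hs) (hc.lpTendsto_mol_grad_atTop R hs)
    have h2 := tendsto_errPair_zero (M := M) (lam := lam) hV hp (hc.memLp hs) (hc.memLp_grad hs)
      ((hc.lpTendsto_pow (R + 1) (by linarith) s hs).lim)
      (Y := fun k x => φ x • (Complex.I * mol k (u s) x)) (B := max B1 B2)
      (fun k => hY2.memLp (⟨s, hs⟩, k)) (fun k => hYp.memLp (⟨s, hs⟩, k))
      (fun k => (hB1 (⟨s, hs⟩, k)).trans (le_max_left _ _))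
      (fun k => (hB2 (⟨s, hs⟩, k)).trans (le_max_right _ _))
    simpa using h1.add h2

/-- The virial current of a regular curve is differentiable, with the derivative predicted by the
virial identity. -/
theorem hasDerivWithinAt_current (hc : IsRegularCurve M V lam p (Set.Icc 0 τ) u g)
    (hV : ContDiff ℝ 1 V) (hp : 1 ≤ p) (hM : M = -Mᵀ) (hφ : ContDiff ℝ ∞ φ)
    (hφc : HasCompactSupport φ) (hB : ∀ x, rotD M φ x = 0) (hR0 : 0 < R)
    (hR : tsupport φ ⊆ Metric.ball 0 R) {q : ℝ≥0∞} (hq : 1 ≤ q) {H : ℝ → ℝ≥0∞}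
    (hH : eLpNorm H q (volume.restrict (Set.Icc 0 τ)) < ⊤)
    (hgH : ∀ t ∈ Set.Icc 0 τ, eLpNorm (g t) (ENNReal.ofReal (p + 1)) volume ≤ H t)
    (ht : t ∈ Set.Icc 0 τ) :
    HasDerivWithinAt (fun s => virialK φ (u s) (g s)) (virialP φ V lam p (u t) (g t))
      (Set.Icc 0 τ) t := by
  have hI : IsCompact (Set.Icc 0 τ) := isCompact_Icc
  have hU2 := hc.lpBdd_mol hI R
  have hG2 := hc.lpBdd_mol_grad hI R
  have hUp := hc.lpBdd_mol_pow hI hp hR0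
  have hY2 := hU2.morC hφ one_le_two hG2
  obtain ⟨B1, hB1⟩ := hY2.bdd
  obtain ⟨B2, hB2⟩ := hUp.bdd
  obtain ⟨C1, hC1⟩ := exists_abs_virialP_le (lam := lam) hφ hR hV hp hU2 hG2 hUp
  obtain ⟨C2, hC20, hC2⟩ := hc.exists_abs_errPair_le hI hV.continuous hp hR0
  obtain ⟨C3, hC30, hC3⟩ := exists_eLpNorm_morC_le hφ R
  have hp1 := one_le_ofReal_add hp
  -- This is the only use of the bound on the gradient in L^q in time with values in L^{p+1}.
  obtain ⟨G, hGi, hG⟩ := hc.exists_integrable_bound_grad hp1 (by simp) hq R hH hgH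
  have hgrad : ∀ s ∈ Set.Icc 0 τ, ∀ k,
      MemLp (mol k (g s)) (ENNReal.ofReal (p + 1)) (ballMeas n R) := fun s hs k => by
    have hcont := (contDiff_mol k (hc.isWeakGrad s hs).2.1).continuous
    obtain ⟨D, -, hD⟩ := exists_bound_ball hcont R
    refine MemLp.of_bound hcont.aestronglyMeasurable D ?_
    filter_upwards [ae_ballMeas_mem R] with x hx using hD x hx
  have hYp : ∀ s ∈ Set.Icc 0 τ, ∀ k, MemLp (morC φ (mol k (u s)) (mol k (g s)))
      (ENNReal.ofReal (p + 1)) (ballMeas n R) := fun s hs k =>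
    -- Only membership of the limit is extracted from the convergence statement, so the filter is
    -- irrelevant.
    ((LpTendsto.const (l := (⊥ : Filter ℕ)) (hUp.memLp (⟨s, hs⟩, k))).morC hφ hp1
      (LpTendsto.const (hgrad s hs k))).lim
  have hYb : ∀ s (hs : s ∈ Set.Icc 0 τ), (∀ k, (eLpNorm (mol k (g s)) (ENNReal.ofReal (p + 1))
      (ballMeas n R)).toReal ≤ G s) → ∀ k, (eLpNorm (morC φ (mol k (u s)) (mol k (g s)))
      (ENNReal.ofReal (p + 1)) (ballMeas n R)).toReal ≤ C3 * (B2 + G s) := fun s hs h k =>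
    (hC3 _ hp1 _ _ (hUp.memLp (⟨s, hs⟩, k)) (hgrad s hs k)).trans
      (mul_le_mul_of_nonneg_left (add_le_add (hB2 (⟨s, hs⟩, k)) (h k)) hC30)
  refine hasDerivWithinAt_of_tendsto_of_dominated
    (Φ := fun k s => virialK φ (mol k (u s)) (mol k (g s)))
    (Φ' := fun k s => virialP φ V lam p (mol k (u s)) (mol k (g s)) +
      errPair M V lam p R k (u s) (g s) (morC φ (mol k (u s)) (mol k (g s))))
    (Ψ := fun s => virialP φ V lam p (u s) (g s))
    (b := fun s => C1 + C2 * (B1 + C3 * (B2 + G s)))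
    (fun k s hs => ?_) (fun s hs => tendsto_virialK hφ hR (hc.lpTendsto_mol_atTop R hs)
      (hc.lpTendsto_mol_grad_atTop R hs))
    (fun s hs => tendsto_virialP hφ hR hV hp
      ((hc.lpTendsto s hs).mono_measure (ballMeas_le R))
      ((hc.lpTendsto_grad s hs).mono_measure (ballMeas_le R)) (hc.lpTendsto_pow R hR0 s hs))
    ?_ ?_ ?_ ht
  · have h1 := hc.hasDerivWithinAt_virialK hI (convex_Icc 0 τ) hV.continuous hp hφ hφc hR0 hR k hs
    have hw := hc.isWeakGrad s hs
    obtain ⟨e1, e2⟩ := hc.memLp_err hI hV.continuous hp hR0 k hs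
    have hgc : Continuous fun x => dotC (∇ φ x) (mol k (g s) x) := by
      simp only [← dotB_apply]
      exact (continuous_dotB (continuous_gradient (hφ.of_le (by simp)))).clm_apply
        (contDiff_mol k hw.2.1).continuous
    have hYc : Continuous (morC φ (mol k (u s)) (mol k (g s))) :=
      (continuous_const.mul hgc).add ((Complex.continuous_ofReal.comp
        (contDiff_lap hφ).continuous).mul (contDiff_mol k hw.1).continuous)
    have h2 := integral_inner_rhsC (M := M) (V := V) (lam := lam) hp hw hV.continuous e1 e2 hYc
      (fun x hx => morC_eq_zero (fun h => hx (hR h)) _ _)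
    rwa [h2, integral_inner_rhsSmooth_morC k hw hφ hφc hM hB hV hp] at h1
  · have hconst : ∀ c : ℝ, IntegrableOn (fun _ => c) (Set.Icc 0 τ) := fun c =>
      integrableOn_const (by simp)
    exact (hconst C1).add (((hconst B1).add (((hconst B2).add hGi).const_mul C3)).const_mul C2)
  · filter_upwards [ae_restrict_mem measurableSet_Icc, hG] with s hs hGs k
    have h1 := hC1 (⟨s, hs⟩, k)
    have h2 := hC2 s hs k _ (hY2.memLp (⟨s, hs⟩, k)) (hYp s hs k)
    have h3 := mul_le_mul_of_nonneg_left
      (add_le_add (hB1 (⟨s, hs⟩, k)) (hYb s hs hGs k)) hC20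
    exact (norm_add_le _ _).trans (add_le_add h1 (h2.trans h3))
  · filter_upwards [ae_restrict_mem measurableSet_Icc, hG] with s hs hGs
    have hpow := (hc.lpTendsto_pow (R + 1) (by linarith) s hs).lim
    have h1 := tendsto_virialP (lam := lam) hφ hR hV hp (hc.lpTendsto_mol_atTop R hs)
      (hc.lpTendsto_mol_grad_atTop R hs) (lpTendsto_mol_ball hp1 (by simp) hpow)
    have h2 := tendsto_errPair_zero (M := M) (lam := lam) hV.continuous hp (hc.memLp hs)
      (hc.memLp_grad hs) hpow
      (Y := fun k => morC φ (mol k (u s)) (mol k (g s))) (B := max B1 (C3 * (B2 + G s)))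
      (fun k => hY2.memLp (⟨s, hs⟩, k)) (hYp s hs)
      (fun k => (hB1 (⟨s, hs⟩, k)).trans (le_max_left _ _))
      (fun k => (hYb s hs hGs k).trans (le_max_right _ _))
    simpa using h1.add h2

end IsRegularCurve

end RegularCurveVirial

/-! ### Radial weights -/

section Radial

variable {n : ℕ}

theorem hasFDerivAt_radial {h : ℝ → ℝ} {h' : ℝ} {x : Eu n} (hx : x ≠ 0)
    (hh : HasDerivAt h h' ‖x‖) :
    HasFDerivAt (fun y : Eu n => h ‖y‖) ((h' / ‖x‖) • innerSL ℝ x) x := by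
  have hx0 : ‖x‖ ≠ 0 := norm_ne_zero_iff.2 hx
  have h1 := (hasStrictFDerivAt_norm_sq x).hasFDerivAt.sqrt (by positivity)
  simp only [Real.sqrt_sq (norm_nonneg _)] at h1
  have h2 := hh.comp_hasFDerivAt x h1
  refine h2.congr_fderiv ?_
  ext y
  simp only [smul_apply, smul_eq_mul, innerSL_apply_apply, nsmul_eq_mul]
  push_cast
  field_simp

theorem innerSL_single (x : Eu n) (j : Fin n) :
    innerSL ℝ x (EuclideanSpace.single j (1 : ℝ)) = x j := by
  simp [innerSL_apply_apply, EuclideanSpace.inner_single_right]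

theorem pd_radial {h : ℝ → ℝ} {h' : ℝ} {x : Eu n} (hx : x ≠ 0) (hh : HasDerivAt h h' ‖x‖)
    (j : Fin n) : pd j (fun y : Eu n => h ‖y‖) x = h' / ‖x‖ * x j := by
  rw [pd, (hasFDerivAt_radial hx hh).fderiv, smul_apply, innerSL_single,
    smul_eq_mul]

theorem pd_eq_of_eventuallyEq {f f' : Eu n → ℝ} {x : Eu n} (h : f =ᶠ[𝓝 x] f') (j : Fin n) :
    pd j f x = pd j f' x := by rw [pd, pd, h.fderiv_eq]

variable {φ : Eu n → ℝ} {Φ : ℝ → ℝ}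

/-- Restricting φ to a line through the origin gives a smooth function that agrees with the profile
for positive radii. Negative arguments of `Φ` are unconstrained, so smoothness is claimed only away
from 0. -/
theorem contDiffOn_profile (hn : 1 ≤ n) (hφ : ContDiff ℝ ∞ φ) (hΦ : ∀ x, φ x = Φ ‖x‖) :
    ∃ ψ : ℝ → ℝ, ContDiff ℝ ∞ ψ ∧ ∀ r, 0 < r → Φ =ᶠ[𝓝 r] ψ := by
  refine ⟨fun s => φ (s • EuclideanSpace.single ⟨0, hn⟩ (1 : ℝ)),
    hφ.comp (contDiff_id.smul contDiff_const), fun r hr => ?_⟩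
  filter_upwards [lt_mem_nhds hr] with s hs
  rw [hΦ, norm_smul, PiLp.norm_single, Real.norm_of_nonneg hs.le]
  simp

theorem hasDerivAt_profile (hn : 1 ≤ n) (hφ : ContDiff ℝ ∞ φ) (hΦ : ∀ x, φ x = Φ ‖x‖) {r : ℝ}
    (hr : 0 < r) : HasDerivAt Φ (deriv Φ r) r ∧
      HasDerivAt (deriv Φ) (deriv (deriv Φ) r) r := by
  obtain ⟨ψ, hψ, h⟩ := contDiffOn_profile hn hφ hΦ
  have h1 : DifferentiableAt ℝ ψ r := hψ.differentiable (by simp) r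
  have h2 : DifferentiableAt ℝ (deriv ψ) r :=
    (contDiff_infty_iff_deriv.1 hψ).2.differentiable (by simp) r
  exact ⟨(h1.congr_of_eventuallyEq (h r hr)).hasDerivAt,
    (h2.congr_of_eventuallyEq (h r hr).deriv).hasDerivAt⟩

theorem pd_eq_radial (hn : 1 ≤ n) (hφ : ContDiff ℝ ∞ φ) (hΦ : ∀ x, φ x = Φ ‖x‖) {x : Eu n}
    (hx : x ≠ 0) (j : Fin n) : pd j φ x = deriv Φ ‖x‖ / ‖x‖ * x j := by
  rw [funext hΦ]
  exact pd_radial hx (hasDerivAt_profile hn hφ hΦ (norm_pos_iff.2 hx)).1 j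

theorem pd_pd_eq_radial (hn : 1 ≤ n) (hφ : ContDiff ℝ ∞ φ) (hΦ : ∀ x, φ x = Φ ‖x‖) {x : Eu n}
    (hx : x ≠ 0) (i j : Fin n) : pd i (pd j φ) x =
      (deriv (deriv Φ) ‖x‖ / ‖x‖ ^ 2 - deriv Φ ‖x‖ / ‖x‖ ^ 3) * (x i * x j) +
        deriv Φ ‖x‖ / ‖x‖ * (if i = j then 1 else 0) := by
  have hx0 : ‖x‖ ≠ 0 := norm_ne_zero_iff.2 hx
  have he : pd j φ =ᶠ[𝓝 x] fun y => deriv Φ ‖y‖ / ‖y‖ * y j := by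
    filter_upwards [isOpen_ne.mem_nhds hx] with y hy using pd_eq_radial hn hφ hΦ hy j
  rw [pd_eq_of_eventuallyEq he]
  have h1 := (hasDerivAt_profile hn hφ hΦ (norm_pos_iff.2 hx)).2.div (hasDerivAt_id ‖x‖) hx0
  have h2 := hasFDerivAt_radial (h := fun r => deriv Φ r / r) hx h1
  have h3 : HasFDerivAt (fun y : Eu n => y j)
      (EuclideanSpace.proj j : Eu n →L[ℝ] ℝ) x :=
    (EuclideanSpace.proj j : Eu n →L[ℝ] ℝ).hasFDerivAt
  have h4 : HasFDerivAt (fun y : Eu n => deriv Φ ‖y‖ / ‖y‖ * y j) _ x := h2.mul h3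
  rw [pd, h4.fderiv]
  have h5 : (EuclideanSpace.proj j : Eu n →L[ℝ] ℝ) (EuclideanSpace.single i (1 : ℝ)) =
      if i = j then 1 else 0 := by
    simp [eq_comm]
  simp only [add_apply, smul_apply, smul_eq_mul,
    innerSL_single, h5, id]
  split_ifs <;> field_simp <;> ring

/-- ∇φ is parallel to x and x·Mx = 0 by skew symmetry. -/
theorem rotD_radial (hn : 1 ≤ n) (hφ : ContDiff ℝ ∞ φ) (hΦ : ∀ x, φ x = Φ ‖x‖)
    {M : Matrix (Fin n) (Fin n) ℝ} (hM : M = -Mᵀ) (x : Eu n) : rotD M φ x = 0 := by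
  rcases eq_or_ne x 0 with rfl | hx
  · simp [rotD, rotField_apply]
  have h1 : ∑ l, ∑ m, M l m * x m * x l = 0 := by
    have h2 : ∑ l, ∑ m, M l m * x m * x l = ∑ l, ∑ m, -(M l m * x m * x l) := by
      conv_lhs => rw [Finset.sum_comm]
      refine Finset.sum_congr rfl fun l _ => Finset.sum_congr rfl fun m _ => ?_
      rw [skew_apply hM m l]
      ring
    simp only [Finset.sum_neg_distrib] at h2
    linarith
  have h3 : rotD M φ x = deriv Φ ‖x‖ / ‖x‖ * ∑ l, ∑ m, M l m * x m * x l := by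
    rw [rotD, Finset.mul_sum]
    refine Finset.sum_congr rfl fun l _ => ?_
    rw [pd_eq_radial hn hφ hΦ hx, rotField_apply, ← Finset.sum_mul]
    ring
  rw [h3, h1, mul_zero]

theorem hessC_radial (hn : 1 ≤ n) (hφ : ContDiff ℝ ∞ φ) (hΦ : ∀ x, φ x = Φ ‖x‖)
    (g : Eu n → EuclideanSpace ℂ (Fin n)) {x : Eu n} (hx : x ≠ 0) :
    hessC φ g x = (deriv (deriv Φ) ‖x‖ / ‖x‖ ^ 2 - deriv Φ ‖x‖ / ‖x‖ ^ 3) * ‖dotC x (g x)‖ ^ 2 +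
      deriv Φ ‖x‖ / ‖x‖ * ‖g x‖ ^ 2 := by
  have h1 : ‖dotC x (g x)‖ ^ 2 =
      ∑ i, ∑ j, x i * x j * ((g x i).re * (g x j).re + (g x i).im * (g x j).im) := by
    rw [← Complex.normSq_eq_norm_sq, Complex.normSq_apply, dotC_re, dotC_im, Finset.sum_mul_sum,
      Finset.sum_mul_sum, ← Finset.sum_add_distrib]
    refine Finset.sum_congr rfl fun i _ => ?_
    rw [← Finset.sum_add_distrib]
    exact Finset.sum_congr rfl fun j _ => by ring
  have h2 : ‖g x‖ ^ 2 = ∑ i, ∑ j, (if i = j then (1 : ℝ) else 0) *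
      ((g x i).re * (g x j).re + (g x i).im * (g x j).im) := by
    rw [EuclideanSpace.norm_sq_eq]
    refine Finset.sum_congr rfl fun i _ => ?_
    rw [← Complex.normSq_eq_norm_sq, Complex.normSq_apply]
    simp
  rw [h1, h2, hessC, Finset.mul_sum, Finset.mul_sum, ← Finset.sum_add_distrib]
  refine Finset.sum_congr rfl fun i _ => ?_
  rw [Finset.mul_sum, Finset.mul_sum, ← Finset.sum_add_distrib]
  refine Finset.sum_congr rfl fun j _ => ?_
  rw [pd_pd_eq_radial hn hφ hΦ hx]
  ring

theorem contDiff_gradient (hφ : ContDiff ℝ ∞ φ) : ContDiff ℝ ∞ (∇ φ) :=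
  (InnerProductSpace.toDual ℝ (Eu n)).symm.contDiff.comp (hφ.fderiv_right (by simp))

/-- φ is even, so ∇φ vanishes at 0; being Lipschitz, it satisfies |∇φ(x)| ≤ C|x|, and ∇φ(x) =
(Φ'(r)/r) x. At x = 0 the quotient is 0 by convention. -/
theorem exists_abs_deriv_div_le (hn : 1 ≤ n) (hφ : ContDiff ℝ ∞ φ) (hφc : HasCompactSupport φ)
    (hΦ : ∀ x, φ x = Φ ‖x‖) : ∃ C, ∀ x : Eu n, |deriv Φ ‖x‖ / ‖x‖| ≤ C := by
  have h0 : ∇ φ 0 = 0 := by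
    have h1 : (fun x => φ (-x)) = φ := by ext x; rw [hΦ, hΦ, norm_neg]
    have hd : HasFDerivAt φ (fderiv ℝ φ 0) (-0) := by
      rw [neg_zero]; exact (hφ.differentiable (by simp) 0).hasFDerivAt
    have h2 : fderiv ℝ φ 0 = fderiv ℝ φ 0 ∘L (-ContinuousLinearMap.id ℝ (Eu n)) := by
      conv_lhs => rw [← h1]
      exact (hd.comp 0 (hasFDerivAt_id (𝕜 := ℝ) (0 : Eu n)).neg).fderiv
    have h3 : fderiv ℝ φ 0 = 0 := by
      ext y
      have h4 := DFunLike.congr_fun h2 y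
      simp only [ContinuousLinearMap.comp_apply, neg_apply, ContinuousLinearMap.id_apply,
        map_neg] at h4
      rw [zero_apply]
      linarith
    rw [gradient, h3, map_zero]
  have hc : HasCompactSupport (∇ φ) := HasCompactSupport.intro hφc.isCompact
    fun x hx => gradient_eq_zero hx
  obtain ⟨C, hC⟩ := ContDiff.lipschitzWith_of_hasCompactSupport hc (contDiff_gradient hφ) (by simp)
  refine ⟨C, fun x => ?_⟩
  rcases eq_or_ne x 0 with rfl | hx
  · simp
  have h1 : ∇ φ x = (deriv Φ ‖x‖ / ‖x‖) • x := by
    ext j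
    rw [gradient_apply_pd, pd_eq_radial hn hφ hΦ hx]
    rfl
  have h2 := hC.dist_le_mul x 0
  rw [h0, dist_zero_right, dist_zero_right, h1, norm_smul] at h2
  exact le_of_mul_le_mul_right h2 (norm_pos_iff.2 hx)

theorem integrable_radial (hn : 1 ≤ n) (hφ : ContDiff ℝ ∞ φ) (hφc : HasCompactSupport φ)
    (hΦ : ∀ x, φ x = Φ ‖x‖) {g : Eu n → EuclideanSpace ℂ (Fin n)} (hg : MemLp g 2 volume) :
    Integrable (fun x => deriv Φ ‖x‖ / ‖x‖ * ‖g x‖ ^ 2) := by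
  obtain ⟨C, hC⟩ := exists_abs_deriv_div_le hn hφ hφc hΦ
  refine Integrable.bdd_mul (c := C) (hg.norm.integrable_sq) ?_ (Eventually.of_forall hC)
  exact (((measurable_deriv Φ).comp measurable_norm).div measurable_norm).aestronglyMeasurable

theorem hessC_ae_eq (hn : 1 ≤ n) (hφ : ContDiff ℝ ∞ φ) (hΦ : ∀ x, φ x = Φ ‖x‖)
    (g : Eu n → EuclideanSpace ℂ (Fin n)) :
    hessC φ g =ᵐ[volume] fun x =>
      (deriv (deriv Φ) ‖x‖ / ‖x‖ ^ 2 - deriv Φ ‖x‖ / ‖x‖ ^ 3) * ‖dotC x (g x)‖ ^ 2 +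
      deriv Φ ‖x‖ / ‖x‖ * ‖g x‖ ^ 2 := by
  have : Nonempty (Fin n) := ⟨⟨0, hn⟩⟩
  have h : ∀ᵐ x : Eu n, x ≠ 0 := compl_mem_ae_iff.2 (measure_singleton 0)
  filter_upwards [h] with x hx using hessC_radial hn hφ hΦ g hx

/-- The singular-looking coefficient is not estimated: the integrand is almost everywhere the
integrable Hessian form minus the other radial term. -/
theorem integrable_radial_dotC (hn : 1 ≤ n) (hφ : ContDiff ℝ ∞ φ) (hφc : HasCompactSupport φ)
    (hΦ : ∀ x, φ x = Φ ‖x‖) {g : Eu n → EuclideanSpace ℂ (Fin n)} (hg : MemLp g 2 volume)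
    (hi : Integrable (hessC φ g)) :
    Integrable fun x => (deriv (deriv Φ) ‖x‖ / ‖x‖ ^ 2 - deriv Φ ‖x‖ / ‖x‖ ^ 3) *
      ‖dotC x (g x)‖ ^ 2 := by
  refine (hi.sub (integrable_radial hn hφ hφc hΦ hg)).congr ?_
  filter_upwards [hessC_ae_eq hn hφ hΦ g] with x hx
  rw [Pi.sub_apply, hx]
  ring

theorem integral_hessC_radial (hn : 1 ≤ n) (hφ : ContDiff ℝ ∞ φ) (hφc : HasCompactSupport φ)
    (hΦ : ∀ x, φ x = Φ ‖x‖) {g : Eu n → EuclideanSpace ℂ (Fin n)} (hg : MemLp g 2 volume)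
    (hi : Integrable (hessC φ g)) :
    ∫ x, hessC φ g x =
      (∫ x, (deriv (deriv Φ) ‖x‖ / ‖x‖ ^ 2 - deriv Φ ‖x‖ / ‖x‖ ^ 3) * ‖dotC x (g x)‖ ^ 2) +
      ∫ x, deriv Φ ‖x‖ / ‖x‖ * ‖g x‖ ^ 2 := by
  rw [integral_congr_ae (hessC_ae_eq hn hφ hΦ g),
    integral_add (integrable_radial_dotC hn hφ hφc hΦ hg hi) (integrable_radial hn hφ hφc hΦ hg)]

theorem inner_gradient (f h : Eu n → ℝ) (x : Eu n) : inner ℝ (∇ f x) (∇ h x) = gradDot f h x := by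
  rw [PiLp.inner_apply]
  refine Finset.sum_congr rfl fun j _ => ?_
  rw [gradient_apply_pd, gradient_apply_pd]
  exact mul_comm _ _

end Radial

/-! ### Solutions are regular curves -/

section Solutions

variable {n : ℕ} {M : Matrix (Fin n) (Fin n) ℝ} {V : Eu n → ℝ} {lam p : ℝ} {T : EReal}
  {u : ℝ → Eu n → ℂ} {t : ℝ}

theorem subcriticalExp_add_one (hp : 1 ≤ p) (hp' : 3 ≤ n → p < 2 * (n : ℝ) / ((n : ℝ) - 2) - 1) :
    SubcriticalExp n (p + 1) :=
  ⟨by linarith, fun h => by linarith [hp' h]⟩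

/-- Subcriticality gives n(p-1) ≤ 4(p+1). For p = 1 the quotient is ∞, the numerator being nonzero.
-/
theorem one_le_timeExponent (hp : 1 ≤ p)
    (hp' : 3 ≤ n → p < 2 * (n : ℝ) / ((n : ℝ) - 2) - 1) :
    1 ≤ ENNReal.ofReal (4 * (p + 1)) / ENNReal.ofReal (n * (p - 1)) := by
  have h4 : 0 < 4 * (p + 1) := by linarith
  rw [ENNReal.le_div_iff_mul_le (Or.inr (ENNReal.ofReal_pos.2 h4).ne')
    (Or.inr ENNReal.ofReal_ne_top), one_mul]
  refine ENNReal.ofReal_le_ofReal ?_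
  rcases le_or_gt n 2 with h | h
  · have : (n : ℝ) ≤ 2 := by exact_mod_cast h
    nlinarith
  · have h3 : (3 : ℝ) ≤ n := by exact_mod_cast h
    have h5 := hp' h
    rw [lt_sub_iff_add_lt, lt_div_iff₀ (by linarith)] at h5
    nlinarith

theorem eLpNorm_weakGrad_le_normH (r : ℝ≥0∞) (f : Eu n → ℂ) :
    eLpNorm (weakGrad f) r volume ≤ normH r f := by
  rw [normH]
  split_ifs
  · exact le_self_add.trans le_self_add
  · exact le_top

theorem timeInterval_Icc {τ : ℝ} (hτ : τ ∈ timeInterval T) : Set.Icc 0 τ ⊆ timeInterval T :=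
  fun _ hs => ⟨hs.1, (EReal.coe_le_coe_iff.2 hs.2).trans_lt hτ.2⟩

/-- [0, T) is open on the right, so derivatives relative to a slightly longer compact interval are
derivatives relative to [0, T). -/
theorem exists_Icc_mem_nhdsWithin (ht : t ∈ timeInterval T) :
    ∃ τ ∈ timeInterval T, t < τ ∧ Set.Icc 0 τ ∈ 𝓝[timeInterval T] t := by
  obtain ⟨τ, h1, h2⟩ := EReal.lt_iff_exists_real_btwn.1 ht.2
  have h1' : t < τ := EReal.coe_lt_coe_iff.1 h1
  refine ⟨τ, ⟨ht.1.trans h1'.le, h2⟩, h1', ?_⟩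
  filter_upwards [eventually_mem_nhdsWithin, mem_nhdsWithin_of_mem_nhds (Iio_mem_nhds h1')]
    with s hs hs' using ⟨hs.1, le_of_lt hs'⟩

theorem uniqueDiffOn_timeInterval : UniqueDiffOn ℝ (timeInterval T) := fun t ht => by
  obtain ⟨τ, hτ, h1, -⟩ := exists_Icc_mem_nhdsWithin ht
  exact ((uniqueDiffOn_Icc (ht.1.trans_lt h1)) t ⟨ht.1, h1.le⟩).mono (timeInterval_Icc hτ)

theorem IsSolution.isRegularCurve (hu : IsSolution M V lam p T u) (hn : 1 ≤ n) (hp : 1 ≤ p)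
    (hp' : 3 ≤ n → p < 2 * (n : ℝ) / ((n : ℝ) - 2) - 1) {I : Set ℝ} (hI : I ⊆ timeInterval T) :
    IsRegularCurve M V lam p I u fun t => weakGrad (u t) where
  isWeakGrad t ht := isWeakGrad_weakGrad (hu.continuous.1 t (hI ht)).2.1
  lpTendsto t ht := (hu.continuous.lpTendsto (hI ht)).1.comp (nhdsWithin_mono t hI)
  lpTendsto_grad t ht := (hu.continuous.lpTendsto (hI ht)).2.comp (nhdsWithin_mono t hI)
  lpTendsto_pow _ hR _ ht := (hu.continuous.lpTendsto_ball hn (subcriticalExp_add_one hp hp') hR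
    (hI ht)).comp (nhdsWithin_mono _ hI)
  hasDerivWithinAt k x _ ht := (hu.equation.hasDerivWithinAt_mol k x (hI ht)).mono hI

end Solutions

end RNLS

end

theorem lemma3p1 (n : ℕ) (hn : 1 ≤ n) (p : ℝ) (hp : 1 ≤ p)
    (hp' : 3 ≤ n → p < 2 * (n : ℝ) / ((n : ℝ) - 2) - 1) (lam : ℝ)
    (M : Matrix (Fin n) (Fin n) ℝ) (hM : M = -Mᵀ)
    (V : EuclideanSpace ℝ (Fin n) → ℝ) (hV : ContDiff ℝ 1 V)
    (T : EReal) (u : ℝ → EuclideanSpace ℝ (Fin n) → ℂ)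
    (hu : RNLS.IsSolution M V lam p T u)
    -- the radial weight `φ(x) = Φ(|x|)`, so that `φ'`, `φ''` are `deriv Φ`, `deriv (deriv Φ)`
    (φ : EuclideanSpace ℝ (Fin n) → ℝ) (hφ : ContDiff ℝ ∞ φ) (hφc : HasCompactSupport φ)
    (Φ : ℝ → ℝ) (hΦ : ∀ x, φ x = Φ ‖x‖)
    (J : ℝ → ℝ) (hJ : J = fun t => ∫ x, φ x * ‖u t x‖ ^ 2)
    (t : ℝ) (ht : t ∈ RNLS.timeInterval T) :
    -- all integrals converge absolutely
    (Integrable (fun x => φ x * ‖u t x‖ ^ 2) ∧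
      Integrable (fun x => starRingEnd ℂ (u t x) * RNLS.dotC (∇ φ x) (RNLS.weakGrad (u t) x)) ∧
      Integrable (fun x => Δ (Δ φ) x * ‖u t x‖ ^ 2) ∧
      Integrable (fun x => Δ φ x * ‖u t x‖ ^ (p + 1)) ∧
      Integrable (fun x => (deriv (deriv Φ) ‖x‖ / ‖x‖ ^ 2 - deriv Φ ‖x‖ / ‖x‖ ^ 3)
        * ‖RNLS.dotC x (RNLS.weakGrad (u t) x)‖ ^ 2) ∧
      Integrable (fun x => deriv Φ ‖x‖ / ‖x‖ * ‖RNLS.weakGrad (u t) x‖ ^ 2) ∧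
      Integrable (fun x => inner ℝ (∇ φ x) (∇ V x) * ‖u t x‖ ^ 2)) ∧
    -- the formula for `J'`
    HasDerivWithinAt J
      (2 * (∫ x, starRingEnd ℂ (u t x) * RNLS.dotC (∇ φ x) (RNLS.weakGrad (u t) x)).im)
      (RNLS.timeInterval T) t ∧
    -- the formula for `J''`
    HasDerivWithinAt (derivWithin J (RNLS.timeInterval T))
      (-(∫ x, Δ (Δ φ) x * ‖u t x‖ ^ 2)
        - 2 * lam * (p - 1) / (p + 1) * (∫ x, Δ φ x * ‖u t x‖ ^ (p + 1))
        + 4 * (∫ x, (deriv (deriv Φ) ‖x‖ / ‖x‖ ^ 2 - deriv Φ ‖x‖ / ‖x‖ ^ 3)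
            * ‖RNLS.dotC x (RNLS.weakGrad (u t) x)‖ ^ 2)
        + 4 * (∫ x, deriv Φ ‖x‖ / ‖x‖ * ‖RNLS.weakGrad (u t) x‖ ^ 2)
        - 2 * (∫ x, inner ℝ (∇ φ x) (∇ V x) * ‖u t x‖ ^ 2))
      (RNLS.timeInterval T) t := by
  open RNLS in
  have hV1 := hV.continuous
  obtain ⟨R, hR0, hR⟩ := hφc.isCompact.isBounded.subset_ball_lt 0 0
  have hB := rotD_radial hn hφ hΦ hM
  have hq := one_le_timeExponent (n := n) hp hp'
  have hlap : Δ φ = lap φ := laplacian_eq_lap hφ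
  have hlap2 : Δ (lap φ) = lap (lap φ) := laplacian_eq_lap (contDiff_lap hφ)
  have hmass : ∀ s ∈ timeInterval T,
      HasDerivWithinAt J (virialK φ (u s) (weakGrad (u s))) (timeInterval T) s := fun s hs => by
    obtain ⟨τ, hτ, h1, h2⟩ := exists_Icc_mem_nhdsWithin hs
    rw [hJ]
    exact ((hu.isRegularCurve hn hp hp' (timeInterval_Icc hτ)).hasDerivWithinAt_mass hV1 hp hM hφ
      hφc hB hR0 hR ⟨hs.1, h1.le⟩).mono_of_mem_nhdsWithin h2
  have hc := hu.isRegularCurve hn hp hp' (subset_refl (timeInterval T))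
  have hf2 := (hc.memLp ht).mono_measure (ballMeas_le (n := n) R)
  have hg2 := (hc.memLp_grad ht).mono_measure (ballMeas_le (n := n) R)
  have hfp := (hc.lpTendsto_pow R hR0 t ht).lim
  have hH := integrable_hessC hφ hR hg2
  have hHol := holderTriple_powNL hp
  refine ⟨⟨?_, integrable_virialK hφ hR hf2 hg2, ?_, ?_,
    integrable_radial_dotC hn hφ hφc hΦ (hc.memLp_grad ht) hH,
    integrable_radial hn hφ hφc hΦ (hc.memLp_grad ht), ?_⟩, hmass t ht, ?_⟩
  · simp only [norm_sq_eq_inner]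
    exact integrable_mul_inner hφ.continuous
      (weight_eq_zero (fun _ hx => image_eq_zero_of_notMem_tsupport hx) hR) hf2 hf2
  · simp only [hlap, hlap2, norm_sq_eq_inner]
    exact integrable_mul_inner (contDiff_lap (contDiff_lap hφ)).continuous
      (weight_eq_zero (fun _ hx => lap_lap_eq_zero hx) hR) hf2 hf2
  · simp only [hlap, norm_rpow_eq_inner hp]
    exact integrable_mul_inner (contDiff_lap hφ).continuous
      (weight_eq_zero (fun _ hx => lap_eq_zero hx) hR) (memLp_powNL hp hfp).1 hfp
  · simp only [inner_gradient, norm_sq_eq_inner]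
    exact integrable_mul_inner (continuous_gradDot (hφ.of_le (by simp)) hV)
      (weight_eq_zero (fun _ hx => gradDot_eq_zero hx V) hR) hf2 hf2
  · obtain ⟨τ, hτ, h1, h2⟩ := exists_Icc_mem_nhdsWithin ht
    have hK := ((hu.isRegularCurve hn hp hp' (timeInterval_Icc hτ)).hasDerivWithinAt_current hV hp
      hM hφ hφc hB hR0 hR hq (hu.memLqLoc τ hτ) (fun s _ => eLpNorm_weakGrad_le_normH _ _)
      ⟨ht.1, h1.le⟩).mono_of_mem_nhdsWithin h2
    -- The first formula holds on all of [0, T), so J' can be replaced by the current before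
    -- differentiating again.
    have hd : ∀ s ∈ timeInterval T, derivWithin J (timeInterval T) s =
        virialK φ (u s) (weakGrad (u s)) := fun s hs =>
      (hmass s hs).derivWithin (uniqueDiffOn_timeInterval s hs)
    refine (hK.congr hd (hd t ht)).congr_deriv ?_
    rw [virialP, integral_hessC_radial hn hφ hφc hΦ (hc.memLp_grad ht) hH]
    simp only [hlap, hlap2, inner_gradient]
    ring
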